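/- **Setting.** Let $d\in\{1,2,3\}$, let $\Omega\subset\mathbb R^d$ be a bounded domain with $\Omega=\operatorname{int}\overline\Omega$, and let $\mathcal T$ be a conforming triangulation of $\Omega$: finitely many open simplices $K$ whose closures cover $\overline\Omega$, such that any two closed simplices meet in a (possibly empty) common subsimplex. Let $\mathcal E$ be the set of $(d-1)$-dimensional faces common to two elements; the other $(d-1)$-dimensional faces make up $\partial\Omega$. Write $h(x)=\max\{h_K: x\in\overline K\}$ with $h_K=\operatorname{diam}K$. For $p\ge 0$ let $\mathbb V$ be the space of functions that are polynomials of degree at most $p$ on each $K$, $\mathbb V_0\subset\mathbb V$ the functions with zero trace on $\partial\Omega$, and $\mathbb V_n\subset\mathbb V^d$ the fields with zero normal trace on $\partial\Omega$. On a face common to $K_1,K_2$, with outward unit normals $n_{K_i}$, set $\{\phi\}=\frac12(\phi|_{K_1}+\phi|_{K_2})$, $[\![\phi]\!]=\phi|_{K_1}n_{K_1}+\phi|_{K_2}n_{K_2}$ for scalar $\phi$, $[\![w]\!]=w|_{K_1}\cdot n_{K_1}+w|_{K_2}\cdot n_{K_2}$ and $[\![w]\!]_\otimes=w|_{K_1}\otimes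 n_{K_1}+w|_{K_2}\otimes n_{K_2}$ for vector fields $w$; on $\partial\Omega$ set $\{\phi\}=\phi$, $[\![\phi]\!]=\phi n$, $[\![w]\!]=w\cdot n$, $[\![w]\!]_\otimes=w\otimes n$. Derivatives in space are taken elementwise. Let $W\in C^1(\mathbb R)$, $\gamma\in\mathbb R$, $\mu\ge0$, $T>0$, and let $B_h$ be a form on $\mathbb V_0^d\times\mathbb V_0^d$. **Scheme.** Find $\rho_h,\tau_h:[0,T]\to\mathbb V$, $v_h:[0,T]\to\mathbb V_0^d$, $q_h:[0,T]\to\mathbb V_n$, with $\rho_h$ and $v_h$ differentiable in time, such that for all $t\in[0,T]$, $\Psi,\Xi\in\mathbb V$, $X\in\mathbb V_0^d$, $Z\in\mathbb V_n$ $$\begin{aligned} 0&=\int_\Omega(\partial_t\rho_h+\operatorname{div}(\rho_hv_h))\Psi\,dx+\int_{\mathcal E}F_1\,ds,\qquad F_1=-[\![\rho_hv_h]\!]\{\Psi\},\\ 0&=\int_\Omega\bigl(\rho_h\partial_tv_h+\operatorname{div}(\rho_hv_h\otimes v_h)-\operatorname{div}(\rho_hv_h)v_h+\rho_h\nabla\tau_h-\tfrac12\rho_h\nabla|v_h|^2\bigr)\cdot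 X\,dx+\int_{\mathcal E}F_2\,ds+\mu B_h(v_h,X),\\ &\hspace{20em} F_2=-[\![\tau_h]\!]\cdot\{\rho_hX\},\\ 0&=\int_\Omega\bigl(\tau_h-W'(\rho_h)+\gamma\operatorname{div}q_h-\tfrac12|v_h|^2\bigr)\Xi\,dx+\int_{\mathcal E}F_3\,ds,\qquad F_3=-\gamma[\![q_h]\!]\{\Xi\},\\ 0&=\int_\Omega(q_h-\nabla\rho_h)\cdot Z\,dx+\int_{\mathcal E}F_4\,ds,\qquad F_4=[\![\rho_h]\!]\cdot\{Z\}. \end{aligned}$$ The scheme is called *consistent* if $F_1,\dots,F_4$ vanish almost everywhere on $\mathcal E$, for all test functions, whenever $\rho_h,v_h,\tau_h,q_h$ are replaced by functions that are smooth in $\Omega$. **Statement.** 1. Let $\mu=0$. The scheme is consistent, and each of its solutions satisfies, for all $t\in[0,T]$ (with one-sided derivatives at $0$ and $T$), $\frac{d}{dt}\int_\Omega\rho_h\,dx=0$ and $$\frac{d}{dt}\int_\Omega W(\rho_h)+\tfrac12\rho_h|v_h|^2+\tfrac\gamma2|q_h|^2\,dx=0 .$$ 2. Let $B_h$ be the symmetric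 interior penalty form with parameter $\sigma$, $$B_h(u,w)=\int_\Omega Du:Dw\,dx-\int_{\mathcal E\cup\partial\Omega}\{Dw\}:[\![u]\!]_\otimes+\{Du\}:[\![w]\!]_\otimes-\frac\sigma h[\![u]\!]_\otimes:[\![w]\!]_\otimes\,ds .$$ For every $\kappa>0$ there are $\sigma_0,c>0$, depending only on $d,p,\kappa$, such that the following holds for all $\Omega$ and $\mathcal T$ as above which are shape regular with constant $\kappa$ (each $K$ contains a ball of radius $h_K/\kappa$, and $h_K\le\kappa h_J$ whenever $K,J$ share a face) and all $\sigma\ge\sigma_0$. The form $B_h$ is coercive: $$B_h(w,w)\ge c\Bigl(\int_\Omega|Dw|^2dx+\int_{\mathcal E\cup\partial\Omega}h^{-1}|[\![w]\!]_\otimes|^2ds\Bigr)\qquad\text{for all }w\in\mathbb V_0^d ,$$ and for $\mu>0$ the scheme is consistent and each of its solutions satisfies, for all $t\in[0,T]$, $\frac{d}{dt}\int_\Omega\rho_h\,dx=0$ and $$\frac{d}{dt}\int_\Omega W(\rho_h)+\tfrac12\rho_h|v_h|^2+\tfrac\gamma2|q_h|^2\,dx=-\mu B_h(v_h,v_h)\le0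 .$$ -/

import Mathlib

open MeasureTheory Set
open scoped ContDiff Matrix RealInnerProductSpace Topology

namespace NSK

noncomputable section

/-- Euclidean space `ℝ^d`. -/
abbrev Space (d : ℕ) : Type := EuclideanSpace ℝ (Fin d)

/-! ### Triangulations -/

/-- A conforming triangulation of `Ω ⊆ ℝ^d`: finitely many `d`-simplices, each given by the set of
its `d + 1` affinely independent vertices, such that any two closed simplices meet in the (possibly
empty) closed simplex spanned by their common vertices and the closed simplices cover the closure
of `Ω`. -/
structure Triangulation (d : ℕ) (Ω : Set (Space d)) where
  /-- the vertex sets of the elements -/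
  cells : Finset (Finset (Space d))
  card_eq : ∀ K ∈ cells, K.card = d + 1
  indep : ∀ K ∈ cells, AffineIndependent ℝ ((↑) : K → Space d)
  conforming : ∀ K ∈ cells, ∀ J ∈ cells,
    convexHull ℝ (K : Set (Space d)) ∩ convexHull ℝ (J : Set (Space d)) =
      convexHull ℝ ((K : Set (Space d)) ∩ (J : Set (Space d)))
  covers : ⋃ K ∈ cells, convexHull ℝ (K : Set (Space d)) = closure Ω

variable {d : ℕ} {Ω : Set (Space d)}

/-- The closed simplex spanned by a finite set of vertices (an element or a face). -/
def hull (S : Finset (Space d)) : Set (Space d) := convexHull ℝ (S : Set (Space d))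

/-- The open element with vertex set `K`. -/
def openCell (K : Finset (Space d)) : Set (Space d) := interior (hull K)

namespace Triangulation

open Classical in
/-- The `(d-1)`-dimensional faces of all elements (as vertex sets). -/
def faces (M : Triangulation d Ω) : Finset (Finset (Space d)) :=
  M.cells.biUnion fun K => K.powersetCard d

open Classical in
/-- The elements that have `F` as a face. -/
def cellsOf (M : Triangulation d Ω) (F : Finset (Space d)) : Finset (Finset (Space d)) :=
  M.cells.filter fun K => F ⊆ K

open Classical in
/-- The skeleton `ℰ`: the common interfaces of two elements. -/
def interiorFaces (M : Triangulation d Ω) : Finset (Finset (Space d)) :=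
  M.faces.filter fun F => 2 ≤ (M.cellsOf F).card

open Classical in
/-- The faces that lie on `∂Ω`: those which belong to one element only. -/
def boundaryFaces (M : Triangulation d Ω) : Finset (Finset (Space d)) :=
  M.faces.filter fun F => (M.cellsOf F).card = 1

/-- The meshsize function `h(x) = max {h_K : x in the closure of K}`, with `h_K = diam K`. -/
def meshSize (M : Triangulation d Ω) (x : Space d) : ℝ :=
  sSup {h | ∃ K ∈ M.cells, x ∈ hull K ∧ h = Metric.diam (hull K)}

/-- Shape regularity with constant `κ`: every element `K` contains a ball of radius `h_K / κ`, and
the diameters of two elements with a common face differ at most by the factor `κ`. In dimension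
`d ≥ 2` the second condition follows from the first one (with the same `κ`); in dimension one,
where every segment satisfies the first condition with `κ = 2`, it is the usual one. -/
structure ShapeRegular (M : Triangulation d Ω) (κ : ℝ) : Prop where
  ball_subset : ∀ K ∈ M.cells, ∃ c, Metric.ball c (Metric.diam (hull K) / κ) ⊆ hull K
  neighbours : ∀ F ∈ M.interiorFaces, ∀ K ∈ M.cellsOf F, ∀ J ∈ M.cellsOf F,
    Metric.diam (hull K) ≤ κ * Metric.diam (hull J)

/-- `∫_ℰ f ds`; the surface measure is the `(d-1)`-dimensional Hausdorff measure, normalised so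
that it agrees with Lebesgue measure on `(d-1)`-planes (counting measure if `d = 1`). -/
def intE (M : Triangulation d Ω) (f : Finset (Space d) → Space d → ℝ) : ℝ :=
  ∑ F ∈ M.interiorFaces, ∫ x in hull F, f F x ∂μHE[d - 1]

/-- `∫_{ℰ ∪ ∂Ω} f ds`. -/
def intEB (M : Triangulation d Ω) (f : Finset (Space d) → Space d → ℝ) : ℝ :=
  M.intE f + ∑ F ∈ M.boundaryFaces, ∫ x in hull F, f F x ∂μHE[d - 1]

end Triangulation

/-! ### Normals, traces, jumps and averages -/

/-- `n` is the outward unit normal to the simplex `K` on its face `F`. -/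
def IsOutwardNormal (K F : Finset (Space d)) (n : Space d) : Prop :=
  ‖n‖ = 1 ∧ (∀ x ∈ F, ∀ y ∈ F, ⟪n, y - x⟫ = 0) ∧ ∀ a ∈ K, a ∉ F → ∀ x ∈ F, ⟪n, a - x⟫ < 0

/-- The outward unit normal `n_K` on the face `F` of `K`; it is characterised by
`existsUnique_isOutwardNormal`. -/
def normal (K F : Finset (Space d)) : Space d := Classical.epsilon (IsOutwardNormal K F)

/-- The trace on `∂K` of a function from the inside of the element `K`: its limit along the open
element. -/
def trace {Y : Type*} [TopologicalSpace Y] (K : Finset (Space d)) (φ : Space d → Y) :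
    Space d → Y :=
  extendFrom (openCell K) φ

namespace Triangulation

variable (M : Triangulation d Ω) (F : Finset (Space d))

/-- Average of a (scalar, vector or matrix valued) function on a face: `½ (φ|_{K₁} + φ|_{K₂})` on an
interior face and `φ|_K` on a boundary face. -/
def avg {Y : Type*} [TopologicalSpace Y] [AddCommGroup Y] [Module ℝ Y] (φ : Space d → Y)
    (x : Space d) : Y :=
  ((M.cellsOf F).card : ℝ)⁻¹ • ∑ K ∈ M.cellsOf F, trace K φ x

/-- Jump of a scalar function: `φ|_{K₁} n_{K₁} + φ|_{K₂} n_{K₂}`, and `φ n` on a boundary face. -/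
def jump (φ : Space d → ℝ) (x : Space d) : Space d :=
  ∑ K ∈ M.cellsOf F, trace K φ x • normal K F

/-- Jump of a vector field: `v|_{K₁} · n_{K₁} + v|_{K₂} · n_{K₂}`, and `v · n` on a boundary face. -/
def jumpVec (v : Space d → Space d) (x : Space d) : ℝ :=
  ∑ K ∈ M.cellsOf F, ⟪trace K v x, normal K F⟫

/-- Tensor jump of a vector field: `v|_{K₁} ⊗ n_{K₁} + v|_{K₂} ⊗ n_{K₂}`, and `v ⊗ n` on a boundary
face. -/
def tensorJump (v : Space d → Space d) (x : Space d) : Matrix (Fin d) (Fin d) ℝ :=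
  ∑ K ∈ M.cellsOf F, Matrix.vecMulVec (trace K v x).ofLp (normal K F).ofLp

end Triangulation

/-! ### Differential operators (used at points of open elements) -/

/-- The divergence `∑ i, ∂_i v_i`. -/
def div (v : Space d → Space d) (x : Space d) : ℝ :=
  ∑ i, (fderiv ℝ v x (EuclideanSpace.single i 1)) i

/-- The divergence of a matrix field, taken row by row. -/
def divMat (A : Space d → Matrix (Fin d) (Fin d) ℝ) (x : Space d) : Space d :=
  WithLp.toLp 2 fun i => div (fun y => WithLp.toLp 2 (A y i)) x

/-- The Jacobian `(D v)_{ij} = ∂_j v_i`. -/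
def jacobian (v : Space d → Space d) (x : Space d) : Matrix (Fin d) (Fin d) ℝ :=
  Matrix.of fun i j => (fderiv ℝ v x (EuclideanSpace.single j 1)) i

/-- The Frobenius inner product `X : Y = tr (Xᵀ Y)`. -/
def frob (X Y : Matrix (Fin d) (Fin d) ℝ) : ℝ := (Xᵀ * Y).trace

/-! ### Discontinuous finite element spaces -/

namespace Triangulation

/-- `𝕍_h`: functions which on every open element coincide with a polynomial of degree at
most `p`. -/
def fes (M : Triangulation d Ω) (p : ℕ) : Set (Space d → ℝ) :=
  {φ | ∀ K ∈ M.cells, ∃ P : MvPolynomial (Fin d) ℝ, P.totalDegree ≤ p ∧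
    ∀ x ∈ openCell K, φ x = MvPolynomial.eval (fun i => x i) P}

/-- The elements of `𝕍_h` with vanishing trace on `∂Ω`. -/
def fesZero (M : Triangulation d Ω) (p : ℕ) : Set (Space d → ℝ) :=
  {φ | φ ∈ M.fes p ∧ ∀ F ∈ M.boundaryFaces, ∀ K ∈ M.cellsOf F, ∀ x ∈ hull F, trace K φ x = 0}

/-- `(𝕍_h ∩ H¹₀)^d`. -/
def fesZeroVec (M : Triangulation d Ω) (p : ℕ) : Set (Space d → Space d) :=
  {v | ∀ i, (fun x => v x i) ∈ M.fesZero p}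

/-- The vector fields in `𝕍_h^d` with vanishing normal trace on `∂Ω`. -/
def fesNormal (M : Triangulation d Ω) (p : ℕ) : Set (Space d → Space d) :=
  {v | (∀ i, (fun x => v x i) ∈ M.fes p) ∧
    ∀ F ∈ M.boundaryFaces, ∀ K ∈ M.cellsOf F, ∀ x ∈ hull F, ⟪trace K v x, normal K F⟫ = 0}

end Triangulation

/-! ### Generic discontinuous Galerkin schemes -/

/-- Elementwise fluxes `F_i (ρ, v, τ, q, test function)`, as functions on the faces of the
triangulation. -/
structure Fluxes (d : ℕ) where
  F₁ : (Space d → ℝ) → (Space d → Space d) → (Space d → ℝ) → (Space d → Space d) →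
    (Space d → ℝ) → Finset (Space d) → Space d → ℝ
  F₂ : (Space d → ℝ) → (Space d → Space d) → (Space d → ℝ) → (Space d → Space d) →
    (Space d → Space d) → Finset (Space d) → Space d → ℝ
  F₃ : (Space d → ℝ) → (Space d → Space d) → (Space d → ℝ) → (Space d → Space d) →
    (Space d → ℝ) → Finset (Space d) → Space d → ℝ
  F₄ : (Space d → ℝ) → (Space d → Space d) → (Space d → ℝ) → (Space d → Space d) →
    (Space d → Space d) → Finset (Space d) → Space d → ℝ

/-- Consistency: the fluxes vanish identically (almost everywhere on the skeleton, for all test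
functions) when they are evaluated at functions `ρ, v, τ, q` which are smooth in `Ω`. -/
def IsConsistent (M : Triangulation d Ω) (p : ℕ) (f : Fluxes d) : Prop :=
  ∀ (ρ τ : Space d → ℝ) (v q : Space d → Space d),
    ContDiffOn ℝ ∞ ρ Ω → ContDiffOn ℝ ∞ τ Ω → ContDiffOn ℝ ∞ v Ω → ContDiffOn ℝ ∞ q Ω →
    ∀ F ∈ M.interiorFaces,
      (∀ Ψ ∈ M.fes p, ∀ᵐ x ∂(μHE[d - 1]).restrict (hull F), f.F₁ ρ v τ q Ψ F x = 0) ∧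
      (∀ χ ∈ M.fesZeroVec p, ∀ᵐ x ∂(μHE[d - 1]).restrict (hull F), f.F₂ ρ v τ q χ F x = 0) ∧
      (∀ Ξ ∈ M.fes p, ∀ᵐ x ∂(μHE[d - 1]).restrict (hull F), f.F₃ ρ v τ q Ξ F x = 0) ∧
      (∀ ζ ∈ M.fesNormal p, ∀ᵐ x ∂(μHE[d - 1]).restrict (hull F), f.F₄ ρ v τ q ζ F x = 0)

/-- `(ρ, v, τ, q)` solves, on the time interval `[0, T]`, the spatially discrete scheme with fluxes
`f`, potential `W`, capillarity `γ`, viscosity `μ` and discretisation `B` of the Laplacian. Only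
`ρ` and `v` are required to be differentiable in time (pointwise in the open elements, which for
functions with values in a finite element space is differentiability in that space). -/
structure IsSolution (M : Triangulation d Ω) (p : ℕ) (f : Fluxes d) (W : ℝ → ℝ) (γ μ : ℝ)
    (B : (Space d → Space d) → (Space d → Space d) → ℝ) (T : ℝ)
    (ρ : ℝ → Space d → ℝ) (v : ℝ → Space d → Space d)
    (τ : ℝ → Space d → ℝ) (q : ℝ → Space d → Space d) : Prop where
  rho_mem : ∀ t ∈ Icc 0 T, ρ t ∈ M.fes p
  v_mem : ∀ t ∈ Icc 0 T, v t ∈ M.fesZeroVec p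
  tau_mem : ∀ t ∈ Icc 0 T, τ t ∈ M.fes p
  q_mem : ∀ t ∈ Icc 0 T, q t ∈ M.fesNormal p
  rho_diff : ∀ t ∈ Icc 0 T, ∀ K ∈ M.cells, ∀ x ∈ openCell K,
    DifferentiableWithinAt ℝ (fun s => ρ s x) (Icc 0 T) t
  v_diff : ∀ t ∈ Icc 0 T, ∀ K ∈ M.cells, ∀ x ∈ openCell K,
    DifferentiableWithinAt ℝ (fun s => v s x) (Icc 0 T) t
  mass_eq : ∀ t ∈ Icc 0 T, ∀ Ψ ∈ M.fes p,
    0 = (∫ x in Ω, (derivWithin (fun s => ρ s x) (Icc 0 T) t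
            + div (fun y => ρ t y • v t y) x) * Ψ x)
      + M.intE (f.F₁ (ρ t) (v t) (τ t) (q t) Ψ)
  momentum_eq : ∀ t ∈ Icc 0 T, ∀ χ ∈ M.fesZeroVec p,
    0 = (∫ x in Ω, ⟪ρ t x • derivWithin (fun s => v s x) (Icc 0 T) t
            + divMat (fun y => ρ t y • Matrix.vecMulVec (v t y).ofLp (v t y).ofLp) x
            - div (fun y => ρ t y • v t y) x • v t x
            + ρ t x • gradient (τ t) x
            - (1 / 2 * ρ t x : ℝ) • gradient (fun y => ‖v t y‖ ^ 2) x, χ x⟫)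
      + M.intE (f.F₂ (ρ t) (v t) (τ t) (q t) χ)
      + μ * B (v t) χ
  tau_eq : ∀ t ∈ Icc 0 T, ∀ Ξ ∈ M.fes p,
    0 = (∫ x in Ω, (τ t x - deriv W (ρ t x) + γ * div (q t) x - 1 / 2 * ‖v t x‖ ^ 2) * Ξ x)
      + M.intE (f.F₃ (ρ t) (v t) (τ t) (q t) Ξ)
  q_eq : ∀ t ∈ Icc 0 T, ∀ ζ ∈ M.fesNormal p,
    0 = (∫ x in Ω, ⟪q t x - gradient (ρ t) x, ζ x⟫)
      + M.intE (f.F₄ (ρ t) (v t) (τ t) (q t) ζ)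

/-- The total mass `∫_Ω ρ dx`. -/
def mass (Ω : Set (Space d)) (ρ : Space d → ℝ) : ℝ := ∫ x in Ω, ρ x

/-- The total energy `∫_Ω W(ρ) + ½ ρ |v|² + ½ γ |q|² dx`. -/
def energy (Ω : Set (Space d)) (W : ℝ → ℝ) (γ : ℝ) (ρ : Space d → ℝ) (v q : Space d → Space d) :
    ℝ :=
  ∫ x in Ω, (W (ρ x) + 1 / 2 * ρ x * ‖v x‖ ^ 2 + γ / 2 * ‖q x‖ ^ 2)

/-! ### The scheme with central fluxes and the symmetric interior penalty form -/

namespace Triangulation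

/-- The fluxes `-[[ρ v]]{Ψ}`, `-[[τ]]·{ρ χ}`, `-γ [[q]]{Ξ}` and `[[ρ]]·{ζ}`. -/
def centralFluxes (M : Triangulation d Ω) (γ : ℝ) : Fluxes d where
  F₁ ρ v _ _ Ψ F x := -(M.jumpVec F (fun y => ρ y • v y) x * M.avg F Ψ x)
  F₂ ρ _ τ _ χ F x := -⟪M.jump F τ x, M.avg F (fun y => ρ y • χ y) x⟫
  F₃ _ _ _ q Ξ F x := -(γ * M.jumpVec F q x * M.avg F Ξ x)
  F₄ ρ _ _ _ ζ F x := ⟪M.jump F ρ x, M.avg F ζ x⟫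

/-- The symmetric interior penalty form with penalty parameter `σ` for the componentwise
Laplacian. -/
def sip (M : Triangulation d Ω) (σ : ℝ) (u w : Space d → Space d) : ℝ :=
  (∫ x in Ω, frob (jacobian u x) (jacobian w x))
    - M.intEB fun F x =>
        frob (M.avg F (jacobian w) x) (M.tensorJump F u x)
          + frob (M.avg F (jacobian u) x) (M.tensorJump F w x)
          - σ / M.meshSize x * frob (M.tensorJump F u x) (M.tensorJump F w x)

/-- The squared discontinuous Galerkin energy norm `‖D w‖² + ∫_{ℰ ∪ ∂Ω} h⁻¹ |[[w]]_⊗|² ds`. -/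
def dgNormSq (M : Triangulation d Ω) (w : Space d → Space d) : ℝ :=
  (∫ x in Ω, frob (jacobian w x) (jacobian w x))
    + M.intEB fun F x => (M.meshSize x)⁻¹ * frob (M.tensorJump F w x) (M.tensorJump F w x)

/-- `B` is coercive on `(𝕍_h ∩ H¹₀)^d` with constant `c` in the discontinuous Galerkin energy
norm. -/
def IsCoercive (M : Triangulation d Ω) (p : ℕ) (B : (Space d → Space d) → (Space d → Space d) → ℝ)
    (c : ℝ) : Prop :=
  ∀ w ∈ M.fesZeroVec p, c * M.dgNormSq w ≤ B w w

end Triangulation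

/-- Existence and uniqueness of the outward unit normal on a face of a `d`-simplex. -/
theorem existsUnique_isOutwardNormal (K F : Finset (Space d)) (hK : K.card = d + 1)
    (hind : AffineIndependent ℝ ((↑) : K → Space d)) (hFK : F ⊆ K) (hF : F.card = d)
    (hd : 1 ≤ d) : ∃! n, IsOutwardNormal K F n := by
  classical
  obtain ⟨x₀, hx₀⟩ : F.Nonempty := Finset.card_pos.1 (by omega)
  obtain ⟨a, haK, haF⟩ : ∃ a ∈ K, a ∉ F := by
    by_contra! h
    have := Finset.card_le_card (show K ⊆ F from h)
    omega
  have huniq : ∀ b ∈ K, b ∉ F → b = a := by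
    intro b hbK hbF
    by_contra hba
    have h : insert a (insert b F) ⊆ K := by
      intro z hz
      simp only [Finset.mem_insert] at hz
      rcases hz with rfl | rfl | hz
      exacts [haK, hbK, hFK hz]
    have := Finset.card_le_card h
    rw [Finset.card_insert_of_notMem (by simp [haF, Ne.symm hba]),
      Finset.card_insert_of_notMem hbF] at this
    omega
  have hFind : AffineIndependent ℝ ((↑) : F → Space d) :=
    hind.mono (s := (F : Set (Space d))) (t := (K : Set (Space d))) (by exact_mod_cast hFK)
  set S : Submodule ℝ (Space d) := vectorSpan ℝ (F : Set (Space d)) with hS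
  have hfr : Module.finrank ℝ S + 1 = d := by
    have : Nonempty F := ⟨⟨x₀, hx₀⟩⟩
    have h := hFind.finrank_vectorSpan_add_one
    rw [Fintype.card_coe, hF] at h
    have h' : Set.range ((↑) : F → Space d) = (F : Set (Space d)) := Subtype.range_coe
    rwa [h'] at h
  have hfr' : Module.finrank ℝ Sᗮ = 1 := by
    have h := S.finrank_add_finrank_orthogonal
    rw [finrank_euclideanSpace_fin] at h
    omega
  have hmem : ∀ n : Space d, (∀ x ∈ F, ∀ y ∈ F, ⟪n, y - x⟫ = 0) → n ∈ Sᗮ := by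
    intro n hn
    have : S ≤ (Submodule.span ℝ {n})ᗮ := by
      rw [hS, vectorSpan, Submodule.span_le]
      rintro _ ⟨y, hy, x, hx, rfl⟩
      exact Submodule.mem_orthogonal_singleton_iff_inner_right.2 (hn x hx y hy)
    exact (Submodule.le_orthogonal_iff_le_orthogonal.1 this) (Submodule.mem_span_singleton_self n)
  have hin : ∀ n ∈ Sᗮ, ∀ x ∈ F, ∀ y ∈ F, ⟪n, y - x⟫ = 0 := by
    intro n hn x hx y hy
    rw [real_inner_comm]
    exact (Submodule.mem_orthogonal S n).1 hn _ (vsub_mem_vectorSpan ℝ hy hx)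
  have haS : a - x₀ ∉ S := by
    intro h
    have h1 : a ∈ affineSpan ℝ (F : Set (Space d)) := by
      have := AffineSubspace.vadd_mem_of_mem_direction
        (s := affineSpan ℝ (F : Set (Space d))) (by rw [direction_affineSpan]; exact h)
        (mem_affineSpan ℝ hx₀)
      simpa using this
    have h2 := hind.notMem_affineSpan_sdiff ⟨a, haK⟩ Set.univ
    apply h2
    refine affineSpan_mono ℝ ?_ h1
    intro y hy
    refine ⟨⟨y, hFK hy⟩, ⟨trivial, ?_⟩, rfl⟩
    rintro h
    have h3 : y = a := congrArg Subtype.val h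
    exact haF (h3 ▸ hy)
  obtain ⟨n₀, hn₀, hspan⟩ := finrank_eq_one_iff'.1 hfr'
  have hc : ⟪(n₀ : Space d), a - x₀⟫ ≠ 0 := by
    intro h
    apply haS
    rw [← S.orthogonal_orthogonal, Submodule.mem_orthogonal]
    intro u hu
    obtain ⟨c, hc⟩ := hspan ⟨u, hu⟩
    have : u = c • (n₀ : Space d) := by
      simpa using (congrArg Subtype.val hc).symm
    rw [this, inner_smul_left, h, mul_zero]
  have hn₀' : ‖(n₀ : Space d)‖ ≠ 0 := by simpa using hn₀
  -- a multiple of `n₀` is the outward normal iff the factor has the right modulus and sign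
  have hsmul : ∀ c : ℝ, IsOutwardNormal K F (c • (n₀ : Space d)) ↔
      |c| * ‖(n₀ : Space d)‖ = 1 ∧ c * ⟪(n₀ : Space d), a - x₀⟫ < 0 := by
    intro c
    unfold IsOutwardNormal
    rw [norm_smul, Real.norm_eq_abs]
    constructor
    · rintro ⟨h1, -, h3⟩
      refine ⟨h1, ?_⟩
      have := h3 a haK haF x₀ hx₀
      rwa [real_inner_smul_left] at this
    · rintro ⟨h1, h2⟩
      refine ⟨h1, hin _ (Submodule.smul_mem _ _ n₀.2), ?_⟩
      intro b hbK hbF x hx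
      rw [huniq b hbK hbF, real_inner_smul_left]
      have h4 := hin _ n₀.2 x hx x₀ hx₀
      have h5 : ⟪(n₀ : Space d), a - x⟫ = ⟪(n₀ : Space d), a - x₀⟫ := by
        rw [show a - x = (a - x₀) + (x₀ - x) by abel, inner_add_right, h4, add_zero]
      rwa [h5]
  have hex : ∃ c : ℝ, |c| * ‖(n₀ : Space d)‖ = 1 ∧ c * ⟪(n₀ : Space d), a - x₀⟫ < 0 := by
    rcases lt_or_gt_of_ne hc with h | h
    · refine ⟨‖(n₀ : Space d)‖⁻¹, ?_, mul_neg_of_pos_of_neg (by positivity) h⟩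
      rw [abs_of_nonneg (by positivity), inv_mul_cancel₀ hn₀']
    · refine ⟨-‖(n₀ : Space d)‖⁻¹, ?_, mul_neg_of_neg_of_pos (neg_lt_zero.2 (by positivity)) h⟩
      rw [abs_neg, abs_of_nonneg (by positivity), inv_mul_cancel₀ hn₀']
  obtain ⟨c, hc1⟩ := hex
  refine ⟨c • (n₀ : Space d), (hsmul c).2 hc1, ?_⟩
  intro n hn
  obtain ⟨e, he⟩ := hspan ⟨n, hmem n hn.2.1⟩
  have hne : n = e • (n₀ : Space d) := by simpa using (congrArg Subtype.val he).symm
  have he1 := (hsmul e).1 (hne ▸ hn)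
  rw [hne]
  congr 1
  have habs : |e| = |c| := mul_right_cancel₀ hn₀' (he1.1.trans hc1.1.symm)
  rcases abs_eq_abs.1 habs with h | h
  · exact h
  · exfalso
    have h1 := he1.2
    rw [h] at h1
    linarith [hc1.2]

/-- The chosen normal vector is the outward unit normal. -/
theorem isOutwardNormal_normal (K F : Finset (Space d)) (hK : K.card = d + 1)
    (hind : AffineIndependent ℝ ((↑) : K → Space d)) (hFK : F ⊆ K) (hF : F.card = d)
    (hd : 1 ≤ d) : IsOutwardNormal K F (normal K F) :=
  Classical.epsilon_spec (existsUnique_isOutwardNormal K F hK hind hFK hF hd).exists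

end

end NSK

/-! The energy law follows by testing each equation with its conjugate quantity: the mass balance
with `τ`, the momentum balance with `v`, the equation for `τ` with `∂ₜρ`, and the time derivative of
the equation for `q` with `q`. The convective terms cancel pointwise (`inner_divMat_self`). The
remaining volume terms are the energy rate up to two elementwise integrations by parts, of `τ`
against `ρ v` and of `∂ₜρ` against `q`. If `w` has zero normal trace on `∂Ω`, summing the divergence
theorem over the elements gives `∫_Ω ∇φ·w + φ div w = ∫_ℰ [[φ]]·{w} + [[w]]{φ}`
(`integral_by_parts`). The four fluxes are these face terms, so everything cancels except `-μ B(v,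
v)` (`setIntegral_energy_rate`). The test function `1` in the mass balance gives conservation of
mass (`setIntegral_mass_rate`).

The time derivative of `q` has to be produced, since only `ρ` and `v` are assumed differentiable.
The curve `ρ` stays in a finite-dimensional space and can be written as `∑ aᵢ(t) ρ(sᵢ)` with fixed
times `sᵢ` and differentiable coefficients (`exists_curve_expansion`). The equation for `q` is
linear and determines `q` from `ρ`, hence `q(t) = ∑ aᵢ(t) q(sᵢ)` (`expansion_of_gradForm`). In
particular `q` is differentiable, and its derivative satisfies the differentiated equation.

The face calculus rests on two geometric facts. One is the divergence theorem on a simplex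
(`setIntegral_div_hull`): the fundamental theorem of calculus along an edge, combined with "volume
is base times height" for determinants. The other is that near a relative interior point of a face a
simplex is a half space (`exists_ball_inter_subset_hull`). With conformity this shows that an
interior face has exactly two elements, with opposite normals, and that its relative interior lies
in `Ω`. Consistency follows: a function continuous in `Ω` has equal traces from both sides, so its
jumps vanish.

Coercivity is the classical argument. Young's inequality splits the consistency terms of the penalty
form into `h |{Dw}|²` and `h⁻¹ |[[w]]|²` on the faces. The discrete trace inequality
(`exists_trace_const`) bounds the first by the volume integral of `|Dw|²`, and a large `σ` absorbs
the second. The trace inequality holds on the reference simplex by compactness. It scales to any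
simplex because volume over face area is proportional to the height, which is at least the radius of
an inscribed ball. -/

namespace NSK

noncomputable section

/-! ### Parametrised simplices -/

/-- The reference simplex. -/
def refSimplex (n : ℕ) : Set (Space n) := {y | (∀ i, 0 ≤ y i) ∧ ∑ i, y i ≤ 1}

/-- The linear map which sends the standard basis to the edges emanating from `a 0`. -/
def edgeMap {n d : ℕ} (a : Fin (n + 1) → Space d) : Space n →ₗ[ℝ] Space d :=
  (Fintype.linearCombination ℝ (fun i : Fin n => a i.succ - a 0)) ∘ₗ
    (WithLp.linearEquiv 2 ℝ (Fin n → ℝ)).toLinearMap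

/-- The affine parametrisation of a simplex by the reference simplex. -/
def param {n d : ℕ} (a : Fin (n + 1) → Space d) (y : Space n) : Space d := a 0 + edgeMap a y

variable {n d : ℕ}

theorem edgeMap_apply (a : Fin (n + 1) → Space d) (y : Space n) :
    edgeMap a y = ∑ i, y i • (a i.succ - a 0) := by
  simp [edgeMap, Fintype.linearCombination_apply]

theorem edgeMap_single (a : Fin (n + 1) → Space d) (i : Fin n) :
    edgeMap a (EuclideanSpace.single i 1) = a i.succ - a 0 := by
  rw [edgeMap_apply, Finset.sum_eq_single i]
  · simp
  · intro j _ hj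
    simp [hj]
  · simp

theorem continuous_edgeMap (a : Fin (n + 1) → Space d) : Continuous (edgeMap a) :=
  LinearMap.continuous_of_finiteDimensional _

theorem continuous_param (a : Fin (n + 1) → Space d) : Continuous (param a) :=
  continuous_const.add (continuous_edgeMap a)

theorem convex_refSimplex (n : ℕ) : Convex ℝ (refSimplex n) := by
  rintro x ⟨hx, hx'⟩ y ⟨hy, hy'⟩ s t hs ht hst
  refine ⟨fun i => ?_, ?_⟩
  · have := hx i
    have := hy i
    simp only [PiLp.add_apply, PiLp.smul_apply, smul_eq_mul]
    positivity
  · simp only [PiLp.add_apply, PiLp.smul_apply, smul_eq_mul, Finset.sum_add_distrib,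
      ← Finset.mul_sum]
    nlinarith

theorem isClosed_refSimplex (n : ℕ) : IsClosed (refSimplex n) := by
  have : refSimplex n = (⋂ i, {y : Space n | 0 ≤ y i}) ∩ {y | ∑ i, y i ≤ 1} := by
    ext y; simp [refSimplex]
  rw [this]
  refine (isClosed_iInter fun i => isClosed_le (by fun_prop) (by fun_prop)).inter
    (isClosed_le (by fun_prop) (by fun_prop))

theorem isCompact_refSimplex (n : ℕ) : IsCompact (refSimplex n) := by
  refine Metric.isCompact_of_isClosed_isBounded (isClosed_refSimplex n) ?_
  have h : (refSimplex n) ⊆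
      (WithLp.ofLp : Space n → Fin n → ℝ) ⁻¹' (Set.Icc 0 1) := by
    rintro y ⟨h1, h2⟩
    refine ⟨fun i => h1 i, fun i => ?_⟩
    exact (Finset.single_le_sum (fun j _ => h1 j) (Finset.mem_univ i)).trans h2
  refine Bornology.IsBounded.subset ?_ h
  exact (PiLp.antilipschitzWith_ofLp 2 (fun _ : Fin n => ℝ)).isBounded_preimage
    (Metric.isBounded_Icc _ _)

theorem interior_refSimplex_nonempty (n : ℕ) :
    ∃ U : Set (Space n), IsOpen U ∧ U.Nonempty ∧ U ⊆ refSimplex n := by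
  refine ⟨{y | (∀ i, 0 < y i) ∧ ∑ i, y i < 1}, ?_, ?_, ?_⟩
  · have : {y : Space n | (∀ i, 0 < y i) ∧ ∑ i, y i < 1} =
        (⋂ i, {y : Space n | 0 < y i}) ∩ {y | ∑ i, y i < 1} := by
      ext y; simp
    rw [this]
    exact (isOpen_iInter_of_finite fun i => isOpen_lt (by fun_prop) (by fun_prop)).inter
      (isOpen_lt (by fun_prop) (by fun_prop))
  · refine ⟨WithLp.toLp 2 fun _ => (1 / (n + 1) : ℝ), fun i => ?_, ?_⟩
    · simp only; positivity
    · simp only [Finset.sum_const, Finset.card_univ, Fintype.card_fin, nsmul_eq_mul]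
      rw [mul_one_div, div_lt_one (by positivity)]
      linarith
  · rintro y ⟨h1, h2⟩
    exact ⟨fun i => (h1 i).le, h2.le⟩

theorem volume_refSimplex_pos (n : ℕ) : 0 < volume.real (refSimplex n) := by
  obtain ⟨U, hU, hne, hs⟩ := interior_refSimplex_nonempty n
  refine ENNReal.toReal_pos ?_ (isCompact_refSimplex n).measure_ne_top
  exact ((hU.measure_pos volume hne).trans_le (measure_mono hs)).ne'

theorem param_eq (a : Fin (n + 1) → Space d) (y : Space n) :
    param a y = (1 - ∑ i, y i) • a 0 + ∑ i : Fin n, y i • a i.succ := by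
  rw [param, edgeMap_apply]
  simp only [smul_sub, Finset.sum_sub_distrib, ← Finset.sum_smul, sub_smul, one_smul]
  abel

theorem image_param (a : Fin (n + 1) → Space d) :
    param a '' refSimplex n = convexHull ℝ (range a) := by
  apply Subset.antisymm
  · rintro _ ⟨y, ⟨h1, h2⟩, rfl⟩
    have h := (convex_convexHull ℝ (range a)).sum_mem (t := Finset.univ)
      (w := Fin.cons (1 - ∑ i, y i) (fun i => y i)) (z := a) ?_ ?_ ?_
    · rw [param_eq]
      simpa [Fin.sum_univ_succ] using h
    · intro i _
      refine Fin.cases ?_ (fun j => ?_) i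
      · simpa using h2
      · simpa using h1 j
    · simp [Fin.sum_univ_succ]
    · intro i _
      exact subset_convexHull ℝ _ ⟨i, rfl⟩
  · apply convexHull_min
    · rintro _ ⟨i, rfl⟩
      refine Fin.cases ?_ (fun j => ?_) i
      · refine ⟨0, ⟨by simp, by simp⟩, by simp [param]⟩
      · refine ⟨EuclideanSpace.single j 1, ⟨fun i => ?_, by simp⟩, by simp [param, edgeMap_single]⟩
        by_cases h : i = j <;> simp [h]
    · have h := (convex_refSimplex n).linear_image (edgeMap a)
      have h2 := h.translate (a 0)
      rwa [image_image] at h2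

/-- A linear map scales `n`-dimensional measure by its `normDet`, and the translation by `a 0` is an
isometry. Affine independence is not needed: for a degenerate simplex both sides vanish. -/
theorem restrict_convexHull_range (a : Fin (n + 1) → Space d) :
    (μHE[n] : Measure (Space d)).restrict (convexHull ℝ (range a)) =
      ENNReal.ofReal (edgeMap a).normDet •
        (volume.restrict (refSimplex n)).map (param a) := by
  ext s hs
  have hpre : MeasurableSet (param a ⁻¹' s) := (continuous_param a).measurable hs
  rw [Measure.restrict_apply hs, Measure.smul_apply, Measure.map_apply
    (continuous_param a).measurable hs, Measure.restrict_apply hpre, smul_eq_mul]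
  have h := (edgeMap a).euclideanHausdorffMeasure_image_eq_normDet_mul_volume
    (param a ⁻¹' s ∩ refSimplex n)
  rw [finrank_euclideanSpace_fin] at h
  rw [← h, ← (IsometryEquiv.addLeft (a 0)).isometry.euclideanHausdorffMeasure_image
    (edgeMap a '' _), image_image, ← image_param, inter_comm s, inter_comm _ (refSimplex n),
    ← image_inter_preimage]
  rfl

theorem setIntegral_convexHull_range (a : Fin (n + 1) → Space d) {g : Space d → ℝ}
    (hg : Continuous g) :
    ∫ x in convexHull ℝ (range a), g x ∂μHE[n] =
      (edgeMap a).normDet * ∫ y in refSimplex n, g (param a y) := by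
  rw [restrict_convexHull_range, integral_smul_measure,
    integral_map (continuous_param a).aemeasurable hg.aestronglyMeasurable,
    ENNReal.toReal_ofReal (edgeMap a).normDet_nonneg, smul_eq_mul]

theorem measure_convexHull_range_lt_top (a : Fin (n + 1) → Space d) :
    (μHE[n] : Measure (Space d)) (convexHull ℝ (range a)) < ⊤ := by
  rw [← Measure.restrict_apply_univ, restrict_convexHull_range, Measure.smul_apply,
    Measure.map_apply (continuous_param a).measurable MeasurableSet.univ, preimage_univ,
    Measure.restrict_apply_univ]
  exact ENNReal.mul_lt_top ENNReal.ofReal_lt_top (isCompact_refSimplex n).measure_lt_top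

/-- Both enumerations describe the same simplex, so integrating the constant `1` over it in the two
parametrisations compares the factors. -/
theorem normDet_edgeMap_comp_equiv (a : Fin (n + 1) → Space d) (e : Fin (n + 1) ≃ Fin (n + 1)) :
    (edgeMap (a ∘ e)).normDet = (edgeMap a).normDet := by
  have h1 := setIntegral_convexHull_range (a ∘ e) (g := fun _ => 1) continuous_const
  have h2 := setIntegral_convexHull_range a (g := fun _ => 1) continuous_const
  rw [e.surjective.range_comp, h2] at h1
  have := (volume_refSimplex_pos n).ne'
  simp only [integral_const, measureReal_restrict_apply_univ, smul_eq_mul, mul_one] at h1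
  exact (mul_right_cancel₀ this h1).symm

theorem edgeMap_injective {a : Fin (n + 1) → Space d} (ha : AffineIndependent ℝ a) :
    Function.Injective (edgeMap a) := by
  have h := (affineIndependent_iff_linearIndependent_vsub ℝ a 0).1 ha
  have h' : LinearIndependent ℝ fun i : Fin n => a i.succ - a 0 :=
    h.comp (fun i : Fin n => (⟨i.succ, Fin.succ_ne_zero i⟩ : {x // x ≠ (0 : Fin (n + 1))}))
      (fun i j hij => by simpa using hij)
  rw [edgeMap, LinearMap.coe_comp]
  exact (linearIndependent_iff_injective_fintypeLinearCombination.1 h').comp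
    (WithLp.linearEquiv 2 ℝ (Fin n → ℝ)).injective

/-- Volume of a simplex as base times height, on the level of determinants. -/
theorem normDet_edgeMap_eq_height_mul {a : Fin (n + 2) → Space (n + 1)}
    (ha : AffineIndependent ℝ a) {ν : Space (n + 1)} (hν : ‖ν‖ = 1)
    (hF : ∀ i : Fin n, ⟪ν, a i.succ.succ - a 0⟫ = 0) :
    (edgeMap a).normDet =
      |⟪ν, a 0 - a 1⟫| * (edgeMap (a ∘ (1 : Fin (n + 2)).succAbove)).normDet := by
  set f := edgeMap (a ∘ (1 : Fin (n + 2)).succAbove) with hf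
  set h : ℝ := ⟪ν, a 0 - a 1⟫ with hh
  have hs0 : (1 : Fin (n + 2)).succAbove 0 = 0 := rfl
  have hs : ∀ i : Fin n, (1 : Fin (n + 2)).succAbove i.succ = i.succ.succ := fun i => by
    rw [← Fin.succ_zero_eq_one, Fin.succ_succAbove_succ, Fin.zero_succAbove]
  have hfe : ∀ i : Fin n, f (EuclideanSpace.single i 1) = a i.succ.succ - a 0 := fun i => by
    rw [hf, edgeMap_single, Function.comp_apply, Function.comp_apply, hs, hs0]
  have hfo : ∀ y, ⟪ν, f y⟫ = 0 := fun y => by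
    rw [hf, edgeMap_apply, inner_sum]
    refine Finset.sum_eq_zero fun i _ => ?_
    rw [inner_smul_right, Function.comp_apply, Function.comp_apply, hs, hs0, hF, mul_zero]
  have hfinj : Function.Injective f :=
    edgeMap_injective (ha.comp_embedding (1 : Fin (n + 2)).succAboveEmb)
  -- The range of `f` is the hyperplane orthogonal to `ν`, by a dimension count, and adding `h • ν`
  -- removes the normal component of `a 1 - a 0`.
  obtain ⟨w, hw⟩ : ∃ w, f w = a 1 - a 0 + h • ν := by
    have hfr : Module.finrank ℝ f.range = n := by
      rw [LinearMap.finrank_range_of_inj hfinj, finrank_euclideanSpace_fin]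
    have hfr' : Module.finrank ℝ f.rangeᗮ = 1 := by
      have := f.range.finrank_add_finrank_orthogonal
      rw [finrank_euclideanSpace_fin] at this
      omega
    have hνm : ν ∈ f.rangeᗮ := by
      rw [Submodule.mem_orthogonal]
      rintro _ ⟨y, rfl⟩
      rw [real_inner_comm, hfo]
    have hsp := (finrank_eq_one_iff_of_nonzero' (⟨ν, hνm⟩ : f.rangeᗮ) (by
      intro h0
      have := congrArg Subtype.val h0
      simp only [Submodule.coe_zero] at this
      rw [this, norm_zero] at hν
      exact zero_ne_one hν)).1 hfr'
    rw [← LinearMap.mem_range, ← f.range.orthogonal_orthogonal, Submodule.mem_orthogonal]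
    intro u hu
    obtain ⟨c, hc⟩ := hsp ⟨u, hu⟩
    have hc' : u = c • ν := by simpa using (congrArg Subtype.val hc).symm
    rw [hc', inner_smul_left, inner_add_right, inner_smul_right, real_inner_self_eq_norm_sq, hν, hh,
      ← neg_sub (a 0), inner_neg_right]
    simp
  -- Factorisation of `edgeMap a`: in `b` the apex is replaced by the point at distance one from `a
  -- 0` along the normal, so its Gram matrix is that of the face with an extra block `1`. The map of
  -- `c` keeps all basis vectors but the first, which it sends to `(-h, w)`, and has determinant
  -- `-h`.
  let b : Fin (n + 2) → Space (n + 1) := Function.update a 1 (a 0 + ν)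
  let c : Fin (n + 2) → Space (n + 1) := Fin.cons 0 (Fin.cons
    (WithLp.toLp 2 (Fin.cons (-h) w.ofLp)) fun i => EuclideanSpace.single i.succ 1)
  have hb0 : edgeMap b (EuclideanSpace.single 0 1) = ν := by
    rw [edgeMap_single]
    simp [b]
  have hbs : ∀ i : Fin n, edgeMap b (EuclideanSpace.single i.succ 1) = a i.succ.succ - a 0 := by
    intro i
    rw [edgeMap_single]
    have h1 : i.succ.succ ≠ 1 := by
      rw [← Fin.succ_zero_eq_one]
      exact fun h => Fin.succ_ne_zero i (Fin.succ_injective _ h)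
    simp [b, h1]
  have hcomp : edgeMap a = edgeMap b ∘ₗ edgeMap c := by
    refine (EuclideanSpace.basisFun (Fin (n + 1)) ℝ).toBasis.ext fun i => ?_
    simp only [OrthonormalBasis.coe_toBasis, EuclideanSpace.basisFun_apply, LinearMap.comp_apply]
    refine Fin.cases ?_ (fun j => ?_) i
    · rw [edgeMap_single, edgeMap_single]
      simp only [c, Fin.cons_succ, Fin.cons_zero, sub_zero]
      have : (WithLp.toLp 2 (Fin.cons (-h) w.ofLp) : Space (n + 1)) =
          (-h) • EuclideanSpace.single 0 1 + ∑ i, w i • EuclideanSpace.single i.succ (1 : ℝ) := by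
        ext k
        refine Fin.cases ?_ (fun k => ?_) k
        · simp
        · simp [Finset.sum_apply, Pi.single_apply, Fin.succ_inj]
      rw [this, map_add, map_smul, hb0, map_sum]
      simp only [map_smul, hbs, ← hfe]
      have hw' : f w = ∑ i, w i • f (EuclideanSpace.single i 1) := by
        simp_rw [hfe]
        rw [hf, edgeMap_apply]
        refine Finset.sum_congr rfl fun i _ => ?_
        rw [Function.comp_apply, Function.comp_apply, hs, hs0]
      rw [← hw', hw, Fin.succ_zero_eq_one]
      module
    · rw [edgeMap_single, edgeMap_single]
      simp only [c, Fin.cons_succ, Fin.cons_zero, sub_zero, hbs]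
  have hc : (edgeMap c).normDet = |h| := by
    rw [LinearMap.normDet_eq_norm_det_toMatrix _ (EuclideanSpace.basisFun (Fin (n + 1)) ℝ)
      (EuclideanSpace.basisFun (Fin (n + 1)) ℝ), Real.norm_eq_abs, Matrix.det_succ_row_zero,
      Fin.sum_univ_succ, Finset.sum_eq_zero, add_zero]
    · have h1 : ((LinearMap.toMatrix (EuclideanSpace.basisFun (Fin (n + 1)) ℝ).toBasis
        (EuclideanSpace.basisFun (Fin (n + 1)) ℝ).toBasis (edgeMap c)).submatrix Fin.succ
          (Fin.succAbove 0)) = 1 := by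
        ext i j
        simp [LinearMap.toMatrix_apply, edgeMap_single, c, Matrix.one_apply]
      rw [h1]
      simp [LinearMap.toMatrix_apply, edgeMap_single, c]
    · intro j _
      simp [LinearMap.toMatrix_apply, edgeMap_single, c]
  have hbn : (edgeMap b).normDet = f.normDet := by
    rw [← sq_eq_sq₀ (edgeMap b).normDet_nonneg f.normDet_nonneg]
    have h1 := (edgeMap b).normDet_sq_eq_det_gram (EuclideanSpace.basisFun (Fin (n + 1)) ℝ)
    have h2 := f.normDet_sq_eq_det_gram (EuclideanSpace.basisFun (Fin n) ℝ)
    simp only [RCLike.ofReal_real_eq_id, id] at h1 h2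
    rw [h1, h2, Matrix.det_succ_row_zero, Fin.sum_univ_succ, Finset.sum_eq_zero, add_zero]
    · have h3 : (Matrix.gram ℝ fun i => edgeMap b (EuclideanSpace.basisFun (Fin (n + 1)) ℝ i)).submatrix
          Fin.succ (Fin.succAbove 0) = Matrix.gram ℝ fun i => f (EuclideanSpace.basisFun (Fin n) ℝ i) := by
        ext i j
        simp [Matrix.gram, hbs, hfe]
      rw [h3]
      simp [Matrix.gram, hb0, hν]
    · intro j _
      simp [Matrix.gram, hb0, hbs, hF]
  rw [hcomp, LinearMap.normDet_comp_of_finrank_eq _ _ rfl, hbn, hc, mul_comm]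

theorem normDet_edgeMap_pos {a : Fin (n + 1) → Space d} (ha : AffineIndependent ℝ a) :
    0 < (edgeMap a).normDet := by
  refine lt_of_le_of_ne (edgeMap a).normDet_nonneg (Ne.symm fun h => ?_)
  exact LinearMap.normDet_eq_zero_iff_ker_ne_bot.1 h
    (LinearMap.ker_eq_bot.2 (edgeMap_injective ha))

/-! ### The divergence theorem on a simplex -/

/-- Prepend a coordinate. -/
def consCoord (s : ℝ) (y : Space n) : Space (n + 1) := WithLp.toLp 2 (Fin.cons s y.ofLp)

@[simp]
theorem consCoord_zero (s : ℝ) (y : Space n) : consCoord s y 0 = s := rfl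

@[simp]
theorem consCoord_succ (s : ℝ) (y : Space n) (i : Fin n) : consCoord s y i.succ = y i := rfl

theorem consCoord_mem_refSimplex {s : ℝ} {y : Space n} :
    consCoord s y ∈ refSimplex (n + 1) ↔ y ∈ refSimplex n ∧ s ∈ Icc 0 (1 - ∑ i, y i) := by
  simp only [refSimplex, mem_ofPred_eq, Fin.forall_fin_succ, Fin.sum_univ_succ, consCoord_zero,
    consCoord_succ, mem_Icc]
  constructor
  · rintro ⟨⟨h1, h2⟩, h3⟩
    exact ⟨⟨h2, by linarith⟩, h1, by linarith⟩
  · rintro ⟨⟨h1, h2⟩, h3, h4⟩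
    exact ⟨⟨h3, h1⟩, by linarith⟩

theorem consCoord_eq (s : ℝ) (y : Space n) :
    consCoord s y = consCoord 0 y + s • EuclideanSpace.single 0 1 := by
  ext i
  refine Fin.cases ?_ (fun j => ?_) i <;> simp

/-- `ℝ × ℝⁿ` as `ℝⁿ⁺¹`. -/
def consEquiv (n : ℕ) : ℝ × Space n ≃ᵐ Space (n + 1) :=
  (((MeasurableEquiv.refl ℝ).prodCongr (MeasurableEquiv.toLp 2 (Fin n → ℝ)).symm).trans
    (MeasurableEquiv.piFinSuccAbove (fun _ : Fin (n + 1) => ℝ) 0).symm).trans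
      (MeasurableEquiv.toLp 2 (Fin (n + 1) → ℝ))

theorem consEquiv_apply (p : ℝ × Space n) : consEquiv n p = consCoord p.1 p.2 := by
  ext i
  refine Fin.cases ?_ (fun j => ?_) i <;> rfl

theorem continuous_consCoord : Continuous fun p : ℝ × Space n => consCoord p.1 p.2 := by
  refine (PiLp.continuous_toLp 2 _).comp (continuous_pi fun i => ?_)
  refine Fin.cases ?_ (fun j => ?_) i
  · exact continuous_fst
  · simp only [Fin.cons_succ]
    fun_prop

theorem measurePreserving_consEquiv (n : ℕ) : MeasurePreserving (consEquiv n) := by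
  have h1 : MeasurePreserving
      ((MeasurableEquiv.refl ℝ).prodCongr (MeasurableEquiv.toLp 2 (Fin n → ℝ)).symm) :=
    (MeasurePreserving.id volume).prod (PiLp.volume_preserving_ofLp (Fin n))
  exact ((PiLp.volume_preserving_toLp (Fin (n + 1))).comp
    (volume_preserving_piFinSuccAbove (fun _ : Fin (n + 1) => ℝ) 0).symm).comp h1

theorem integral_refSimplex_succ {g : Space (n + 1) → ℝ} (hg : Continuous g) :
    ∫ z in refSimplex (n + 1), g z =
      ∫ y in refSimplex n, ∫ s in (0 : ℝ)..(1 - ∑ i, y i), g (consCoord s y) := by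
  have hT := (isClosed_refSimplex (n + 1)).measurableSet
  have hint : IntegrableOn g (refSimplex (n + 1)) :=
    hg.continuousOn.integrableOn_compact (isCompact_refSimplex _)
  rw [← integral_indicator hT, ← (measurePreserving_consEquiv n).integral_comp'
    (g := (refSimplex (n + 1)).indicator g), Measure.volume_eq_prod, integral_prod_symm]
  · rw [← integral_indicator (isClosed_refSimplex n).measurableSet]
    refine integral_congr_ae (Filter.Eventually.of_forall fun y => ?_)
    simp only [consEquiv_apply]
    by_cases hy : y ∈ refSimplex n
    · rw [indicator_of_mem hy, intervalIntegral.integral_of_le (by linarith [hy.2]),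
        ← integral_Icc_eq_integral_Ioc, ← integral_indicator measurableSet_Icc]
      refine integral_congr_ae (Filter.Eventually.of_forall fun s => ?_)
      simp only [indicator, consCoord_mem_refSimplex, hy, true_and]
    · rw [indicator_of_notMem hy]
      have : ∀ s, (refSimplex (n + 1)).indicator g (consCoord s y) = 0 := fun s =>
        indicator_of_notMem (fun h => hy (consCoord_mem_refSimplex.1 h).1) _
      simp [this]
  · rw [← Measure.volume_eq_prod]
    exact ((measurePreserving_consEquiv n).integrable_comp_emb
      (consEquiv n).measurableEmbedding).2 (hint.integrable_indicator hT)

theorem one_succAbove_succ (i : Fin n) : (1 : Fin (n + 2)).succAbove i.succ = i.succ.succ := by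
  rw [← Fin.succ_zero_eq_one, Fin.succ_succAbove_succ, Fin.zero_succAbove]

theorem param_consCoord_zero (a : Fin (n + 2) → Space d) (y : Space n) :
    param a (consCoord 0 y) = param (a ∘ (1 : Fin (n + 2)).succAbove) y := by
  simp [param_eq, Fin.sum_univ_succ]

theorem param_consCoord_one_sub (a : Fin (n + 2) → Space d) (y : Space n) :
    param a (consCoord (1 - ∑ i, y i) y) = param (a ∘ (0 : Fin (n + 2)).succAbove) y := by
  simp [param_eq, Fin.sum_univ_succ]

theorem param_consCoord (a : Fin (n + 2) → Space d) (s : ℝ) (y : Space n) :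
    param a (consCoord s y) = param a (consCoord 0 y) + s • (a 1 - a 0) := by
  rw [consCoord_eq, param, param, map_add, map_smul, edgeMap_single, ← add_assoc,
    Fin.succ_zero_eq_one]

/-- The edge `a 1 - a 0` is the image of the first coordinate direction. The fundamental theorem of
calculus in that coordinate leaves its two end points: `0` gives the face opposite `a 1` and `1 - ∑
yᵢ` the face opposite `a 0`, both parametrised by the same `y`. -/
theorem setIntegral_refSimplex_fderiv (a : Fin (n + 2) → Space d) {f : Space d → ℝ}
    (hf : ContDiff ℝ 1 f) :
    ∫ z in refSimplex (n + 1), fderiv ℝ f (param a z) (a 1 - a 0) =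
      (∫ y in refSimplex n, f (param (a ∘ (0 : Fin (n + 2)).succAbove) y)) -
        ∫ y in refSimplex n, f (param (a ∘ (1 : Fin (n + 2)).succAbove) y) := by
  have hc : Continuous fun z => fderiv ℝ f (param a z) (a 1 - a 0) :=
    ((hf.continuous_fderiv one_ne_zero).comp (continuous_param a)).clm_apply continuous_const
  have hi : ∀ b : Fin (n + 1) → Space d,
      IntegrableOn (fun y => f (param b y)) (refSimplex n) := fun b =>
    (hf.continuous.comp (continuous_param b)).continuousOn.integrableOn_compact
      (isCompact_refSimplex _)
  rw [integral_refSimplex_succ hc, ← integral_sub (hi _) (hi _)]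
  refine integral_congr_ae (Filter.Eventually.of_forall fun y => ?_)
  simp only
  rw [← param_consCoord_one_sub, ← param_consCoord_zero]
  refine intervalIntegral.integral_eq_sub_of_hasDerivAt
    (f := fun s => f (param a (consCoord s y))) (fun s _ => ?_) ?_
  · have h1 : HasDerivAt (fun s : ℝ => param a (consCoord s y)) (a 1 - a 0) s := by
      rw [funext fun s => param_consCoord a s y]
      have h2 := ((hasDerivAt_id s).smul_const (a 1 - a 0)).const_add (param a (consCoord 0 y))
      rw [one_smul] at h2
      exact h2
    exact ((hf.differentiable one_ne_zero _).hasFDerivAt).comp_hasDerivAt s h1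
  · exact (hc.comp (continuous_consCoord.comp
      (continuous_id.prodMk continuous_const))).intervalIntegrable _ _

/-- A simplex as a parametrised simplex with two given first vertices. -/
theorem exists_enumeration {K : Finset (Space d)} (hK : K.card = n + 2)
    (hind : AffineIndependent ℝ ((↑) : K → Space d)) {x y : Space d} (hx : x ∈ K) (hy : y ∈ K)
    (hxy : x ≠ y) :
    ∃ a : Fin (n + 2) → Space d, a 0 = x ∧ a 1 = y ∧ Function.Injective a ∧
      range a = K ∧ AffineIndependent ℝ a := by
  classical
  have hyx : y ∈ K.erase x := Finset.mem_erase.2 ⟨hxy.symm, hy⟩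
  have hc : ((K.erase x).erase y).card = n := by
    rw [Finset.card_erase_of_mem hyx, Finset.card_erase_of_mem hx, hK]
    omega
  obtain ⟨g⟩ : Nonempty (((K.erase x).erase y : Finset _) ≃ Fin n) :=
    ⟨Finset.equivFinOfCardEq hc⟩
  obtain ⟨a, ha0, ha1, ha2⟩ : ∃ a : Fin (n + 2) → Space d, a 0 = x ∧ a 1 = y ∧
      ∀ i : Fin n, a i.succ.succ = g.symm i :=
    ⟨Fin.cons x (Fin.cons y fun i => (g.symm i : Space d)), rfl, rfl, fun _ => rfl⟩
  have hg : ∀ i, (g.symm i : Space d) ≠ y ∧ (g.symm i : Space d) ≠ x ∧ (g.symm i : Space d) ∈ K := by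
    intro i
    have h1 := Finset.mem_erase.1 (g.symm i).2
    have h2 := Finset.mem_erase.1 h1.2
    exact ⟨h1.1, h2.1, h2.2⟩
  have hmem : ∀ i, a i ∈ K := by
    refine Fin.cases ?_ (Fin.cases ?_ fun j => ?_)
    · rw [ha0]
      exact hx
    · rw [Fin.succ_zero_eq_one, ha1]
      exact hy
    · rw [ha2]
      exact (hg j).2.2
  have hrange : range a = K := by
    apply Subset.antisymm
    · rintro _ ⟨i, rfl⟩
      exact hmem i
    · intro z hz
      by_cases hzx : z = x
      · exact ⟨0, ha0.trans hzx.symm⟩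
      by_cases hzy : z = y
      · exact ⟨1, ha1.trans hzy.symm⟩
      have hz' : z ∈ (K.erase x).erase y := by
        simp only [Finset.mem_erase]
        exact ⟨hzy, hzx, hz⟩
      refine ⟨(g ⟨z, hz'⟩).succ.succ, ?_⟩
      rw [ha2, Equiv.symm_apply_apply]
  have hinj : Function.Injective a := by
    have h1 : (Finset.univ.image a).card = (Finset.univ : Finset (Fin (n + 2))).card := by
      have : Finset.univ.image a = K := by
        rw [← Finset.coe_inj, ← hrange]
        simp
      rw [this, hK, Finset.card_univ, Fintype.card_fin]
    have := Finset.card_image_iff.1 h1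
    rwa [Finset.coe_univ, injOn_univ] at this
  refine ⟨a, ha0, ha1, hinj, hrange, ?_⟩
  have hφ : Function.Injective fun i => (⟨a i, hmem i⟩ : K) := fun i j h =>
    hinj (Subtype.ext_iff.1 h)
  exact hind.comp_embedding ⟨_, hφ⟩

open Classical in
theorem hull_erase_eq {K : Finset (Space d)} {a : Fin (n + 2) → Space d}
    (hinj : Function.Injective a) (hr : range a = K) (i : Fin (n + 2)) :
    hull (K.erase (a i)) = convexHull ℝ (range (a ∘ i.succAbove)) := by
  rw [hull, range_comp, Fin.range_succAbove, Finset.coe_erase, ← hr,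
    image_compl_eq_range_sdiff_image hinj, image_singleton]

theorem isCompact_hull (S : Finset (Space d)) : IsCompact (hull S) :=
  S.finite_toSet.isCompact_convexHull (𝕜 := ℝ)

theorem convex_hull (S : Finset (Space d)) : Convex ℝ (hull S) := convex_convexHull ℝ _

theorem measure_hull_lt_top {F : Finset (Space d)} (hF : F.card = n + 1) :
    (μHE[n] : Measure (Space d)) (hull F) < ⊤ := by
  let e := F.equivFinOfCardEq hF
  have h := measure_convexHull_range_lt_top (fun i => (e.symm i : Space d))
  have h2 : range (fun i => (e.symm i : Space d)) = F := by
    have := e.symm.surjective.range_comp (fun z : F => (z : Space d))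
    exact this.trans Subtype.range_coe
  rwa [h2] at h

theorem integrableOn_hull {F : Finset (Space d)} (hF : F.card = n + 1) {g : Space d → ℝ}
    (hg : Continuous g) : IntegrableOn g (hull F) μHE[n] :=
  hg.continuousOn.integrableOn_of_subset_isCompact (isCompact_hull F)
    (isCompact_hull F).measurableSet Subset.rfl (measure_hull_lt_top hF).ne

/-- The vertex opposite `F` is `a 1`, on the inner side of the outward normal; this fixes the sign
of the height and removes the absolute value in `normDet_edgeMap_eq_height_mul`. -/
theorem normDet_eq_inner_normal_mul {K F : Finset (Space (n + 1))}
    {a : Fin (n + 2) → Space (n + 1)} (ha : AffineIndependent ℝ a) (hr : range a = K)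
    (hF : (F : Set (Space (n + 1))) = range (a ∘ (1 : Fin (n + 2)).succAbove)) {ν : Space (n + 1)}
    (hν : IsOutwardNormal K F ν) :
    0 < ⟪ν, a 0 - a 1⟫ ∧ (edgeMap a).normDet =
      ⟪ν, a 0 - a 1⟫ * (edgeMap (a ∘ (1 : Fin (n + 2)).succAbove)).normDet := by
  obtain ⟨h1, h2, h3⟩ := hν
  have hmem : ∀ i, a ((1 : Fin (n + 2)).succAbove i) ∈ F := fun i => by
    rw [← Finset.mem_coe, hF]
    exact ⟨i, rfl⟩
  have h0 : a 0 ∈ F := hmem 0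
  have hpos : 0 < ⟪ν, a 0 - a 1⟫ := by
    have h4 : a 1 ∈ K := by
      rw [← Finset.mem_coe, ← hr]
      exact ⟨1, rfl⟩
    have h5 : a 1 ∉ F := by
      rw [← Finset.mem_coe, hF]
      rintro ⟨i, hi⟩
      exact Fin.succAbove_ne _ _ (ha.injective hi)
    have := h3 _ h4 h5 _ h0
    rw [← neg_sub, inner_neg_right]
    linarith
  refine ⟨hpos, ?_⟩
  rw [normDet_edgeMap_eq_height_mul ha h1, abs_of_pos hpos]
  intro i
  have := hmem i.succ
  rw [one_succAbove_succ] at this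
  exact h2 _ h0 _ this

open Classical in
theorem isOutwardNormal_erase {K : Finset (Space (n + 1))} (hK : K.card = n + 2)
    (hind : AffineIndependent ℝ ((↑) : K → Space (n + 1))) {x : Space (n + 1)} (hx : x ∈ K) :
    IsOutwardNormal K (K.erase x) (normal K (K.erase x)) :=
  isOutwardNormal_normal K _ hK hind (K.erase_subset x)
    (by rw [Finset.card_erase_of_mem hx, hK]; rfl) (by omega)

theorem setIntegral_hull_eq {K : Finset (Space (n + 1))} {a : Fin (n + 2) → Space (n + 1)}
    (hr : range a = K) {g : Space (n + 1) → ℝ} (hg : Continuous g) :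
    ∫ z in hull K, g z = (edgeMap a).normDet * ∫ y in refSimplex (n + 1), g (param a y) := by
  rw [← setIntegral_convexHull_range a hg, EuclideanSpace.euclideanHausdorffMeasure_eq_volume, hr]
  rfl

-- In parameters, both face integrals carry the volume factor of `K`. Base times height rewrites it
-- for each face as the surface factor times the inner product of the normal with the edge, which
-- are the weights of the divergence theorem.
open Classical in
theorem setIntegral_fderiv_edge {K : Finset (Space (n + 1))} (hK : K.card = n + 2)
    (hind : AffineIndependent ℝ ((↑) : K → Space (n + 1))) {x y : Space (n + 1)} (hx : x ∈ K)
    (hy : y ∈ K) (hxy : x ≠ y) {f : Space (n + 1) → ℝ} (hf : ContDiff ℝ 1 f) :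
    ∫ z in hull K, fderiv ℝ f z (y - x) =
      ⟪normal K (K.erase x), y - x⟫ * (∫ z in hull (K.erase x), f z ∂μHE[n]) +
      ⟪normal K (K.erase y), y - x⟫ * (∫ z in hull (K.erase y), f z ∂μHE[n]) := by
  obtain ⟨a, rfl, rfl, hinj, hr, ha⟩ := exists_enumeration hK hind hx hy hxy
  have hc : Continuous fun z => fderiv ℝ f z (a 1 - a 0) :=
    (hf.continuous_fderiv one_ne_zero).clm_apply continuous_const
  rw [setIntegral_hull_eq hr hc, setIntegral_refSimplex_fderiv a hf, hull_erase_eq hinj hr,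
    hull_erase_eq hinj hr, setIntegral_convexHull_range _ hf.continuous,
    setIntegral_convexHull_range _ hf.continuous]
  have hface : ∀ i, ((K.erase (a i) : Finset _) : Set (Space (n + 1))) =
      range (a ∘ i.succAbove) := fun i => by
    rw [range_comp, Fin.range_succAbove, Finset.coe_erase, ← hr,
      image_compl_eq_range_sdiff_image hinj, image_singleton]
  obtain ⟨-, h1⟩ := normDet_eq_inner_normal_mul ha hr (hface 1) (isOutwardNormal_erase hK hind hy)
  -- Exchanging the first two vertices puts `a 0` into the role of the apex, so that the same height
  -- formula serves the face opposite `a 0`.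
  let e : Fin (n + 2) ≃ Fin (n + 2) := Equiv.swap 0 1
  have he0 : (a ∘ e) 0 = a 1 := by simp [e]
  have he1 : (a ∘ e) 1 = a 0 := by simp [e]
  have hfun : (a ∘ e) ∘ (1 : Fin (n + 2)).succAbove = a ∘ (0 : Fin (n + 2)).succAbove := by
    funext i
    refine Fin.cases ?_ (fun j => ?_) i
    · simp [e]
    · simp only [Function.comp_apply, one_succAbove_succ, Fin.zero_succAbove, e]
      rw [Equiv.swap_apply_of_ne_of_ne (Fin.succ_ne_zero _)]
      rw [← Fin.succ_zero_eq_one]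
      exact fun h => Fin.succ_ne_zero j (Fin.succ_injective _ h)
  have hre : range (a ∘ e) = K := by rw [e.surjective.range_comp, hr]
  obtain ⟨-, h2⟩ := normDet_eq_inner_normal_mul (ha.comp_embedding e.toEmbedding) hre
    (F := K.erase (a 0)) (by
      have := hface 0
      rw [← hfun] at this
      exact this) (isOutwardNormal_erase hK hind hx)
  change (edgeMap (a ∘ e)).normDet = ⟪_, (a ∘ e) 0 - (a ∘ e) 1⟫ * (edgeMap ((a ∘ e) ∘ _)).normDet
    at h2
  rw [normDet_edgeMap_comp_equiv, he0, he1, hfun] at h2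
  have h3 : ⟪normal K (K.erase (a 1)), a 1 - a 0⟫ = -⟪normal K (K.erase (a 1)), a 0 - a 1⟫ := by
    rw [← inner_neg_right, neg_sub]
  rw [h3, mul_sub]
  nth_rewrite 1 [h2]
  rw [h1]
  ring

open Classical in
/-- The divergence theorem on a simplex, for constant directions. -/
theorem setIntegral_fderiv_hull {K : Finset (Space (n + 1))} (hK : K.card = n + 2)
    (hind : AffineIndependent ℝ ((↑) : K → Space (n + 1))) {f : Space (n + 1) → ℝ}
    (hf : ContDiff ℝ 1 f) (e : Space (n + 1)) :
    ∫ z in hull K, fderiv ℝ f z e =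
      ∑ w ∈ K, ⟪normal K (K.erase w), e⟫ * ∫ z in hull (K.erase w), f z ∂μHE[n] := by
  have hci : ∀ e, IntegrableOn (fun z => fderiv ℝ f z e) (hull K) := fun e =>
    ((hf.continuous_fderiv one_ne_zero).clm_apply
      continuous_const).continuousOn.integrableOn_compact (isCompact_hull K)
  -- Both sides are linear in `e` and the edges span the space, so edge directions suffice.
  have hspan : e ∈ Submodule.span ℝ ((K : Set (Space (n + 1))) -ᵥ (K : Set (Space (n + 1)))) := by
    have h := hind.vectorSpan_eq_top_of_card_eq_finrank_add_one
      (by rw [Fintype.card_coe, hK, finrank_euclideanSpace_fin])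
    rw [Subtype.range_coe_subtype] at h
    change e ∈ vectorSpan ℝ (K : Set (Space (n + 1)))
    rw [show (K : Set (Space (n + 1))) = {x | x ∈ K} from rfl, h]
    trivial
  induction hspan using Submodule.span_induction with
  | mem u hu =>
    obtain ⟨y, hy, x, hx, rfl⟩ := hu
    rw [Finset.mem_coe] at hx hy
    simp only [vsub_eq_sub]
    by_cases hxy : x = y
    · simp [hxy]
    rw [setIntegral_fderiv_edge hK hind hx hy hxy hf, ← Finset.sum_subset
      (show ({x, y} : Finset _) ⊆ K by
        intro z hz
        simp only [Finset.mem_insert, Finset.mem_singleton] at hz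
        rcases hz with rfl | rfl <;> assumption), Finset.sum_pair hxy]
    intro w hw hwxy
    simp only [Finset.mem_insert, Finset.mem_singleton, not_or] at hwxy
    -- All other faces contain both end points of the edge, hence their normals are orthogonal to
    -- it.
    rw [(isOutwardNormal_erase hK hind hw).2.1 x (Finset.mem_erase.2 ⟨Ne.symm hwxy.1, hx⟩) y
      (Finset.mem_erase.2 ⟨Ne.symm hwxy.2, hy⟩), zero_mul]
  | zero => simp
  | add u v _ _ hu hv =>
    simp only [map_add, inner_add_right, add_mul, Finset.sum_add_distrib]
    rw [integral_add (hci u) (hci v), hu, hv]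
  | smul c u _ hu =>
    simp only [map_smul, inner_smul_right, smul_eq_mul, mul_assoc, ← Finset.mul_sum]
    rw [integral_const_mul, hu]

open Classical in
/-- A sum over the vertices of a simplex as a sum over the opposite faces. -/
theorem sum_erase_eq_sum_powersetCard {K : Finset (Space d)} (hK : K.card = d + 1)
    (G : Finset (Space d) → ℝ) :
    ∑ w ∈ K, G (K.erase w) = ∑ F ∈ K.powersetCard d, G F := by
  refine Finset.sum_bij (fun w _ => K.erase w) ?_ ?_ ?_ (fun _ _ => rfl)
  · intro w hw
    rw [Finset.mem_powersetCard]
    exact ⟨K.erase_subset w, by rw [Finset.card_erase_of_mem hw, hK]; rfl⟩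
  · intro w hw u hu h
    by_contra hne
    have h1 : w ∈ K.erase u := Finset.mem_erase.2 ⟨hne, hw⟩
    rw [← h] at h1
    exact Finset.notMem_erase w K h1
  · intro F hF
    rw [Finset.mem_powersetCard] at hF
    have h1 : (K \ F).card = 1 := by
      rw [Finset.card_sdiff_of_subset hF.1, hK, hF.2]
      omega
    obtain ⟨w, hw⟩ := Finset.card_eq_one.1 h1
    refine ⟨w, ?_, ?_⟩
    · have : w ∈ K \ F := by rw [hw]; exact Finset.mem_singleton_self w
      exact (Finset.mem_sdiff.1 this).1
    · rw [Finset.erase_eq, ← hw, Finset.sdiff_sdiff_eq_self hF.1]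

/-- The divergence theorem on a simplex. -/
theorem setIntegral_div_hull {K : Finset (Space (n + 1))} (hK : K.card = n + 2)
    (hind : AffineIndependent ℝ ((↑) : K → Space (n + 1))) {v : Space (n + 1) → Space (n + 1)}
    (hv : ContDiff ℝ 1 v) :
    ∫ z in hull K, div v z =
      ∑ F ∈ K.powersetCard (n + 1), ∫ z in hull F, ⟪v z, normal K F⟫ ∂μHE[n] := by
  classical
  have hvi : ∀ i, ContDiff ℝ 1 fun z => v z i := fun i => (contDiff_euclidean.1 hv) i
  have hdiv : ∀ z, div v z =
      ∑ i, fderiv ℝ (fun z => v z i) z (EuclideanSpace.single i 1) := fun z => by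
    refine Finset.sum_congr rfl fun i _ => ?_
    have h1 : HasFDerivAt (fun z => v z i) _ z := ((PiLp.proj 2 (𝕜 := ℝ)
      (fun _ : Fin (n + 1) => ℝ) i).hasFDerivAt).comp z
        (hv.differentiable one_ne_zero z).hasFDerivAt
    rw [h1.fderiv]
    rfl
  simp only [hdiv]
  rw [integral_finsetSum _ fun i _ => (((hvi i).continuous_fderiv one_ne_zero).clm_apply
      continuous_const).continuousOn.integrableOn_compact (isCompact_hull K)]
  simp only [setIntegral_fderiv_hull hK hind (hvi _)]
  rw [Finset.sum_comm, ← sum_erase_eq_sum_powersetCard hK]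
  refine Finset.sum_congr rfl fun w hw => ?_
  have hi : ∀ i ∈ Finset.univ, IntegrableOn
      (fun z => ⟪normal K (K.erase w), EuclideanSpace.single i (1 : ℝ)⟫ * v z i)
      (hull (K.erase w)) μHE[n] := fun i _ =>
    integrableOn_hull (by rw [Finset.card_erase_of_mem hw, hK]; rfl)
      (continuous_const.mul (hvi i).continuous)
  simp only [← integral_const_mul]
  rw [← integral_finsetSum _ hi]
  refine integral_congr_ae (Filter.Eventually.of_forall fun z => ?_)
  simp [PiLp.inner_apply]

/-! ### The discrete trace inequality -/

/-- A polynomial as a function on Euclidean space. -/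
def polyFun (P : MvPolynomial (Fin d) ℝ) (x : Space d) : ℝ :=
  MvPolynomial.eval (fun i => x i) P

theorem contDiff_polyFun (P : MvPolynomial (Fin d) ℝ) {k : WithTop ℕ∞} :
    ContDiff ℝ k (polyFun P) := by
  unfold polyFun
  induction P using MvPolynomial.induction_on with
  | C a => simpa using contDiff_const
  | add p q hp hq => simpa using hp.add hq
  | mul_X p i hp =>
    simp only [map_mul, MvPolynomial.eval_X]
    exact hp.mul ((contDiff_piLp_apply 2).of_le le_top)

theorem continuous_polyFun (P : MvPolynomial (Fin d) ℝ) : Continuous (polyFun P) :=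
  (contDiff_polyFun P (k := 0)).continuous

theorem totalDegree_aeval_le {σ τ : Type*} (P : MvPolynomial σ ℝ)
    {g : σ → MvPolynomial τ ℝ} (hg : ∀ i, (g i).totalDegree ≤ 1) :
    (MvPolynomial.aeval g P).totalDegree ≤ P.totalDegree := by
  rw [MvPolynomial.aeval_def, MvPolynomial.eval₂_eq]
  refine MvPolynomial.totalDegree_finsetSum_le fun s hs => ?_
  refine (MvPolynomial.totalDegree_mul _ _).trans ?_
  rw [show algebraMap ℝ (MvPolynomial τ ℝ) = MvPolynomial.C from rfl,
    MvPolynomial.totalDegree_C, zero_add]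
  refine (MvPolynomial.totalDegree_finsetProd _ _).trans ?_
  refine le_trans ?_ (MvPolynomial.le_totalDegree hs)
  refine Finset.sum_le_sum fun i _ => ?_
  exact (MvPolynomial.totalDegree_pow _ _).trans (by nlinarith [hg i, Nat.zero_le (s i)])

theorem exists_polyFun_comp_param (a : Fin (n + 1) → Space d) (P : MvPolynomial (Fin d) ℝ) :
    ∃ Q : MvPolynomial (Fin n) ℝ, Q.totalDegree ≤ P.totalDegree ∧
      ∀ z, polyFun Q z = polyFun P (param a z) := by
  refine ⟨MvPolynomial.aeval (fun i => MvPolynomial.C (a 0 i) +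
    ∑ j : Fin n, MvPolynomial.C (a j.succ i - a 0 i) * MvPolynomial.X j) P,
    totalDegree_aeval_le P fun i => ?_, fun z => ?_⟩
  · refine (MvPolynomial.totalDegree_add _ _).trans (max_le (by simp) ?_)
    refine MvPolynomial.totalDegree_finsetSum_le fun j _ => ?_
    refine (MvPolynomial.totalDegree_mul _ _).trans ?_
    rw [MvPolynomial.totalDegree_C, MvPolynomial.totalDegree_X]
  · unfold polyFun
    rw [← MvPolynomial.aeval_eq_eval, ← MvPolynomial.aeval_eq_eval, ← AlgHom.comp_apply,
      MvPolynomial.comp_aeval]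
    congr 2
    funext i
    simp [param, edgeMap_apply, mul_comm]

/-- An open set contains a product of infinite sets of real numbers, and a polynomial vanishing on
such a product is zero. -/
theorem eq_zero_of_polyFun_eqOn {P : MvPolynomial (Fin d) ℝ} {U : Set (Space d)} (hU : IsOpen U)
    (hne : U.Nonempty) (h : ∀ x ∈ U, polyFun P x = 0) : P = 0 := by
  obtain ⟨x, hx⟩ := hne
  have hU' : IsOpen ((WithLp.toLp 2 : (Fin d → ℝ) → Space d) ⁻¹' U) :=
    hU.preimage (PiLp.continuous_toLp 2 _)
  obtain ⟨ε, hε, hb⟩ := Metric.isOpen_iff.1 hU' x.ofLp hx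
  refine MvPolynomial.funext_set (fun i => Metric.ball (x i) ε) (fun i => ?_) fun y hy => ?_
  · rw [Real.ball_eq_Ioo]
    exact Set.Ioo_infinite (by linarith)
  · rw [map_zero]
    refine h (WithLp.toLp 2 y) (hb ?_)
    rw [ball_pi _ hε]
    exact hy

/-- The quotient `B / A` is bounded on the compact unit sphere, and homogeneity extends the bound.
This plays the part of the equivalence of norms, without exhibiting `A` and `B` as squares of norms.
-/
theorem exists_le_mul_of_homogeneous {E : Type*} [NormedAddCommGroup E] [NormedSpace ℝ E]
    [FiniteDimensional ℝ E] {A B : E → ℝ} (hA : Continuous A) (hB : Continuous B)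
    (hA2 : ∀ (r : ℝ) x, A (r • x) = r ^ 2 * A x) (hB2 : ∀ (r : ℝ) x, B (r • x) = r ^ 2 * B x)
    (hpos : ∀ x, x ≠ 0 → 0 < A x) : ∃ C : ℝ, 0 < C ∧ ∀ x, B x ≤ C * A x := by
  have hne : ∀ x ∈ Metric.sphere (0 : E) 1, x ≠ 0 := fun x hx =>
    ne_zero_of_mem_unit_sphere ⟨x, hx⟩
  obtain ⟨C, hC⟩ := (isCompact_sphere (0 : E) 1).exists_bound_of_continuousOn
    (f := fun x => B x / A x) (hB.continuousOn.div hA.continuousOn fun x hx => (hpos x (hne x hx)).ne')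
  refine ⟨max C 1, by positivity, fun x => ?_⟩
  by_cases hx : x = 0
  · have h1 := hA2 0 0
    have h2 := hB2 0 0
    rw [hx]
    simp at h1 h2
    simp [h1, h2]
  · have hn : ‖x‖ ≠ 0 := norm_ne_zero_iff.2 hx
    have hy : ‖x‖⁻¹ • x ∈ Metric.sphere (0 : E) 1 := by
      simp [norm_smul, hn]
    have h1 := (le_abs_self _).trans (hC _ hy)
    rw [div_le_iff₀ (hpos _ (hne _ hy)), hA2, hB2] at h1
    have h2 : B x ≤ C * A x := by
      have h3 : 0 < (‖x‖⁻¹) ^ 2 := by positivity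
      refine le_of_mul_le_mul_left ?_ h3
      linarith
    exact h2.trans (mul_le_mul_of_nonneg_right (le_max_left _ _) (hpos x hx).le)

theorem setIntegral_polyFun_sq_pos {P : MvPolynomial (Fin n) ℝ} (hP : P ≠ 0) :
    0 < ∫ z in refSimplex n, polyFun P z ^ 2 := by
  refine lt_of_le_of_ne (integral_nonneg fun z => sq_nonneg _) (Ne.symm fun h0 => hP ?_)
  have hcq : Continuous fun z => polyFun P z ^ 2 := (continuous_polyFun _).pow 2
  rw [integral_eq_zero_iff_of_nonneg (fun z => sq_nonneg _)
    (hcq.continuousOn.integrableOn_compact (isCompact_refSimplex _))] at h0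
  obtain ⟨U, hU, hne, hs⟩ := interior_refSimplex_nonempty n
  have h1 := Measure.eqOn_open_of_ae_eq (ae_restrict_of_ae_restrict_of_subset hs h0) hU
    hcq.continuousOn continuousOn_const
  exact eq_zero_of_polyFun_eqOn hU hne fun x hx => by simpa using h1 hx

theorem continuous_consCoord_right (s : ℝ) : Continuous fun y : Space n => consCoord s y :=
  continuous_consCoord.comp ((continuous_const (y := s)).prodMk continuous_id)

/-- Discrete trace inequality on the reference simplex. -/
theorem exists_refSimplex_trace_const (n p : ℕ) : ∃ C : ℝ, 0 < C ∧
    ∀ Q : MvPolynomial (Fin (n + 1)) ℝ, Q.totalDegree ≤ p →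
      ∫ y in refSimplex n, polyFun Q (consCoord 0 y) ^ 2 ≤
        C * ∫ z in refSimplex (n + 1), polyFun Q z ^ 2 := by
  -- In coordinates with respect to a basis of `V`, both integrals are continuous and 2-homogeneous
  -- functions on `Fin N → ℝ`, to which the compactness lemma applies.
  let V := MvPolynomial.restrictTotalDegree (Fin (n + 1)) ℝ p
  obtain ⟨N, ⟨b⟩⟩ : ∃ N, Nonempty (Module.Basis (Fin N) ℝ V) := ⟨_, ⟨Module.finBasis ℝ V⟩⟩
  obtain ⟨q, hqd⟩ : ∃ q : (Fin N → ℝ) → MvPolynomial (Fin (n + 1)) ℝ,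
      ∀ c, q c = ∑ i, c i • (b i : MvPolynomial (Fin (n + 1)) ℝ) := ⟨_, fun _ => rfl⟩
  have hq : ∀ c x, polyFun (q c) x = ∑ i, c i * polyFun (b i : MvPolynomial _ ℝ) x := by
    intro c x
    simp [hqd, polyFun, MvPolynomial.smul_eval]
  have hqb : ∀ Q : V, q (b.repr Q) = Q := fun Q => by
    have h := congrArg Subtype.val (b.sum_repr Q)
    rw [AddSubmonoidClass.coe_finsetSum] at h
    rw [hqd, ← h]
    rfl
  have hq0 : ∀ c, q c = 0 → c = 0 := fun c hc => by
    have h3 : ∑ i, c i • b i = 0 := by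
      apply Subtype.ext
      simpa [hqd] using hc
    funext i
    exact Fintype.linearIndependent_iff.1 b.linearIndependent c h3 i
  have hcont : Continuous fun x : (Fin N → ℝ) × Space (n + 1) =>
      polyFun (q x.1) x.2 := by
    simp only [hq]
    refine continuous_finsetSum _ fun i _ => ?_
    exact ((continuous_apply i).comp continuous_fst).mul ((continuous_polyFun _).comp continuous_snd)
  have hsmul : ∀ (r : ℝ) c x, polyFun (q (r • c)) x = r * polyFun (q c) x := by
    intro r c x
    simp only [hq, Pi.smul_apply, smul_eq_mul, mul_assoc, Finset.mul_sum]
  have hcont' : Continuous fun x : (Fin N → ℝ) × Space n =>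
      polyFun (q x.1) (consCoord 0 x.2) :=
    (hcont.comp (continuous_fst.prodMk ((continuous_consCoord_right 0).comp
      continuous_snd))).congr fun _ => rfl
  have hA : Continuous fun c : Fin N → ℝ => ∫ z in refSimplex (n + 1), polyFun (q c) z ^ 2 :=
    continuous_parametric_integral_of_continuous (hcont.pow 2) (isCompact_refSimplex _)
  have hB : Continuous fun c : Fin N → ℝ =>
      ∫ y in refSimplex n, polyFun (q c) (consCoord 0 y) ^ 2 :=
    continuous_parametric_integral_of_continuous
      (f := fun c y => polyFun (q c) (consCoord 0 y) ^ 2) ((hcont'.pow 2).congr fun _ => rfl)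
      (isCompact_refSimplex _)
  obtain ⟨C, hC0, hC⟩ := exists_le_mul_of_homogeneous hA hB
    (fun r c => by simp only [hsmul, mul_pow, integral_const_mul])
    (fun r c => by simp only [hsmul, mul_pow, integral_const_mul])
    (fun c hc => setIntegral_polyFun_sq_pos fun h => hc (hq0 c h))
  refine ⟨C, hC0, fun Q hQ => ?_⟩
  have h := hC (b.repr ⟨Q, (MvPolynomial.mem_restrictTotalDegree _ _ _).2 hQ⟩)
  rwa [hqb] at h

/-- If a simplex contains a ball of radius `r`, then its heights are at least `r`. -/
theorem le_height_of_ball_subset {K F : Finset (Space d)} {ν c x y : Space d} {r : ℝ}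
    (hν : IsOutwardNormal K F ν) (hF : ∀ z ∈ K, z = y ∨ z ∈ F) (hx : x ∈ F) (hyK : y ∈ K)
    (hyF : y ∉ F) (hr : Metric.ball c r ⊆ hull K) : r ≤ ⟪ν, x - y⟫ := by
  by_contra! hlt
  obtain ⟨h1, h2, h3⟩ := hν
  have hpos : ⟪ν, y - x⟫ < 0 := h3 y hyK hyF x hx
  have hneg : ⟪ν, x - y⟫ = -⟪ν, y - x⟫ := by rw [← inner_neg_right, neg_sub]
  have hub : hull K ⊆ {z | ⟪ν, z - x⟫ ≤ 0 ∧ ⟪ν, y - x⟫ ≤ ⟪ν, z - x⟫} := by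
    have hlin : IsLinearMap ℝ fun z : Space d => ⟪ν, z⟫ :=
      (innerₛₗ ℝ ν).isLinear
    refine convexHull_min (fun z hz => ?_) ?_
    · rcases hF z hz with rfl | hzF
      · exact ⟨hpos.le, le_rfl⟩
      · have := h2 x hx z hzF
        exact ⟨this.le, by rw [this]; exact hpos.le⟩
    · simp only [inner_sub_right, sub_nonpos, sub_le_sub_iff_right]
      exact (convex_halfSpace_le hlin _).inter (convex_halfSpace_ge hlin _)
  -- On the simplex the `ν`-coordinate varies by at most the height, while the points `c + s • ν`
  -- and `c - s • ν` of the ball differ in it by `2 * s`, which is more than the height.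
  obtain ⟨s, hs1, hs2⟩ := exists_between hlt
  have hs0 : 0 < s := by linarith
  have hνν : ⟪ν, ν⟫ = 1 := by rw [real_inner_self_eq_norm_sq, h1, one_pow]
  have hm1 : c + s • ν ∈ hull K := hr (by
    simp [Metric.mem_ball, norm_smul, h1, abs_of_pos hs0, hs2])
  have hm2 : c - s • ν ∈ hull K := hr (by
    simp [Metric.mem_ball, norm_smul, h1, abs_of_pos hs0, hs2])
  have e1 := (hub hm1).1
  have e2 := (hub hm2).2
  rw [add_sub_right_comm, inner_add_right, inner_smul_right, hνν] at e1
  rw [sub_right_comm, inner_sub_right ν (c - x), inner_smul_right, hνν] at e2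
  linarith

/-- The discrete trace inequality. -/
theorem exists_trace_const (n p : ℕ) : ∃ C : ℝ, 0 < C ∧
    ∀ K : Finset (Space (n + 1)), K.card = n + 2 →
      AffineIndependent ℝ ((↑) : K → Space (n + 1)) →
      ∀ F ∈ K.powersetCard (n + 1), ∀ (c : Space (n + 1)) (r : ℝ), Metric.ball c r ⊆ hull K →
      ∀ P : MvPolynomial (Fin (n + 1)) ℝ, P.totalDegree ≤ p →
        r * ∫ x in hull F, polyFun P x ^ 2 ∂μHE[n] ≤ C * ∫ x in hull K, polyFun P x ^ 2 := by
  classical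
  obtain ⟨C, hC0, hC⟩ := exists_refSimplex_trace_const n p
  refine ⟨C, hC0, fun K hK hind F hF c r hr P hP => ?_⟩
  rw [Finset.mem_powersetCard] at hF
  obtain ⟨y, hy⟩ := Finset.card_eq_one.1 (show (K \ F).card = 1 by
    rw [Finset.card_sdiff_of_subset hF.1, hK, hF.2]; omega)
  have hyK : y ∈ K ∧ y ∉ F := Finset.mem_sdiff.1 (hy ▸ Finset.mem_singleton_self y)
  have hFe : F = K.erase y := by rw [Finset.erase_eq, ← hy, Finset.sdiff_sdiff_eq_self hF.1]
  obtain ⟨x, hx⟩ : F.Nonempty := Finset.card_pos.1 (by omega)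
  -- With the apex opposite `F` listed as `a 1`, the face `F` corresponds to the face of the
  -- reference simplex on which the first coordinate vanishes, the one covered by the reference
  -- estimate.
  obtain ⟨a, rfl, rfl, hinj, hra, ha⟩ := exists_enumeration hK hind (hF.1 hx) hyK.1
    (fun h => hyK.2 (h ▸ hx))
  have hν := isOutwardNormal_normal K F hK hind hF.1 hF.2 (by omega)
  have hface : (F : Set (Space (n + 1))) = range (a ∘ (1 : Fin (n + 2)).succAbove) := by
    rw [hFe, range_comp, Fin.range_succAbove, Finset.coe_erase, ← hra,
      image_compl_eq_range_sdiff_image hinj, image_singleton]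
  obtain ⟨hpos, hdet⟩ := normDet_eq_inner_normal_mul ha hra hface hν
  have hh := le_height_of_ball_subset hν (fun z hz => by
    rw [hFe, Finset.mem_erase]
    tauto) hx hyK.1 hyK.2 hr
  have hsq : Continuous fun z => polyFun P z ^ 2 := (continuous_polyFun P).pow 2
  have e1 := setIntegral_convexHull_range (a ∘ (1 : Fin (n + 2)).succAbove) hsq
  rw [← hface] at e1
  change ∫ x in hull F, _ ∂μHE[n] = _ at e1
  obtain ⟨Q, hQ, hQP⟩ := exists_polyFun_comp_param a P
  have h := hC Q (hQ.trans hP)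
  simp only [hQP, param_consCoord_zero] at h
  have hnn : 0 ≤ ∫ x in hull F, polyFun P x ^ 2 ∂μHE[n] := integral_nonneg fun x => sq_nonneg _
  calc r * ∫ x in hull F, polyFun P x ^ 2 ∂μHE[n]
      ≤ ⟪normal K F, a 0 - a 1⟫ * ∫ x in hull F, polyFun P x ^ 2 ∂μHE[n] :=
        mul_le_mul_of_nonneg_right hh hnn
    _ = (edgeMap a).normDet * ∫ y in refSimplex n,
          polyFun P (param (a ∘ (1 : Fin (n + 2)).succAbove) y) ^ 2 := by
        rw [e1, hdet, mul_assoc]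
    _ ≤ (edgeMap a).normDet * (C * ∫ z in refSimplex (n + 1), polyFun P (param a z) ^ 2) :=
        mul_le_mul_of_nonneg_left h (edgeMap a).normDet_nonneg
    _ = C * ∫ x in hull K, polyFun P x ^ 2 := by
        rw [setIntegral_hull_eq hra hsq]
        ring

/-! ### Geometry of simplices and their faces -/

theorem hull_mono {S T : Finset (Space d)} (h : S ⊆ T) : hull S ⊆ hull T :=
  convexHull_mono (by exact_mod_cast h)

theorem affineSpan_eq_top {K : Finset (Space d)} (hK : K.card = d + 1)
    (hind : AffineIndependent ℝ ((↑) : K → Space d)) :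
    affineSpan ℝ (K : Set (Space d)) = ⊤ := by
  have h := hind.affineSpan_eq_top_iff_card_eq_finrank_add_one.2
    (by rw [Fintype.card_coe, hK, finrank_euclideanSpace_fin])
  rwa [Subtype.range_coe_subtype] at h

theorem openCell_nonempty {K : Finset (Space d)} (hK : K.card = d + 1)
    (hind : AffineIndependent ℝ ((↑) : K → Space d)) : (openCell K).Nonempty :=
  interior_convexHull_nonempty_iff_affineSpan_eq_top.2 (affineSpan_eq_top hK hind)

theorem openCell_subset_hull (K : Finset (Space d)) : openCell K ⊆ hull K := interior_subset

theorem isOpen_openCell (K : Finset (Space d)) : IsOpen (openCell K) := isOpen_interior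

theorem closure_openCell {K : Finset (Space d)} (hK : K.card = d + 1)
    (hind : AffineIndependent ℝ ((↑) : K → Space d)) : closure (openCell K) = hull K := by
  rw [openCell, (convex_hull K).closure_interior_eq_closure_of_nonempty_interior
    (openCell_nonempty hK hind), (isCompact_hull K).isClosed.closure_eq]

theorem interior_hull_eq_empty {S : Finset (Space d)} (hS : S.card ≤ d) :
    interior (hull S) = ∅ := by
  by_contra h
  have h1 := interior_convexHull_nonempty_iff_affineSpan_eq_top.1 (nonempty_iff_ne_empty.2 h)
  have h2 : vectorSpan ℝ (S : Set (Space d)) = ⊤ := by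
    rw [← direction_affineSpan, h1, AffineSubspace.direction_top]
  have hne : S.Nonempty := by
    by_contra hne
    rw [Finset.not_nonempty_iff_eq_empty] at hne
    rw [hne] at h
    simp [hull] at h
  obtain ⟨m, hm⟩ : ∃ m, S.card = m + 1 := ⟨S.card - 1, by have := hne.card_pos; omega⟩
  classical
  have h3 := finrank_vectorSpan_image_finset_le ℝ (id : Space d → Space d) S hm
  rw [Finset.image_id, h2, finrank_top, finrank_euclideanSpace_fin] at h3
  omega

/-- The relative interior of the simplex with vertex set `F`. -/
def relint (F : Finset (Space d)) : Set (Space d) := hull F \ ⋃ G ∈ F.ssubsets, hull G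

theorem relint_subset_hull (F : Finset (Space d)) : relint F ⊆ hull F := sdiff_subset

theorem notMem_hull_of_mem_relint {F G : Finset (Space d)} {x : Space d} (hx : x ∈ relint F)
    (hG : G ⊂ F) : x ∉ hull G := fun h =>
  hx.2 (mem_biUnion (Finset.mem_ssubsets.2 hG) h)

/-- A simplex of dimension `m < n` has finite `m`-dimensional measure, so its `n`-dimensional
measure cannot be positive. -/
theorem measure_hull_eq_zero {G : Finset (Space d)} (hG : G.card ≤ n) :
    (μHE[n] : Measure (Space d)) (hull G) = 0 := by
  rcases Nat.eq_zero_or_pos G.card with h | h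
  · rw [Finset.card_eq_zero] at h
    simp [h, hull]
  · obtain ⟨m, hm⟩ : ∃ m, G.card = m + 1 := ⟨G.card - 1, by omega⟩
    rcases Measure.euclideanHausdorffMeasure_zero_or_top (show m < n by omega) (hull G) with h1 | h1
    · exact h1
    · exact absurd h1 (measure_hull_lt_top hm).ne

theorem measure_hull_diff_relint {F : Finset (Space d)} (hF : F.card = n + 1) :
    (μHE[n] : Measure (Space d)) (hull F \ relint F) = 0 := by
  refine measure_mono_null (t := ⋃ G ∈ F.ssubsets, hull G) (fun x hx => ?_) ?_
  · by_contra h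
    exact hx.2 ⟨hx.1, h⟩
  · refine (measure_biUnion_null_iff F.ssubsets.countable_toSet).2 fun G hG => ?_
    exact measure_hull_eq_zero (by
      have := Finset.card_lt_card (Finset.mem_ssubsets.1 hG)
      omega)

theorem ae_mem_relint {F : Finset (Space d)} (hF : F.card = n + 1) :
    ∀ᵐ x ∂(μHE[n] : Measure (Space d)).restrict (hull F), x ∈ relint F := by
  rw [ae_restrict_iff' (isCompact_hull F).measurableSet]
  refine measure_mono_null (fun x hx => ?_) (measure_hull_diff_relint hF)
  simp only [mem_compl_iff, mem_ofPred_eq, Classical.not_imp] at hx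
  exact hx

/-- The simplex has positive measure by affine independence, and its proper faces are null sets. -/
theorem relint_nonempty {F : Finset (Space d)} (hF : F.card = n + 1)
    (hind : AffineIndependent ℝ ((↑) : F → Space d)) : (relint F).Nonempty := by
  let e := F.equivFinOfCardEq hF
  let a : Fin (n + 1) → Space d := fun i => e.symm i
  have hr : range a = F := (e.symm.surjective.range_comp _).trans Subtype.range_coe
  have ha : AffineIndependent ℝ a := hind.comp_embedding e.symm.toEmbedding
  have h1 := setIntegral_convexHull_range a (g := fun _ => 1) continuous_const
  rw [hr] at h1
  by_contra h
  rw [not_nonempty_iff_eq_empty] at h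
  have h2 := measure_hull_diff_relint hF
  rw [h, sdiff_empty, hull] at h2
  rw [Measure.restrict_eq_zero.2 h2, integral_zero_measure] at h1
  have h3 := mul_pos (normDet_edgeMap_pos ha) (volume_refSimplex_pos n)
  simp only [integral_const, measureReal_restrict_apply_univ, smul_eq_mul, mul_one] at h1
  linarith

theorem inner_sub_eq_zero_of_mem_hull {F : Finset (Space d)} {ν x y : Space d}
    (hν : ∀ x ∈ F, ∀ y ∈ F, ⟪ν, y - x⟫ = 0) (hx : x ∈ hull F) (hy : y ∈ hull F) :
    ⟪ν, y - x⟫ = 0 := by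
  have hlin : IsLinearMap ℝ fun z : Space d => ⟪ν, z⟫ := (innerₛₗ ℝ ν).isLinear
  have h1 : ∀ z ∈ F, hull F ⊆ {y | ⟪ν, y⟫ = ⟪ν, z⟫} := fun z hz =>
    convexHull_min (fun w hw => by
      have := hν z hz w hw
      rw [inner_sub_right, sub_eq_zero] at this
      exact this) (convex_hyperplane hlin _)
  have hne : F.Nonempty := by
    rw [← Finset.coe_nonempty, ← convexHull_nonempty_iff (𝕜 := ℝ)]
    exact ⟨x, hx⟩
  obtain ⟨z, hz⟩ := hne
  have e1 : ⟪ν, x⟫ = ⟪ν, z⟫ := h1 z hz hx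
  have e2 : ⟪ν, y⟫ = ⟪ν, z⟫ := h1 z hz hy
  rw [inner_sub_right, e1, e2, sub_self]

/-- Near a point in the relative interior of a face, a simplex is a half space. -/
theorem exists_ball_inter_subset_hull {K F : Finset (Space d)} (hK : K.card = d + 1)
    (hind : AffineIndependent ℝ ((↑) : K → Space d)) (hFK : F ⊆ K) {ν : Space d}
    (hν : IsOutwardNormal K F ν) {x : Space d} (hx : x ∈ relint F) (hF : F.card = d) :
    ∃ ε > 0, ∀ y ∈ Metric.ball x ε, ⟪ν, y - x⟫ ≤ 0 → y ∈ hull K := by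
  classical
  let b : AffineBasis K ℝ (Space d) := ⟨((↑) : K → Space d), hind, by
    rw [Subtype.range_coe_subtype]
    exact affineSpan_eq_top hK hind⟩
  have hb : ∀ i, b i = (i : Space d) := fun _ => rfl
  have hhull : hull K = {y | ∀ i, 0 ≤ b.coord i y} := by
    rw [← b.convexHull_eq_nonneg_coord, show range b = K from Subtype.range_coe]
    rfl
  have hexp : ∀ y : Space d, ∑ i, b.coord i y • (i : Space d) = y := fun y =>
    b.linear_combination_coord_eq_self y
  -- If the barycentric coordinate at a vertex of `F` vanished, `x` would lie in the subface without
  -- that vertex, which the relative interior excludes. By continuity these coordinates stay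
  -- positive in a ball, so only the coordinate of the opposite vertex `a` has to be checked.
  have hpos : ∀ i : K, (i : Space d) ∈ F → 0 < b.coord i x := by
    intro i hi
    have h0 : ∀ j, 0 ≤ b.coord j x := by
      have := hull_mono hFK (relint_subset_hull F hx)
      rwa [hhull] at this
    refine lt_of_le_of_ne (h0 i) fun hz => ?_
    have h1 : x ∈ hull (K.erase i) := by
      have h4 := (convex_hull (K.erase i)).sum_mem (t := Finset.univ.erase i)
        (w := fun j : K => b.coord j x) (z := fun j => (j : Space d)) (fun j _ => h0 j)
        ((Finset.sum_erase (f := fun j : K => b.coord j x) _ hz.symm).trans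
          (b.sum_coord_apply_eq_one x)) (fun j hj =>
          subset_convexHull ℝ _ (by
            rw [Finset.mem_coe, Finset.mem_erase]
            exact ⟨fun h => (Finset.mem_erase.1 hj).1 (Subtype.ext h), j.2⟩))
      rw [Finset.sum_erase (f := fun j : K => b.coord j x • (j : Space d)) _
        (by rw [← hz, zero_smul]), hexp] at h4
      exact h4
    have h2 := AffineIndependent.convexHull_inter hind (K.erase_subset (i : Space d)) hFK
    have h3 : x ∈ hull (F.erase i) := by
      have : x ∈ convexHull ℝ ((K.erase i : Finset _) : Set (Space d)) ∩
        convexHull ℝ (F : Set (Space d)) := ⟨h1, relint_subset_hull F hx⟩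
      rw [← h2] at this
      refine convexHull_mono ?_ this
      intro z hz
      simp only [Finset.coe_erase, mem_inter_iff, mem_sdiff, mem_singleton_iff] at hz ⊢
      exact ⟨hz.2, hz.1.2⟩
    exact notMem_hull_of_mem_relint hx (Finset.erase_ssubset hi) h3
  obtain ⟨a, ha⟩ := Finset.card_eq_one.1 (show (K \ F).card = 1 by
    rw [Finset.card_sdiff_of_subset hFK, hK, hF]; omega)
  have haK : a ∈ K ∧ a ∉ F := Finset.mem_sdiff.1 (ha ▸ Finset.mem_singleton_self a)
  have hor : ∀ z ∈ K, z ≠ a → z ∈ F := by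
    intro z hz hza
    by_contra hzF
    have : z ∈ K \ F := Finset.mem_sdiff.2 ⟨hz, hzF⟩
    rw [ha, Finset.mem_singleton] at this
    exact hza this
  have hopen : IsOpen {y | ∀ i : K, (i : Space d) ∈ F → 0 < b.coord i y} := by
    have : {y | ∀ i : K, (i : Space d) ∈ F → 0 < b.coord i y} =
        ⋂ i : K, ⋂ _ : (i : Space d) ∈ F, {y | 0 < b.coord i y} := by
      ext y; simp
    rw [this]
    refine isOpen_iInter_of_finite fun i => isOpen_iInter_of_finite fun _ =>
      isOpen_lt continuous_const (continuous_barycentric_coord b i)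
  obtain ⟨ε, hε, hball⟩ := Metric.isOpen_iff.1 hopen x hpos
  refine ⟨ε, hε, fun y hy hle => ?_⟩
  rw [hhull]
  intro i
  by_cases hi : (i : Space d) = a
  · obtain ⟨v, hv⟩ : F.Nonempty := by
      rw [← Finset.coe_nonempty, ← convexHull_nonempty_iff (𝕜 := ℝ)]
      exact ⟨x, relint_subset_hull F hx⟩
    have hvx : ⟪ν, x⟫ = ⟪ν, v⟫ := by
      have := inner_sub_eq_zero_of_mem_hull hν.2.1 (subset_convexHull ℝ _ hv)
        (relint_subset_hull F hx)
      rwa [inner_sub_right, sub_eq_zero] at this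
    -- Since `ν` is orthogonal to `F`, only the vertex `a` contributes. As `⟪ν, a - v⟫ < 0`, the
    -- half-space condition says that this coordinate is nonnegative.
    have h1 : ⟪ν, y - x⟫ = b.coord i y * ⟪ν, a - v⟫ := by
      have h2 : y - x = ∑ j, b.coord j y • ((j : Space d) - x) := by
        simp only [smul_sub, Finset.sum_sub_distrib, ← Finset.sum_smul,
          b.sum_coord_apply_eq_one, one_smul, hexp]
      rw [h2, inner_sum, Finset.sum_eq_single i]
      · rw [inner_smul_right, hi, inner_sub_right, inner_sub_right, hvx]
      · intro j _ hj
        have hja : (j : Space d) ≠ a := fun h => hj (Subtype.ext (h.trans hi.symm))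
        rw [inner_smul_right, inner_sub_right, hvx, ← inner_sub_right,
          hν.2.1 v hv _ (hor j j.2 hja), mul_zero]
      · simp
    have h2 := hν.2.2 a haK.1 haK.2 v hv
    by_contra hneg
    push Not at hneg
    rw [h1] at hle
    nlinarith
  · exact (hball hy i (hor i i.2 hi)).le

/-- The normals to a face of two simplices are parallel. -/
theorem normal_eq_or_eq_neg {K J F : Finset (Space d)} (hF : F.card = d) (hd : 1 ≤ d)
    (hind : AffineIndependent ℝ ((↑) : F → Space d)) {ν ν' : Space d}
    (hν : IsOutwardNormal K F ν) (hν' : IsOutwardNormal J F ν') : ν' = ν ∨ ν' = -ν := by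
  set S : Submodule ℝ (Space d) := vectorSpan ℝ (F : Set (Space d)) with hS
  have hfr' : Module.finrank ℝ Sᗮ = 1 := by
    obtain ⟨x₀, hx₀⟩ : F.Nonempty := Finset.card_pos.1 (by omega)
    have : Nonempty F := ⟨⟨x₀, hx₀⟩⟩
    have h := hind.finrank_vectorSpan_add_one
    rw [Fintype.card_coe, hF, Subtype.range_coe_subtype] at h
    change Module.finrank ℝ S + 1 = d at h
    have h' := S.finrank_add_finrank_orthogonal
    rw [finrank_euclideanSpace_fin] at h'
    omega
  have hmem : ∀ m : Space d, (∀ x ∈ F, ∀ y ∈ F, ⟪m, y - x⟫ = 0) → m ∈ Sᗮ := by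
    intro m hm
    have : S ≤ (Submodule.span ℝ {m})ᗮ := by
      rw [hS, vectorSpan, Submodule.span_le]
      rintro _ ⟨y, hy, x, hx, rfl⟩
      exact Submodule.mem_orthogonal_singleton_iff_inner_right.2 (hm x hx y hy)
    exact (Submodule.le_orthogonal_iff_le_orthogonal.1 this) (Submodule.mem_span_singleton_self m)
  have hne : (⟨ν, hmem ν hν.2.1⟩ : Sᗮ) ≠ 0 := fun h0 => by
    have h1 : ν = 0 := congrArg Subtype.val h0
    have h2 := hν.1
    rw [h1, norm_zero] at h2
    exact zero_ne_one h2
  obtain ⟨c, hc⟩ := (finrank_eq_one_iff_of_nonzero' _ hne).1 hfr' ⟨ν', hmem ν' hν'.2.1⟩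
  have hc' : ν' = c • ν := by simpa using (congrArg Subtype.val hc).symm
  have h1 := hν'.1
  rw [hc', norm_smul, hν.1, mul_one, Real.norm_eq_abs] at h1
  rcases abs_eq zero_le_one |>.1 h1 with h | h
  · left; rw [hc', h, one_smul]
  · right; rw [hc', h, neg_smul, one_smul]

/-! ### Faces of a conforming triangulation -/

namespace Triangulation

variable {Ω : Set (Space d)} (M : Triangulation d Ω)

theorem isOutwardNormal {K F : Finset (Space d)} (hd : 1 ≤ d) (hK : K ∈ M.cells)
    (hF : F ∈ K.powersetCard d) : IsOutwardNormal K F (normal K F) := by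
  rw [Finset.mem_powersetCard] at hF
  exact isOutwardNormal_normal K F (M.card_eq K hK) (M.indep K hK) hF.1 hF.2 hd

theorem indep_of_subset {K F : Finset (Space d)} (hK : K ∈ M.cells) (hF : F ⊆ K) :
    AffineIndependent ℝ ((↑) : F → Space d) :=
  (M.indep K hK).mono (s := (F : Set (Space d))) (t := (K : Set (Space d))) (by exact_mod_cast hF)

theorem mem_cellsOf {K F : Finset (Space d)} : K ∈ M.cellsOf F ↔ K ∈ M.cells ∧ F ⊆ K := by
  simp [cellsOf]

theorem mem_faces {F : Finset (Space d)} :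
    F ∈ M.faces ↔ ∃ K ∈ M.cells, F ∈ K.powersetCard d := by
  simp [faces]

theorem card_of_mem_faces {F : Finset (Space d)} (hF : F ∈ M.faces) : F.card = d := by
  obtain ⟨K, -, h⟩ := M.mem_faces.1 hF
  exact (Finset.mem_powersetCard.1 h).2

theorem mem_powersetCard_of_mem_cellsOf {K F : Finset (Space d)} (hF : F ∈ M.faces)
    (hK : K ∈ M.cellsOf F) : F ∈ K.powersetCard d :=
  Finset.mem_powersetCard.2 ⟨(M.mem_cellsOf.1 hK).2, M.card_of_mem_faces hF⟩

theorem cellsOf_nonempty {F : Finset (Space d)} (hF : F ∈ M.faces) : (M.cellsOf F).Nonempty := by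
  obtain ⟨K, hK, h⟩ := M.mem_faces.1 hF
  exact ⟨K, M.mem_cellsOf.2 ⟨hK, (Finset.mem_powersetCard.1 h).1⟩⟩

theorem interiorFaces_subset_faces : M.interiorFaces ⊆ M.faces := by
  classical exact Finset.filter_subset _ _

theorem sum_faces (G : Finset (Space d) → ℝ) :
    ∑ F ∈ M.faces, G F = ∑ F ∈ M.interiorFaces, G F + ∑ F ∈ M.boundaryFaces, G F := by
  classical
  rw [interiorFaces, boundaryFaces, ← Finset.sum_filter_add_sum_filter_not M.faces
    (fun F => 2 ≤ (M.cellsOf F).card)]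
  congr 1
  refine Finset.sum_congr (Finset.filter_congr fun F hF => ?_) fun _ _ => rfl
  have := (M.cellsOf_nonempty hF).card_pos
  omega

theorem sum_cells_faces (G : Finset (Space d) → Finset (Space d) → ℝ) :
    ∑ K ∈ M.cells, ∑ F ∈ K.powersetCard d, G K F = ∑ F ∈ M.faces, ∑ K ∈ M.cellsOf F, G K F := by
  classical
  refine Finset.sum_comm' fun K F => ?_
  rw [mem_cellsOf, mem_faces, Finset.mem_powersetCard]
  constructor
  · rintro ⟨hK, hFK, hF⟩
    exact ⟨⟨hK, hFK⟩, K, hK, Finset.mem_powersetCard.2 ⟨hFK, hF⟩⟩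
  · rintro ⟨⟨hK, hFK⟩, J, hJ, hF⟩
    exact ⟨hK, hFK, (Finset.mem_powersetCard.1 hF).2⟩

/-- By conformity `x` lies in the simplex spanned by `K ∩ J`, and inside `J` this simplex meets that
of `F` in the simplex spanned by `K ∩ F`. The latter contains no relative interior point of `F`
unless `F ⊆ K`. -/
theorem subset_of_mem_relint_of_mem_hull {K J F : Finset (Space d)} (hJ : J ∈ M.cells)
    (hFJ : F ⊆ J) (hK : K ∈ M.cells) {x : Space d} (hx : x ∈ relint F) (hxK : x ∈ hull K) :
    F ⊆ K := by
  classical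
  by_contra hFK
  have h1 : x ∈ convexHull ℝ ((K : Set (Space d)) ∩ (J : Set (Space d))) := by
    rw [← M.conforming K hK J hJ]
    exact ⟨hxK, hull_mono hFJ (relint_subset_hull F hx)⟩
  have h2 := AffineIndependent.convexHull_inter (M.indep J hJ)
    (Finset.inter_subset_right (s₁ := K)) hFJ
  have h3 : x ∈ hull (K ∩ F) := by
    have : x ∈ convexHull ℝ ((K ∩ J : Finset _) : Set (Space d)) ∩
        convexHull ℝ (F : Set (Space d)) := by
      rw [Finset.coe_inter]
      exact ⟨h1, relint_subset_hull F hx⟩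
    rw [← h2] at this
    refine convexHull_mono ?_ this
    intro z hz
    simp only [Finset.coe_inter, mem_inter_iff] at hz ⊢
    exact ⟨hz.1.1, hz.2⟩
  refine notMem_hull_of_mem_relint hx ⟨Finset.inter_subset_right, fun h => hFK fun z hz => ?_⟩ h3
  exact (Finset.mem_inter.1 (h hz)).1

theorem openCell_subset (hΩ : interior (closure Ω) = Ω) {K : Finset (Space d)}
    (hK : K ∈ M.cells) : openCell K ⊆ Ω := by
  rw [← hΩ, ← M.covers]
  exact interior_mono (subset_biUnion_of_mem (u := fun K : Finset (Space d) =>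
    convexHull ℝ (K : Set (Space d))) hK)

theorem card_inter_le {K J : Finset (Space d)} [DecidableEq (Space d)] (hK : K ∈ M.cells)
    (hJ : J ∈ M.cells) (h : K ≠ J) : (K ∩ J).card ≤ d := by
  by_contra! hlt
  have h1 : K ∩ J = K := Finset.eq_of_subset_of_card_le Finset.inter_subset_left
    (by rw [M.card_eq K hK]; omega)
  have h2 : K ∩ J = J := Finset.eq_of_subset_of_card_le Finset.inter_subset_right
    (by rw [M.card_eq J hJ]; omega)
  exact h (h1.symm.trans h2)

/-- The closed elements meet in the hull of at most `d` points, which has empty interior. -/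
theorem disjoint_openCell {K J : Finset (Space d)} (hK : K ∈ M.cells)
    (hJ : J ∈ M.cells) (h : K ≠ J) : Disjoint (openCell K) (openCell J) := by
  classical
  rw [disjoint_iff_inter_eq_empty, openCell, openCell, ← interior_inter, hull, hull,
    M.conforming K hK J hJ, ← Finset.coe_inter]
  exact interior_hull_eq_empty (M.card_inter_le hK hJ h)

/-- The outward normals of two neighbouring elements are opposite. -/
theorem normal_eq_neg {K J F : Finset (Space d)} (hd : 1 ≤ d) (hF : F ∈ M.faces)
    (hK : K ∈ M.cellsOf F) (hJ : J ∈ M.cellsOf F) (h : K ≠ J) : normal J F = -normal K F := by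
  classical
  have hFc := M.card_of_mem_faces hF
  have hK' := M.mem_cellsOf.1 hK
  have hJ' := M.mem_cellsOf.1 hJ
  have hνK := M.isOutwardNormal hd hK'.1 (M.mem_powersetCard_of_mem_cellsOf hF hK)
  have hνJ := M.isOutwardNormal hd hJ'.1 (M.mem_powersetCard_of_mem_cellsOf hF hJ)
  have hind := M.indep_of_subset hK'.1 hK'.2
  refine (normal_eq_or_eq_neg hFc hd hind hνK hνJ).resolve_left fun heq => ?_
  obtain ⟨n, rfl⟩ : ∃ n, d = n + 1 := ⟨d - 1, by omega⟩
  obtain ⟨x, hx⟩ := relint_nonempty hFc hind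
  obtain ⟨ε₁, hε₁, h1⟩ := exists_ball_inter_subset_hull (M.card_eq K hK'.1) (M.indep K hK'.1) hK'.2
    hνK hx hFc
  obtain ⟨ε₂, hε₂, h2⟩ := exists_ball_inter_subset_hull (M.card_eq J hJ'.1) (M.indep J hJ'.1) hJ'.2
    hνJ hx hFc
  rw [heq] at h2
  set ν := normal K F
  -- If the normals were equal, both elements would contain the half ball on the same side of `F`.
  -- Then `x - s • ν` would lie in both, hence by conformity in the hull of `F`, which is orthogonal
  -- to `ν`.
  obtain ⟨s, hs0, hs⟩ := exists_between (lt_min hε₁ hε₂)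
  have hνν : ⟪ν, ν⟫ = 1 := by rw [real_inner_self_eq_norm_sq, hνK.1, one_pow]
  have hin : ⟪ν, x - s • ν - x⟫ = -s := by
    rw [sub_sub_cancel_left, inner_neg_right, inner_smul_right, hνν, mul_one]
  have hd : dist (x - s • ν) x = s := by
    rw [dist_eq_norm, sub_sub_cancel_left, norm_neg, norm_smul, hνK.1, mul_one, Real.norm_eq_abs,
      abs_of_pos hs0]
  have m1 := h1 (x - s • ν) (by rw [Metric.mem_ball, hd]; exact hs.trans_le (min_le_left _ _))
    (by rw [hin]; linarith)
  have m2 := h2 (x - s • ν) (by rw [Metric.mem_ball, hd]; exact hs.trans_le (min_le_right _ _))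
    (by rw [hin]; linarith)
  have m3 : x - s • ν ∈ convexHull ℝ ((K : Set (Space (n + 1))) ∩ (J : Set (Space (n + 1)))) := by
    rw [← M.conforming K hK'.1 J hJ'.1]
    exact ⟨m1, m2⟩
  have hKJ : K ∩ J = F := (Finset.eq_of_subset_of_card_le (Finset.subset_inter hK'.2 hJ'.2)
    (by rw [hFc]; exact M.card_inter_le hK'.1 hJ'.1 h)).symm
  rw [← Finset.coe_inter, hKJ] at m3
  have := inner_sub_eq_zero_of_mem_hull hνK.2.1 (relint_subset_hull F hx) m3
  rw [hin] at this
  linarith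

/-- Any two elements at a face have opposite normals, and three unit vectors cannot be pairwise
opposite. -/
theorem exists_cellsOf_eq_pair {F : Finset (Space d)} [DecidableEq (Finset (Space d))] (hd : 1 ≤ d)
    (hF : F ∈ M.interiorFaces) : ∃ K J, K ≠ J ∧ M.cellsOf F = {K, J} := by
  have hF' := M.interiorFaces_subset_faces hF
  have h2 : 2 ≤ (M.cellsOf F).card := by
    classical exact (Finset.mem_filter.1 hF).2
  obtain ⟨K, J, hK, hJ, hne⟩ := Finset.one_lt_card_iff.1 h2
  refine ⟨K, J, hne, Finset.Subset.antisymm (fun L hL => ?_) (fun L hL => ?_)⟩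
  · by_contra hL'
    simp only [Finset.mem_insert, Finset.mem_singleton, not_or] at hL'
    have h1 := M.normal_eq_neg hd hF' hK hJ hne
    have h2 := M.normal_eq_neg hd hF' hK hL (Ne.symm hL'.1)
    have h3 := M.normal_eq_neg hd hF' hJ hL (Ne.symm hL'.2)
    rw [h1, neg_neg, h2] at h3
    have h4 := (M.isOutwardNormal hd (M.mem_cellsOf.1 hK).1
      (M.mem_powersetCard_of_mem_cellsOf hF' hK)).1
    have h5 : normal K F = 0 := by
      have h6 : (2 : ℝ) • normal K F = 0 := by
        rw [two_smul]
        nth_rewrite 1 [← h3]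
        exact neg_add_cancel _
      exact (smul_eq_zero.1 h6).resolve_left two_ne_zero
    rw [h5, norm_zero] at h4
    exact zero_ne_one h4
  · simp only [Finset.mem_insert, Finset.mem_singleton] at hL
    rcases hL with rfl | rfl <;> assumption

/-- The two elements contain the two halves of a small ball around `x`, so `x` is interior to the
closure of `Ω`. This is where `Ω = int (closure Ω)` excludes slits along faces. -/
theorem relint_subset (hΩ : interior (closure Ω) = Ω) {F : Finset (Space d)} (hd : 1 ≤ d)
    (hF : F ∈ M.interiorFaces) : relint F ⊆ Ω := by
  classical
  intro x hx
  obtain ⟨K, J, hne, hKJ⟩ := M.exists_cellsOf_eq_pair hd hF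
  have hF' := M.interiorFaces_subset_faces hF
  have hFc := M.card_of_mem_faces hF'
  have hK : K ∈ M.cellsOf F := by rw [hKJ]; simp
  have hJ : J ∈ M.cellsOf F := by rw [hKJ]; simp
  have hK' := M.mem_cellsOf.1 hK
  have hJ' := M.mem_cellsOf.1 hJ
  obtain ⟨ε₁, hε₁, h1⟩ := exists_ball_inter_subset_hull (M.card_eq K hK'.1) (M.indep K hK'.1) hK'.2
    (M.isOutwardNormal hd hK'.1 (M.mem_powersetCard_of_mem_cellsOf hF' hK)) hx hFc
  obtain ⟨ε₂, hε₂, h2⟩ := exists_ball_inter_subset_hull (M.card_eq J hJ'.1) (M.indep J hJ'.1) hJ'.2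
    (M.isOutwardNormal hd hJ'.1 (M.mem_powersetCard_of_mem_cellsOf hF' hJ)) hx hFc
  rw [M.normal_eq_neg hd hF' hK hJ hne] at h2
  rw [← hΩ, ← M.covers, mem_interior_iff_mem_nhds, Metric.mem_nhds_iff]
  refine ⟨min ε₁ ε₂, lt_min hε₁ hε₂, fun y hy => ?_⟩
  simp only [mem_iUnion]
  rcases le_total ⟪normal K F, y - x⟫ 0 with hle | hle
  · exact ⟨K, hK'.1, h1 y (Metric.ball_subset_ball (min_le_left _ _) hy) hle⟩
  · exact ⟨J, hJ'.1, h2 y (Metric.ball_subset_ball (min_le_right _ _) hy)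
      (by rw [inner_neg_left]; linarith)⟩

end Triangulation

/-! ### Traces -/

theorem trace_eq {Y : Type*} [TopologicalSpace Y] [T2Space Y] {K : Finset (Space d)}
    (hK : K.card = d + 1) (hind : AffineIndependent ℝ ((↑) : K → Space d)) {φ g : Space d → Y}
    {x : Space d} (hg : ContinuousAt g x) (h : EqOn φ g (openCell K)) (hx : x ∈ hull K) :
    trace K φ x = g x := by
  refine extendFrom_eq (by rwa [closure_openCell hK hind]) ?_
  exact (hg.tendsto.mono_left nhdsWithin_le_nhds).congr'
    (eventually_nhdsWithin_of_forall fun y hy => (h hy).symm)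

theorem integrableOn_hull_of_continuousOn {E : Type*} [NormedAddCommGroup E]
    {F : Finset (Space d)} (hF : F.card = n + 1) {g : Space d → E}
    (hg : ContinuousOn g (hull F)) : IntegrableOn g (hull F) μHE[n] :=
  hg.integrableOn_of_subset_isCompact (isCompact_hull F)
    (isCompact_hull F).measurableSet Subset.rfl (measure_hull_lt_top hF).ne

/-- The frontier of a convex set is a null set. -/
theorem openCell_ae_eq_hull (K : Finset (Space d)) : openCell K =ᵐ[volume] hull K := by
  have h := (convex_hull K).addHaar_frontier volume
  rw [(isCompact_hull K).isClosed.frontier_eq] at h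
  exact (openCell_subset_hull K).eventuallyLE.antisymm (ae_le_set.2 h)

theorem div_smul_eq {φ : Space d → ℝ} {w : Space d → Space d} {x : Space d}
    (hφ : DifferentiableAt ℝ φ x) (hw : DifferentiableAt ℝ w x) :
    div (fun y => φ y • w y) x = ⟪gradient φ x, w x⟫ + φ x * div w x := by
  have h := (hφ.hasFDerivAt.smul hw.hasFDerivAt).fderiv
  change fderiv ℝ (fun y => φ y • w y) x = _ at h
  have hw' : fderiv ℝ φ x (w x) = ∑ i, w x i * fderiv ℝ φ x (EuclideanSpace.single i 1) := by
    conv_lhs => rw [← (EuclideanSpace.basisFun (Fin d) ℝ).sum_repr (w x), map_sum]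
    simp
  rw [div, h, div, Finset.mul_sum, add_comm, inner_gradient_left, hw']
  simp [Finset.sum_add_distrib, mul_comm, add_comm]

theorem div_congr {v w : Space d → Space d} {x : Space d} (h : v =ᶠ[𝓝 x] w) :
    div v x = div w x := by
  simp only [div, h.fderiv_eq]

theorem gradient_congr {φ ψ : Space d → ℝ} {x : Space d} (h : φ =ᶠ[𝓝 x] ψ) :
    gradient φ x = gradient ψ x := by
  simp only [gradient, h.fderiv_eq]

theorem jacobian_congr {v w : Space d → Space d} {x : Space d} (h : v =ᶠ[𝓝 x] w) :
    jacobian v x = jacobian w x := by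
  simp only [jacobian, h.fderiv_eq]

theorem contDiff_div {v : Space d → Space d} (hv : ContDiff ℝ ∞ v) : ContDiff ℝ ∞ (div v) := by
  unfold div
  refine ContDiff.sum fun i _ => ?_
  exact (contDiff_euclidean.1 ((hv.fderiv_right (m := ∞) (by simp)).clm_apply contDiff_const)) i

theorem contDiff_gradient {φ : Space d → ℝ} (hφ : ContDiff ℝ ∞ φ) :
    ContDiff ℝ ∞ (gradient φ) := by
  unfold gradient
  exact (InnerProductSpace.toDual ℝ (Space d)).symm.contDiff.comp
    (hφ.fderiv_right (m := ∞) (by simp))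

/-! ### Elementwise smooth functions and their traces -/

namespace Triangulation

variable {Ω : Set (Space d)} (M : Triangulation d Ω)

/-- `φ` coincides on each open element `K` with the smooth function `g K`. -/
def IsRep {E : Type*} [NormedAddCommGroup E] [NormedSpace ℝ E] (φ : Space d → E)
    (g : Finset (Space d) → Space d → E) : Prop :=
  ∀ K ∈ M.cells, ContDiff ℝ ∞ (g K) ∧ EqOn φ (g K) (openCell K)

variable {M}

section Rep

variable {E : Type*} [NormedAddCommGroup E] [NormedSpace ℝ E] {φ ψ : Space d → E}
  {g k : Finset (Space d) → Space d → E}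

theorem IsRep.eventuallyEq (h : M.IsRep φ g) {K : Finset (Space d)} (hK : K ∈ M.cells)
    {x : Space d} (hx : x ∈ openCell K) : φ =ᶠ[𝓝 x] g K :=
  Filter.eventuallyEq_of_mem ((isOpen_openCell K).mem_nhds hx) (h K hK).2

theorem IsRep.add (hφ : M.IsRep φ g) (hψ : M.IsRep ψ k) :
    M.IsRep (fun x => φ x + ψ x) fun K x => g K x + k K x := fun K hK =>
  ⟨(hφ K hK).1.add (hψ K hK).1, fun x hx => by
    simp only [(hφ K hK).2 hx, (hψ K hK).2 hx]⟩

theorem IsRep.smul {f : Space d → ℝ} {u : Finset (Space d) → Space d → ℝ} (hf : M.IsRep f u)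
    (hφ : M.IsRep φ g) : M.IsRep (fun x => f x • φ x) fun K x => u K x • g K x := fun K hK =>
  ⟨(hf K hK).1.smul (hφ K hK).1, fun x hx => by
    simp only [(hφ K hK).2 hx, (hf K hK).2 hx]⟩

theorem isRep_const (c : E) : M.IsRep (fun _ => c) fun _ _ => c := fun _ _ =>
  ⟨contDiff_const, fun _ _ => rfl⟩

theorem IsRep.sub (hφ : M.IsRep φ g) (hψ : M.IsRep ψ k) :
    M.IsRep (fun x => φ x - ψ x) fun K x => g K x - k K x := fun K hK =>
  ⟨(hφ K hK).1.sub (hψ K hK).1, fun x hx => by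
    simp only [(hφ K hK).2 hx, (hψ K hK).2 hx]⟩

theorem IsRep.trace_eq (h : M.IsRep φ g) {K : Finset (Space d)} (hK : K ∈ M.cells)
    {x : Space d} (hx : x ∈ hull K) : trace K φ x = g K x :=
  NSK.trace_eq (M.card_eq K hK) (M.indep K hK) (h K hK).1.continuous.continuousAt (h K hK).2 hx

theorem IsRep.avg_eq (h : M.IsRep φ g) (F : Finset (Space d)) {x : Space d} (hx : x ∈ hull F) :
    M.avg F φ x = ((M.cellsOf F).card : ℝ)⁻¹ • ∑ K ∈ M.cellsOf F, g K x := by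
  unfold avg
  congr 1
  refine Finset.sum_congr rfl fun K hK => ?_
  rw [M.mem_cellsOf] at hK
  exact h.trace_eq hK.1 (hull_mono hK.2 hx)

theorem IsRep.continuousOn_avg (h : M.IsRep φ g) (F : Finset (Space d)) :
    ContinuousOn (M.avg F φ) (hull F) :=
  ContinuousOn.congr (Continuous.continuousOn (by
    refine Continuous.const_smul (continuous_finsetSum _ fun K hK => ?_) _
    exact (h K (M.mem_cellsOf.1 hK).1).1.continuous)) fun _ hx => h.avg_eq F hx

end Rep

theorem IsRep.inner {v w : Space d → Space d} {g k : Finset (Space d) → Space d → Space d}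
    (hv : M.IsRep v g) (hw : M.IsRep w k) :
    M.IsRep (fun x => ⟪v x, w x⟫) fun K x => ⟪g K x, k K x⟫ := fun K hK =>
  ⟨(hv K hK).1.inner ℝ (hw K hK).1, fun x hx => by
    simp only [(hv K hK).2 hx, (hw K hK).2 hx]⟩

theorem IsRep.mul {φ ψ : Space d → ℝ} {g k : Finset (Space d) → Space d → ℝ}
    (hφ : M.IsRep φ g) (hψ : M.IsRep ψ k) :
    M.IsRep (fun x => φ x * ψ x) fun K x => g K x * k K x :=
  hφ.smul hψ

theorem IsRep.div {v : Space d → Space d} {g : Finset (Space d) → Space d → Space d}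
    (hv : M.IsRep v g) : M.IsRep (div v) fun K => NSK.div (g K) := fun K hK =>
  ⟨contDiff_div (hv K hK).1, fun _ hx => div_congr (hv.eventuallyEq hK hx)⟩

theorem IsRep.gradient {φ : Space d → ℝ} {g : Finset (Space d) → Space d → ℝ}
    (hφ : M.IsRep φ g) : M.IsRep (gradient φ) fun K => _root_.gradient (g K) := fun K hK =>
  ⟨contDiff_gradient (hφ K hK).1, fun _ hx => gradient_congr (hφ.eventuallyEq hK hx)⟩

section Jump

variable {φ : Space d → ℝ} {g : Finset (Space d) → Space d → ℝ} {v : Space d → Space d}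
  {u : Finset (Space d) → Space d → Space d}

theorem IsRep.jump_eq (h : M.IsRep φ g) (F : Finset (Space d)) {x : Space d} (hx : x ∈ hull F) :
    M.jump F φ x = ∑ K ∈ M.cellsOf F, g K x • normal K F := by
  refine Finset.sum_congr rfl fun K hK => ?_
  rw [M.mem_cellsOf] at hK
  rw [h.trace_eq hK.1 (hull_mono hK.2 hx)]

theorem IsRep.continuousOn_jump (h : M.IsRep φ g) (F : Finset (Space d)) :
    ContinuousOn (M.jump F φ) (hull F) :=
  ContinuousOn.congr (Continuous.continuousOn (by
    refine continuous_finsetSum _ fun K hK => ?_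
    have := (h K (M.mem_cellsOf.1 hK).1).1.continuous
    fun_prop)) fun _ hx => h.jump_eq F hx

theorem IsRep.jumpVec_eq (h : M.IsRep v u) (F : Finset (Space d)) {x : Space d}
    (hx : x ∈ hull F) : M.jumpVec F v x = ∑ K ∈ M.cellsOf F, ⟪u K x, normal K F⟫ := by
  refine Finset.sum_congr rfl fun K hK => ?_
  rw [M.mem_cellsOf] at hK
  rw [h.trace_eq hK.1 (hull_mono hK.2 hx)]

theorem IsRep.continuousOn_jumpVec (h : M.IsRep v u) (F : Finset (Space d)) :
    ContinuousOn (M.jumpVec F v) (hull F) :=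
  ContinuousOn.congr (Continuous.continuousOn (by
    refine continuous_finsetSum _ fun K hK => ?_
    have := (h K (M.mem_cellsOf.1 hK).1).1.continuous
    fun_prop)) fun _ hx => h.jumpVec_eq F hx

end Jump

/-! ### Integration over the domain -/

theorem restrict_eq_restrict_openCell (M : Triangulation d Ω) (hΩ : interior (closure Ω) = Ω) :
    (volume : Measure (Space d)).restrict Ω = volume.restrict (⋃ K ∈ M.cells, openCell K) := by
  have hsub : ⋃ K ∈ M.cells, openCell K ⊆ Ω := iUnion₂_subset fun K hK => M.openCell_subset hΩ hK
  refine Measure.restrict_congr_set (Filter.EventuallyLE.antisymm (ae_le_set.2 ?_)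
    (Filter.Eventually.of_forall hsub))
  refine measure_mono_null (t := ⋃ K ∈ M.cells, hull K \ openCell K) ?_ ?_
  · rintro x ⟨hx, hx'⟩
    have h1 : x ∈ closure Ω := subset_closure hx
    rw [← M.covers] at h1
    simp only [mem_iUnion, exists_prop] at h1
    obtain ⟨K, hK, hxK⟩ := h1
    change x ∈ hull K at hxK
    have hno : x ∉ openCell K := fun h => hx' (by
      simp only [mem_iUnion]
      exact ⟨K, hK, h⟩)
    simp only [mem_iUnion]
    exact ⟨K, hK, hxK, hno⟩
  · refine (measure_biUnion_null_iff M.cells.countable_toSet).2 fun K _ => ?_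
    exact ae_le_set.1 (openCell_ae_eq_hull K).symm.le

theorem ae_mem_openCell (M : Triangulation d Ω) (hΩ : interior (closure Ω) = Ω) :
    ∀ᵐ x ∂(volume : Measure (Space d)).restrict Ω, ∃ K ∈ M.cells, x ∈ openCell K := by
  rw [M.restrict_eq_restrict_openCell hΩ, ae_restrict_iff'
    (M.cells.measurableSet_biUnion fun K _ => (isOpen_openCell K).measurableSet)]
  refine Filter.Eventually.of_forall fun x hx => ?_
  simpa only [mem_iUnion, exists_prop] using hx

/-- Only continuity of the representatives is asked for, so that integrands containing `deriv W`,
which need not be smooth, are covered as well. -/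
theorem integrableOn_and_setIntegral_eq_sum (M : Triangulation d Ω)
    (hΩ : interior (closure Ω) = Ω) {φ : Space d → ℝ}
    {g : Finset (Space d) → Space d → ℝ}
    (h : ∀ K ∈ M.cells, Continuous (g K) ∧ EqOn φ (g K) (openCell K)) :
    IntegrableOn φ Ω ∧ ∫ x in Ω, φ x = ∑ K ∈ M.cells, ∫ x in hull K, g K x := by
  have hi : ∀ K ∈ M.cells, IntegrableOn φ (openCell K) := fun K hK =>
    (((h K hK).1.continuousOn.integrableOn_compact (isCompact_hull K)).mono_set
      (openCell_subset_hull K)).congr_fun (h K hK).2.symm (isOpen_openCell K).measurableSet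
  constructor
  · rw [IntegrableOn, M.restrict_eq_restrict_openCell hΩ]
    exact integrableOn_finset_iUnion.2 hi
  · rw [M.restrict_eq_restrict_openCell hΩ, integral_biUnion_finset _
      (fun K _ => (isOpen_openCell K).measurableSet) ?_ hi]
    · refine Finset.sum_congr rfl fun K hK => ?_
      rw [setIntegral_congr_fun (isOpen_openCell K).measurableSet (h K hK).2,
        setIntegral_congr_set (openCell_ae_eq_hull K)]
    · exact fun K hK J hJ hne => M.disjoint_openCell hK hJ hne

theorem IsRep.integrableOn {φ : Space d → ℝ} {g : Finset (Space d) → Space d → ℝ}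
    (h : M.IsRep φ g) (hΩ : interior (closure Ω) = Ω) : IntegrableOn φ Ω :=
  (M.integrableOn_and_setIntegral_eq_sum hΩ fun K hK => ⟨(h K hK).1.continuous, (h K hK).2⟩).1

theorem IsRep.setIntegral_eq {φ : Space d → ℝ} {g : Finset (Space d) → Space d → ℝ}
    (h : M.IsRep φ g) (hΩ : interior (closure Ω) = Ω) :
    ∫ x in Ω, φ x = ∑ K ∈ M.cells, ∫ x in hull K, g K x :=
  (M.integrableOn_and_setIntegral_eq_sum hΩ fun K hK => ⟨(h K hK).1.continuous, (h K hK).2⟩).2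

end Triangulation

/-! ### Integration by parts over the triangulation, and consistency -/

namespace Triangulation

variable {Ω : Set (Space (n + 1))} {M : Triangulation (n + 1) Ω}

theorem card_face {F : Finset (Space (n + 1))} (hF : F ∈ M.faces) : F.card = n + 1 :=
  M.card_of_mem_faces hF

/-- Elementwise integration by parts. -/
theorem integral_by_parts (hΩ : interior (closure Ω) = Ω) {φ : Space (n + 1) → ℝ}
    {g : Finset (Space (n + 1)) → Space (n + 1) → ℝ} {w : Space (n + 1) → Space (n + 1)}
    {u : Finset (Space (n + 1)) → Space (n + 1) → Space (n + 1)} (hφ : M.IsRep φ g)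
    (hw : M.IsRep w u)
    (hb : ∀ F ∈ M.boundaryFaces, ∀ K ∈ M.cellsOf F, ∀ x ∈ hull F, ⟪trace K w x, normal K F⟫ = 0) :
    ∫ x in Ω, (⟪gradient φ x, w x⟫ + φ x * div w x) =
      M.intE fun F x => ⟪M.jump F φ x, M.avg F w x⟫ + M.jumpVec F w x * M.avg F φ x := by
  classical
  have hrep := (hφ.gradient.inner hw).add (hφ.mul hw.div)
  rw [hrep.setIntegral_eq hΩ]
  have h1 : ∀ K ∈ M.cells, ∫ x in hull K, (⟪gradient (g K) x, u K x⟫ + g K x * div (u K) x) =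
      ∑ F ∈ K.powersetCard (n + 1), ∫ x in hull F, g K x * ⟪u K x, normal K F⟫ ∂μHE[n] := by
    intro K hK
    have hg := (hφ K hK).1
    have hu := (hw K hK).1
    rw [← integral_congr_ae (Filter.Eventually.of_forall fun x => div_smul_eq
      (hg.differentiable (by simp) x) (hu.differentiable (by simp) x))]
    have h2 := setIntegral_div_hull (v := fun y => g K y • u K y) (M.card_eq K hK) (M.indep K hK)
      ((hg.smul hu).of_le (by simp))
    rw [h2]
    simp only [inner_smul_left]
    rfl
  rw [Finset.sum_congr rfl h1, M.sum_cells_faces fun K F =>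
    ∫ x in hull F, g K x * ⟪u K x, normal K F⟫ ∂μHE[n], M.sum_faces]
  have hbd : ∑ F ∈ M.boundaryFaces, ∑ K ∈ M.cellsOf F,
      ∫ x in hull F, g K x * ⟪u K x, normal K F⟫ ∂μHE[n] = 0 := by
    refine Finset.sum_eq_zero fun F hF => Finset.sum_eq_zero fun K hK => ?_
    rw [setIntegral_congr_fun (isCompact_hull F).measurableSet (g := fun _ => (0 : ℝ)),
      integral_zero]
    intro x hx
    have hK' := M.mem_cellsOf.1 hK
    have := hb F hF K hK x hx
    rw [hw.trace_eq hK'.1 (hull_mono hK'.2 hx)] at this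
    simp only [this, mul_zero]
  rw [hbd, add_zero]
  refine Finset.sum_congr rfl fun F hF => ?_
  have hF' := M.interiorFaces_subset_faces hF
  have hgi : ∀ K ∈ M.cellsOf F, IntegrableOn (fun x => g K x * ⟪u K x, normal K F⟫) (hull F)
      μHE[n] := fun K hK => by
    have hK' := M.mem_cellsOf.1 hK
    exact integrableOn_hull (card_face hF')
      ((hφ K hK'.1).1.continuous.mul ((hw K hK'.1).1.continuous.inner continuous_const))
  rw [← integral_finsetSum _ hgi]
  refine setIntegral_congr_fun (isCompact_hull F).measurableSet fun x hx => ?_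
  simp only [hφ.jump_eq F hx, hφ.avg_eq F hx, hw.avg_eq F hx, hw.jumpVec_eq F hx]
  -- With `n_J = -n_K` the claim becomes the algebraic identity behind `[[φ w]] = [[φ]]·{w} +
  -- [[w]]{φ}`; the averages carry the factor `½` because the face has two elements.
  obtain ⟨K, J, hne, hKJ⟩ := M.exists_cellsOf_eq_pair (by omega) hF
  rw [hKJ, Finset.sum_pair hne, Finset.sum_pair hne, Finset.sum_pair hne, Finset.sum_pair hne,
    Finset.sum_pair hne, Finset.card_pair hne,
    M.normal_eq_neg (by omega) hF' (K := K) (J := J) (by rw [hKJ]; simp) (by rw [hKJ]; simp) hne]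
  simp only [inner_smul_left, inner_smul_right, inner_add_left, inner_add_right, smul_eq_mul,
    inner_neg_right, inner_neg_left, smul_neg, conj_trivial, real_inner_comm (normal K F)]
  push_cast
  ring

/-- The scheme with central fluxes is consistent. -/
theorem isConsistent_centralFluxes (M : Triangulation (n + 1) Ω) (hΩo : IsOpen Ω)
    (hΩ : interior (closure Ω) = Ω) (p : ℕ) (γ : ℝ) :
    IsConsistent M p (M.centralFluxes γ) := by
  classical
  intro ρ τ v q hρ hτ hv hq F hF
  have hF' := M.interiorFaces_subset_faces hF
  have hae := ae_mem_relint (card_face hF')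
  obtain ⟨K, J, hne, hKJ⟩ := M.exists_cellsOf_eq_pair (by omega) hF
  have hn := M.normal_eq_neg (by omega) hF' (K := K) (J := J) (by rw [hKJ]; simp)
    (by rw [hKJ]; simp) hne
  -- Relative interior points of an interior face lie in `Ω`, where `φ` is continuous, so the trace
  -- from either side is the value of `φ`. The remaining points of the face form a null set.
  have htr : ∀ {Y : Type} [NormedAddCommGroup Y] (φ : Space (n + 1) → Y), ContinuousOn φ Ω →
      ∀ x ∈ relint F, ∀ L ∈ M.cellsOf F, trace L φ x = φ x := by
    intro Y _ φ hφ x hx L hL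
    have hL' := M.mem_cellsOf.1 hL
    exact trace_eq (M.card_eq L hL'.1) (M.indep L hL'.1)
      (hφ.continuousAt (hΩo.mem_nhds (M.relint_subset hΩ (by omega) hF hx))) (fun _ _ => rfl)
      (hull_mono hL'.2 (relint_subset_hull F hx))
  have hjump : ∀ φ : Space (n + 1) → ℝ, ContinuousOn φ Ω → ∀ x ∈ relint F, M.jump F φ x = 0 := by
    intro φ hφ x hx
    rw [jump, Finset.sum_congr rfl fun L hL => by rw [htr φ hφ x hx L hL], hKJ,
      Finset.sum_pair hne, hn, smul_neg, add_neg_cancel]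
  have hjumpVec : ∀ w : Space (n + 1) → Space (n + 1), ContinuousOn w Ω → ∀ x ∈ relint F,
      M.jumpVec F w x = 0 := by
    intro w hw x hx
    rw [jumpVec, Finset.sum_congr rfl fun L hL => by rw [htr w hw x hx L hL], hKJ,
      Finset.sum_pair hne, hn, inner_neg_right, add_neg_cancel]
  refine ⟨fun Ψ _ => ?_, fun χ _ => ?_, fun Ξ _ => ?_, fun ζ _ => ?_⟩ <;>
    filter_upwards [hae] with x hx <;> simp only [centralFluxes]
  · rw [hjumpVec (fun y => ρ y • v y) (hρ.continuousOn.smul hv.continuousOn) x hx, zero_mul, neg_zero]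
  · rw [hjump _ hτ.continuousOn x hx, inner_zero_left, neg_zero]
  · rw [hjumpVec _ hq.continuousOn x hx, mul_zero, zero_mul, neg_zero]
  · rw [hjump _ hρ.continuousOn x hx, inner_zero_left]

end Triangulation

/-! ### Representatives of finite element functions -/

/-- A vector of polynomials as a vector field. -/
def polyVec (P : Fin d → MvPolynomial (Fin d) ℝ) (x : Space d) : Space d :=
  WithLp.toLp 2 fun i => polyFun (P i) x

theorem contDiff_polyVec (P : Fin d → MvPolynomial (Fin d) ℝ) {k : WithTop ℕ∞} :
    ContDiff ℝ k (polyVec P) :=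
  contDiff_euclidean.2 fun i => contDiff_polyFun (P i)

namespace Triangulation

variable {Ω : Set (Space d)} {M : Triangulation d Ω} {p : ℕ}

theorem exists_isRep_of_mem_fes {φ : Space d → ℝ} (h : φ ∈ M.fes p) :
    ∃ P : Finset (Space d) → MvPolynomial (Fin d) ℝ, (∀ K ∈ M.cells, (P K).totalDegree ≤ p) ∧
      M.IsRep φ fun K => polyFun (P K) := by
  classical
  choose! P hP using h
  exact ⟨P, fun K hK => (hP K hK).1, fun K hK => ⟨contDiff_polyFun _, fun x hx => (hP K hK).2 x hx⟩⟩

theorem exists_isRep_of_forall_mem_fes {v : Space d → Space d}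
    (h : ∀ i, (fun x => v x i) ∈ M.fes p) :
    ∃ P : Finset (Space d) → Fin d → MvPolynomial (Fin d) ℝ,
      (∀ K ∈ M.cells, ∀ i, (P K i).totalDegree ≤ p) ∧ M.IsRep v fun K => polyVec (P K) := by
  choose P hP hP' using fun i => exists_isRep_of_mem_fes (h i)
  refine ⟨fun K i => P i K, fun K hK i => hP i K hK, fun K hK => ⟨contDiff_polyVec _, ?_⟩⟩
  intro x hx
  ext i
  exact (hP' i K hK).2 hx

theorem IsRep.mem_fesNormal {v : Space d → Space d} {g : Finset (Space d) → Space d → Space d}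
    (hv : M.IsRep v g) (h : ∀ i, (fun x => v x i) ∈ M.fes p)
    (hb : ∀ F ∈ M.boundaryFaces, ∀ K ∈ M.cellsOf F, ∀ x ∈ hull F, ⟪g K x, normal K F⟫ = 0) :
    v ∈ M.fesNormal p := by
  refine ⟨h, fun F hF K hK x hx => ?_⟩
  have hK' := M.mem_cellsOf.1 hK
  rw [hv.trace_eq hK'.1 (hull_mono hK'.2 hx)]
  exact hb F hF K hK x hx

theorem trace_eq_zero_of_mem_fesZeroVec {v : Space d → Space d} (h : v ∈ M.fesZeroVec p)
    {F K : Finset (Space d)} (hF : F ∈ M.boundaryFaces) (hK : K ∈ M.cellsOf F) {x : Space d}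
    (hx : x ∈ hull F) : trace K v x = 0 := by
  obtain ⟨P, -, hP⟩ := exists_isRep_of_forall_mem_fes (M := M) fun i => (h i).1
  have hK' := M.mem_cellsOf.1 hK
  have hxK := hull_mono hK'.2 hx
  rw [hP.trace_eq hK'.1 hxK]
  ext i
  have h1 := (h i).2 F hF K hK x hx
  rw [trace_eq (M.card_eq K hK'.1) (M.indep K hK'.1)
    (continuous_polyFun (P K i)).continuousAt (fun y hy => by rw [(hP K hK'.1).2 hy]; rfl) hxK] at h1
  exact h1

theorem const_mem_fes (c : ℝ) : (fun _ => c) ∈ M.fes p := fun K _ =>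
  ⟨MvPolynomial.C c, by simp, fun x _ => by simp⟩

theorem sum_mem_fes {m : ℕ} {c : Fin m → ℝ} {φ : Fin m → Space d → ℝ} (h : ∀ i, φ i ∈ M.fes p) :
    (fun x => ∑ i, c i * φ i x) ∈ M.fes p := by
  intro K hK
  choose P hP hP' using fun i => h i K hK
  refine ⟨∑ i, c i • P i, MvPolynomial.totalDegree_finsetSum_le fun i _ =>
    (MvPolynomial.totalDegree_smul_le _ _).trans (hP i), fun x hx => ?_⟩
  simp only [hP' _ x hx, map_sum, MvPolynomial.smul_eval]

end Triangulation

/-! ### Differentiation in time -/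

/-- A curve in a finite dimensional function space which is differentiable pointwise has
differentiable coordinates with respect to a basis consisting of points on the curve. -/
theorem exists_curve_expansion {X : Type*} (V : Submodule ℝ (X → ℝ)) [FiniteDimensional ℝ V]
    (S : Set ℝ) (u : ℝ → X → ℝ) (hu : ∀ t ∈ S, u t ∈ V) :
    ∃ (m : ℕ) (s : Fin m → ℝ) (a : ℝ → Fin m → ℝ), (∀ i, s i ∈ S) ∧
      (∀ t ∈ S, ∀ x, u t x = ∑ i, a t i * u (s i) x) ∧
      ∀ t ∈ S, (∀ x, DifferentiableWithinAt ℝ (fun r => u r x) S t) →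
        DifferentiableWithinAt ℝ a S t := by
  classical
  have hle : Submodule.span ℝ (u '' S) ≤ V := by
    rw [Submodule.span_le]
    rintro _ ⟨t, ht, rfl⟩
    exact hu t ht
  have : FiniteDimensional ℝ (Submodule.span ℝ (u '' S)) := Submodule.finiteDimensional_of_le hle
  -- A basis of the span is selected among the members of the curve itself.
  obtain ⟨f, hf, hspan, hli⟩ := Submodule.exists_fun_fin_finrank_span_eq ℝ (u '' S)
  choose s hsS hs using hf
  generalize Module.finrank ℝ (Submodule.span ℝ (u '' S)) = m at f hspan hli s hsS hs
  let b := Module.Basis.span hli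
  have hb : ∀ i, (b i : X → ℝ) = u (s i) := fun i => by
    rw [hs, Module.Basis.span_apply]
  have hmem : ∀ t ∈ S, u t ∈ Submodule.span ℝ (range f) := fun t ht => by
    rw [hspan]
    exact Submodule.subset_span ⟨t, ht, rfl⟩
  have : FiniteDimensional ℝ (Submodule.span ℝ (range f)) :=
    FiniteDimensional.span_of_finite ℝ (finite_range f)
  have hcoord : ∀ i, ∃ c : X →₀ ℝ, ∀ w : Submodule.span ℝ (range f),
      b.coord i w = c.sum fun x r => r * (w : X → ℝ) x := by
    intro i
    let ev : X → Submodule.span ℝ (range f) →ₗ[ℝ] ℝ := fun x =>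
      (LinearMap.proj x).comp (Submodule.subtype _)
    -- A function at which all evaluations vanish is zero, so in finite dimension the evaluations
    -- span the dual space. Each coordinate is thus a finite combination of point values and
    -- inherits their differentiability.
    have h1 : b.coord i ∈ Submodule.span ℝ (range ev) := by
      apply FiniteDimensional.mem_span_of_iInf_ker_le_ker
      intro w hw
      have : w = 0 := by
        apply Subtype.ext
        funext x
        exact (Submodule.mem_iInf _).1 hw x
      rw [this]
      exact Submodule.zero_mem _
    obtain ⟨c, hc⟩ := Finsupp.mem_span_range_iff_exists_finsupp.1 h1
    refine ⟨c, fun w => ?_⟩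
    rw [← hc]
    simp [Finsupp.sum, ev]
  choose c hc using hcoord
  refine ⟨m, s, fun t i => (c i).sum fun x r => r * u t x, hsS, fun t ht x => ?_, fun t ht hd => ?_⟩
  · have h1 := congrArg Subtype.val (b.sum_repr ⟨u t, hmem t ht⟩)
    rw [AddSubmonoidClass.coe_finsetSum] at h1
    have h2 := congrFun h1 x
    rw [Finset.sum_apply] at h2
    refine h2.symm.trans (Finset.sum_congr rfl fun i _ => ?_)
    rw [← hb i]
    exact congrArg (· * (b i : X → ℝ) x) (hc i ⟨u t, hmem t ht⟩)
  · rw [differentiableWithinAt_pi]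
    intro i
    unfold Finsupp.sum
    exact DifferentiableWithinAt.fun_sum fun x _ => (hd x).const_mul _

namespace Triangulation

variable {Ω : Set (Space d)} (M : Triangulation d Ω) (p : ℕ)

/-- The points in the open elements. -/
abbrev CellPoint : Type := {x : Space d // ∃ K ∈ M.cells, x ∈ openCell K}

open Classical in
/-- The map which restricts piecewise polynomials to the open elements. -/
def restrictPoly : (M.cells → MvPolynomial.restrictTotalDegree (Fin d) ℝ p) →ₗ[ℝ]
    (M.CellPoint → ℝ) where
  toFun P x := ∑ K : M.cells, if (x : Space d) ∈ openCell K then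
    MvPolynomial.eval (fun i => (x : Space d) i) (P K : MvPolynomial (Fin d) ℝ) else 0
  map_add' P Q := by
    funext x
    simp only [Pi.add_apply, Submodule.coe_add, map_add, ← Finset.sum_add_distrib]
    refine Finset.sum_congr rfl fun K _ => ?_
    split_ifs <;> simp
  map_smul' c P := by
    funext x
    simp only [Pi.smul_apply, Submodule.coe_smul, MvPolynomial.smul_eval, RingHom.id_apply,
      smul_eq_mul, Finset.mul_sum]
    refine Finset.sum_congr rfl fun K _ => ?_
    split_ifs <;> simp

variable {M p}

/-- Membership in `fes` leaves the values off the open elements arbitrary; finite dimensionality is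
obtained after restriction to `CellPoint`. -/
theorem mem_range_restrictPoly {φ : Space d → ℝ} (hφ : φ ∈ M.fes p) :
    (fun x : M.CellPoint => φ x) ∈ LinearMap.range (M.restrictPoly p) := by
  classical
  choose! P hP using hφ
  refine ⟨fun K => ⟨P K, (MvPolynomial.mem_restrictTotalDegree _ _ _).2 (hP K K.2).1⟩, ?_⟩
  funext x
  obtain ⟨K, hK, hx⟩ := x.2
  change ∑ J : M.cells, _ = φ x
  rw [Finset.sum_eq_single ⟨K, hK⟩, if_pos hx, (hP K hK).2 x hx]
  · intro J _ hJ
    rw [if_neg]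
    intro hxJ
    exact (disjoint_left.1 (M.disjoint_openCell J.2 hK fun h => hJ (Subtype.ext h)) hxJ) hx
  · simp

/-- It matters that the expansion is in time slices of the curve: along a solution each `ρ (s i)` is
accompanied by its own `q (s i)`, so the same coefficients can be used for `q`. -/
theorem exists_time_expansion {S : Set ℝ} {ρ : ℝ → Space d → ℝ} (hρ : ∀ t ∈ S, ρ t ∈ M.fes p)
    (hd : ∀ t ∈ S, ∀ K ∈ M.cells, ∀ x ∈ openCell K,
      DifferentiableWithinAt ℝ (fun s => ρ s x) S t) :
    ∃ (m : ℕ) (s : Fin m → ℝ) (a : ℝ → Fin m → ℝ), (∀ i, s i ∈ S) ∧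
      (∀ t ∈ S, ∀ K ∈ M.cells, ∀ x ∈ openCell K, ρ t x = ∑ i, a t i * ρ (s i) x) ∧
      ∀ t ∈ S, DifferentiableWithinAt ℝ a S t := by
  obtain ⟨m, s, a, h1, h2, h3⟩ := exists_curve_expansion (LinearMap.range (M.restrictPoly p)) S
    (fun t (x : M.CellPoint) => ρ t x) fun t ht => mem_range_restrictPoly (hρ t ht)
  refine ⟨m, s, a, h1, fun t ht K hK x hx => h2 t ht ⟨x, K, hK, hx⟩, fun t ht => h3 t ht ?_⟩
  rintro ⟨x, K, hK, hx⟩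
  exact hd t ht K hK x hx

theorem exists_time_expansion_vec {S : Set ℝ} {v : ℝ → Space d → Space d}
    (hv : ∀ t ∈ S, ∀ i, (fun x => v t x i) ∈ M.fes p)
    (hd : ∀ t ∈ S, ∀ K ∈ M.cells, ∀ x ∈ openCell K,
      DifferentiableWithinAt ℝ (fun s => v s x) S t) :
    ∃ (m : ℕ) (s : Fin m → ℝ) (a : ℝ → Fin m → ℝ), (∀ i, s i ∈ S) ∧
      (∀ t ∈ S, ∀ K ∈ M.cells, ∀ x ∈ openCell K, v t x = ∑ i, a t i • v (s i) x) ∧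
      ∀ t ∈ S, DifferentiableWithinAt ℝ a S t := by
  let L : (Fin d → LinearMap.range (M.restrictPoly p)) →ₗ[ℝ] (M.CellPoint × Fin d → ℝ) :=
    { toFun := fun f x => (f x.2 : M.CellPoint → ℝ) x.1
      map_add' := fun f g => rfl
      map_smul' := fun c f => rfl }
  obtain ⟨m, s, a, h1, h2, h3⟩ := exists_curve_expansion (LinearMap.range L) S
    (fun t x => v t x.1 x.2)
    fun t ht => ⟨fun i => ⟨_, mem_range_restrictPoly (hv t ht i)⟩, rfl⟩
  refine ⟨m, s, a, h1, fun t ht K hK x hx => ?_, fun t ht => h3 t ht ?_⟩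
  · ext i
    have := h2 t ht (⟨x, K, hK, hx⟩, i)
    simpa using this
  · rintro ⟨⟨x, K, hK, hx⟩, i⟩
    exact (differentiableWithinAt_euclidean.1 (hd t ht K hK x hx)) i

end Triangulation

/-- Differentiation under the integral, followed by the chain rule; a bound for the derivative on
the compact set `closedBall (c t) 1 × K` is the dominating constant. -/
theorem hasDerivWithinAt_setIntegral_comp {E : Type*} [NormedAddCommGroup E] [NormedSpace ℝ E]
    [FiniteDimensional ℝ E] {G : E × Space d → ℝ} (hG : ContDiff ℝ 1 G) {c : ℝ → E} {c' : E}
    {S : Set ℝ} {t : ℝ} (hc : HasDerivWithinAt c c' S t) {K : Set (Space d)} (hK : IsCompact K) :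
    HasDerivWithinAt (fun s => ∫ x in K, G (c s, x)) (∫ x in K, fderiv ℝ G (c t, x) (c', 0)) S t := by
  have hG' : Continuous fun z : E × Space d => (fderiv ℝ G z).comp (ContinuousLinearMap.inl ℝ E (Space d)) :=
    (hG.continuous_fderiv one_ne_zero).clm_comp continuous_const
  have hcx : ∀ e : E, Continuous fun x : Space d => (e, x) := fun e => by fun_prop
  obtain ⟨C, hC⟩ := ((isCompact_closedBall (c t) 1).prod hK).exists_bound_of_continuousOn
    hG'.continuousOn
  have hint : IntegrableOn (fun x => (fderiv ℝ G (c t, x)).comp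
      (ContinuousLinearMap.inl ℝ E (Space d))) K :=
    ((hG'.comp (hcx (c t))).continuousOn).integrableOn_compact hK
  have h := hasFDerivAt_integral_of_dominated_of_fderiv_le (μ := volume.restrict K)
    (F := fun e x => G (e, x))
    (F' := fun e x => (fderiv ℝ G (e, x)).comp (ContinuousLinearMap.inl ℝ E (Space d)))
    (x₀ := c t) (bound := fun _ => C) (Metric.closedBall_mem_nhds (c t) one_pos)
    (Filter.Eventually.of_forall fun e => (hG.continuous.comp (hcx e)).aestronglyMeasurable)
    (((hG.continuous.comp (hcx (c t))).continuousOn).integrableOn_compact hK)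
    hint.aestronglyMeasurable
    ((ae_restrict_mem hK.measurableSet).mono fun x hx e he => hC (e, x) ⟨he, hx⟩)
    (by
      have : IsFiniteMeasure (volume.restrict K) := ⟨by
        rw [Measure.restrict_apply_univ]; exact hK.measure_lt_top⟩
      exact integrable_const C)
    (Filter.Eventually.of_forall fun x e _ => by
      have h1 : HasFDerivAt (fun e : E => (e, x)) (ContinuousLinearMap.inl ℝ E (Space d)) e :=
        hasFDerivAt_prodMk_left e x
      exact (hG.differentiable one_ne_zero (e, x)).hasFDerivAt.comp e h1)
  have h2 := h.comp_hasDerivWithinAt t hc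
  rw [ContinuousLinearMap.integral_apply hint] at h2
  exact h2

theorem gradient_sum_mul {m : ℕ} {c : Fin m → ℝ} {r : Fin m → Space d → ℝ} {x : Space d}
    (h : ∀ i, DifferentiableAt ℝ (r i) x) :
    gradient (fun y => ∑ i, c i * r i y) x = ∑ i, c i • gradient (r i) x := by
  unfold gradient
  rw [fderiv_fun_sum fun i _ => (h i).const_mul (c i), map_sum]
  refine Finset.sum_congr rfl fun i _ => ?_
  rw [fderiv_const_mul (h i)]
  simp

/-- The convective term tested with the velocity. -/
theorem inner_divMat_self {ρ : Space d → ℝ} {v : Space d → Space d} {x : Space d}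
    (hρ : DifferentiableAt ℝ ρ x) (hv : DifferentiableAt ℝ v x) :
    ⟪divMat (fun y => ρ y • Matrix.vecMulVec (v y).ofLp (v y).ofLp) x, v x⟫ =
      div (fun y => ρ y • v y) x * ‖v x‖ ^ 2 +
        1 / 2 * ρ x * ⟪gradient (fun y => ‖v y‖ ^ 2) x, v x⟫ := by
  have hvi : ∀ i, HasFDerivAt (fun y => v y i)
      ((PiLp.proj 2 (𝕜 := ℝ) (fun _ : Fin d => ℝ) i).comp (fderiv ℝ v x)) x := fun i =>
    ((PiLp.proj 2 (𝕜 := ℝ) (fun _ : Fin d => ℝ) i).hasFDerivAt).comp x hv.hasFDerivAt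
  have hrow : ∀ i, (divMat (fun y => ρ y • Matrix.vecMulVec (v y).ofLp (v y).ofLp) x) i =
      ρ x * (fderiv ℝ v x (v x)) i + v x i * div (fun y => ρ y • v y) x := by
    intro i
    -- Row `i` of `ρ v ⊗ v` is the scalar `v_i` times the field `ρ v`, to which the product rule
    -- applies.
    have h1 : (fun y => WithLp.toLp 2 ((ρ y • Matrix.vecMulVec (v y).ofLp (v y).ofLp) i) :
        Space d → Space d) = fun y => v y i • (ρ y • v y) := by
      funext y
      ext j
      simp [Matrix.vecMulVec_apply]
      ring
    change div (fun y => WithLp.toLp 2 ((ρ y • Matrix.vecMulVec (v y).ofLp (v y).ofLp) i)) x = _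
    rw [h1, div_smul_eq (w := fun y => ρ y • v y) (hvi i).differentiableAt (hρ.smul hv), inner_gradient_left, (hvi i).fderiv]
    simp
  have hsq : HasFDerivAt (fun y => ‖v y‖ ^ 2) _ x := hv.hasFDerivAt.norm_sq
  rw [inner_gradient_left, hsq.fderiv, ← real_inner_self_eq_norm_sq, PiLp.inner_apply,
    PiLp.inner_apply]
  simp only [hrow]
  have h2 : (2 • (innerSL ℝ (v x)).comp (fderiv ℝ v x)) (v x) =
      2 * ∑ i, v x i * (fderiv ℝ v x (v x)) i := by
    simp [PiLp.inner_apply, two_mul, mul_comm]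
  rw [h2]
  simp only [RCLike.inner_apply, conj_trivial, Finset.mul_sum, ← Finset.sum_add_distrib]
  refine Finset.sum_congr rfl fun i _ => ?_
  ring

/-! ### The equation for the discrete gradient -/

namespace Triangulation

section

variable {Ω : Set (Space d)} {M : Triangulation d Ω} {E : Type*} [NormedAddCommGroup E]
  [NormedSpace ℝ E]

theorem IsRep.congr {φ ψ : Space d → E} {g : Finset (Space d) → Space d → E} (h : M.IsRep φ g)
    (hψ : ∀ K ∈ M.cells, EqOn ψ φ (openCell K)) : M.IsRep ψ g := fun K hK =>
  ⟨(h K hK).1, (hψ K hK).trans (h K hK).2⟩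

theorem IsRep.sum {m : ℕ} {c : Fin m → ℝ} {φ : Fin m → Space d → E}
    {g : Fin m → Finset (Space d) → Space d → E} (h : ∀ i, M.IsRep (φ i) (g i)) :
    M.IsRep (fun x => ∑ i, c i • φ i x) fun K x => ∑ i, c i • g i K x := fun K hK =>
  ⟨ContDiff.sum fun i _ => (h i K hK).1.const_smul (c i), fun x hx => by
    simp only [fun i => (h i K hK).2 hx]⟩

theorem IsRep.differentiableAt {φ : Space d → E} {g : Finset (Space d) → Space d → E}
    (h : M.IsRep φ g) {K : Finset (Space d)} (hK : K ∈ M.cells) {x : Space d}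
    (hx : x ∈ openCell K) : DifferentiableAt ℝ φ x :=
  ((h K hK).1.differentiable (by simp) x).congr_of_eventuallyEq (h.eventuallyEq hK hx)

variable {p : ℕ}

theorem sum_mem_fesNormal {m : ℕ} {c : Fin m → ℝ} {v : Fin m → Space d → Space d}
    (h : ∀ i, v i ∈ M.fesNormal p) : (fun x => ∑ i, c i • v i x) ∈ M.fesNormal p := by
  choose P hPd hP using fun i => exists_isRep_of_forall_mem_fes (h i).1
  refine (IsRep.sum hP).mem_fesNormal (fun j => ?_) fun F hF K hK x hx => ?_
  · have := sum_mem_fes (c := c) fun i => (h i).1 j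
    simpa using this
  · rw [sum_inner]
    refine Finset.sum_eq_zero fun i _ => ?_
    have h1 := (h i).2 F hF K hK x hx
    have hK' := M.mem_cellsOf.1 hK
    rw [(hP i).trace_eq hK'.1 (hull_mono hK'.2 hx)] at h1
    rw [inner_smul_left, h1, mul_zero]

theorem IsRep.jump_sum {m : ℕ} {c : Fin m → ℝ} {r : Fin m → Space d → ℝ}
    {g : Fin m → Finset (Space d) → Space d → ℝ} (h : ∀ i, M.IsRep (r i) (g i))
    (F : Finset (Space d)) {x : Space d} (hx : x ∈ hull F) :
    M.jump F (fun y => ∑ i, c i * r i y) x = ∑ i, c i • M.jump F (r i) x := by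
  have hs : M.IsRep (fun x => ∑ i, c i * r i x) _ := IsRep.sum h
  rw [hs.jump_eq F hx]
  simp only [fun i => (h i).jump_eq F hx, Finset.smul_sum, Finset.sum_smul, smul_eq_mul, mul_smul]
  exact Finset.sum_comm

theorem exists_isRep_fesNormal {v : Space d → Space d} (h : v ∈ M.fesNormal p) :
    ∃ g, M.IsRep v g := by
  obtain ⟨P, -, hP⟩ := exists_isRep_of_forall_mem_fes h.1
  exact ⟨_, hP⟩

theorem exists_isRep_fesZeroVec {v : Space d → Space d} (h : v ∈ M.fesZeroVec p) :
    ∃ g, M.IsRep v g := by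
  obtain ⟨P, -, hP⟩ := exists_isRep_of_forall_mem_fes fun i => (h i).1
  exact ⟨_, hP⟩

theorem exists_isRep_fes {φ : Space d → ℝ} (h : φ ∈ M.fes p) : ∃ g, M.IsRep φ g := by
  obtain ⟨P, -, hP⟩ := exists_isRep_of_mem_fes h
  exact ⟨_, hP⟩

theorem setIntegral_congr_cells (hΩo : IsOpen Ω) (hΩ : interior (closure Ω) = Ω)
    {f g : Space d → ℝ} (h : ∀ K ∈ M.cells, ∀ x ∈ openCell K, f x = g x) :
    ∫ x in Ω, f x = ∫ x in Ω, g x := by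
  refine setIntegral_congr_ae hΩo.measurableSet ?_
  rw [← ae_restrict_iff' hΩo.measurableSet]
  filter_upwards [M.ae_mem_openCell hΩ] with x hx
  obtain ⟨K, hK, hxK⟩ := hx
  exact h K hK x hxK

end

variable {Ω : Set (Space (n + 1))} {M : Triangulation (n + 1) Ω} {p : ℕ}

theorem integrableOn_interiorFace {F : Finset (Space (n + 1))} (hF : F ∈ M.interiorFaces)
    {f : Space (n + 1) → ℝ} (hf : ContinuousOn f (hull F)) :
    IntegrableOn f (hull F) μHE[n + 1 - 1] :=
  integrableOn_hull_of_continuousOn (card_face (M.interiorFaces_subset_faces hF)) hf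

theorem intE_add {f g : Finset (Space (n + 1)) → Space (n + 1) → ℝ}
    (hf : ∀ F, ContinuousOn (f F) (hull F)) (hg : ∀ F, ContinuousOn (g F) (hull F)) :
    (M.intE fun F x => f F x + g F x) = M.intE f + M.intE g := by
  rw [intE, intE, intE, ← Finset.sum_add_distrib]
  refine Finset.sum_congr rfl fun F hF => ?_
  exact integral_add (integrableOn_interiorFace hF (hf F)) (integrableOn_interiorFace hF (hg F))

theorem intE_neg (f : Finset (Space (n + 1)) → Space (n + 1) → ℝ) :
    (M.intE fun F x => -f F x) = -M.intE f := by
  simp only [intE, integral_neg, Finset.sum_neg_distrib]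

theorem intE_const_mul (c : ℝ) (f : Finset (Space (n + 1)) → Space (n + 1) → ℝ) :
    (M.intE fun F x => c * f F x) = c * M.intE f := by
  simp only [intE, integral_const_mul, Finset.mul_sum]

variable (M) in
/-- The form which determines the discrete gradient. -/
def gradForm (r : Space (n + 1) → ℝ) (k ζ : Space (n + 1) → Space (n + 1)) : ℝ :=
  (∫ x in Ω, ⟪k x - gradient r x, ζ x⟫) + M.intE fun F x => ⟪M.jump F r x, M.avg F ζ x⟫

theorem gradForm_sum (hΩo : IsOpen Ω) (hΩ : interior (closure Ω) = Ω) {m : ℕ} {c : Fin m → ℝ}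
    {r : Fin m → Space (n + 1) → ℝ} {k : Fin m → Space (n + 1) → Space (n + 1)}
    {ζ : Space (n + 1) → Space (n + 1)} (hr : ∀ i, r i ∈ M.fes p) (hk : ∀ i, k i ∈ M.fesNormal p)
    (hζ : ζ ∈ M.fesNormal p) :
    M.gradForm (fun x => ∑ i, c i * r i x) (fun x => ∑ i, c i • k i x) ζ =
      ∑ i, c i * M.gradForm (r i) (k i) ζ := by
  choose g hg using fun i => exists_isRep_fes (hr i)
  choose u hu using fun i => exists_isRep_fesNormal (hk i)
  obtain ⟨z, hz⟩ := exists_isRep_fesNormal hζ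
  have h1 : ∫ x in Ω, ⟪(∑ i, c i • k i x) - gradient (fun y => ∑ i, c i * r i y) x, ζ x⟫ =
      ∑ i, c i * ∫ x in Ω, ⟪k i x - gradient (r i) x, ζ x⟫ := by
    simp only [← integral_const_mul]
    rw [← integral_finsetSum _ fun i _ =>
      ((((hu i).sub (hg i).gradient).inner hz).integrableOn hΩ).const_mul (c i)]
    refine setIntegral_congr_cells (M := M) hΩo hΩ fun K hK x hx => ?_
    rw [gradient_sum_mul fun i => (hg i).differentiableAt hK hx, ← Finset.sum_sub_distrib, sum_inner]
    refine Finset.sum_congr rfl fun i _ => ?_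
    rw [← smul_sub, inner_smul_left, conj_trivial]
  have h2 : (M.intE fun F x => ⟪M.jump F (fun y => ∑ i, c i * r i y) x, M.avg F ζ x⟫) =
      ∑ i, c i * M.intE fun F x => ⟪M.jump F (r i) x, M.avg F ζ x⟫ := by
    simp only [intE, Finset.mul_sum]
    rw [Finset.sum_comm]
    refine Finset.sum_congr rfl fun F hF => ?_
    simp only [← integral_const_mul]
    rw [← integral_finsetSum _ fun i _ => (integrableOn_interiorFace hF
      (((hg i).continuousOn_jump F).inner (hz.continuousOn_avg F))).const_mul (c i)]
    refine setIntegral_congr_fun (isCompact_hull F).measurableSet fun x hx => ?_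
    rw [IsRep.jump_sum hg F hx, sum_inner]
    refine Finset.sum_congr rfl fun i _ => ?_
    rw [inner_smul_left, conj_trivial]
  simp only [gradForm, mul_add, Finset.sum_add_distrib, h1, h2]

/-- Uniqueness of the discrete gradient: for vanishing `r` the form tested with `k` reduces to the
integral of `|k|²`. -/
theorem eq_zero_of_gradForm (hΩo : IsOpen Ω) (hΩ : interior (closure Ω) = Ω)
    {r : Space (n + 1) → ℝ} {k : Space (n + 1) → Space (n + 1)} (hk : k ∈ M.fesNormal p)
    (hr : ∀ K ∈ M.cells, ∀ x ∈ openCell K, r x = 0) (h : M.gradForm r k k = 0) :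
    ∀ K ∈ M.cells, ∀ x ∈ openCell K, k x = 0 := by
  obtain ⟨u, hu⟩ := exists_isRep_fesNormal hk
  have hr0 : M.IsRep r fun _ _ => (0 : ℝ) := (isRep_const (0 : ℝ)).congr hr
  have h1 : (M.intE fun F x => ⟪M.jump F r x, M.avg F k x⟫) = 0 := by
    refine Finset.sum_eq_zero fun F _ => ?_
    rw [setIntegral_congr_fun (isCompact_hull F).measurableSet (g := fun _ => (0 : ℝ)),
      integral_zero]
    intro x hx
    simp [hr0.jump_eq F hx]
  have h2 : ∫ x in Ω, ⟪k x - gradient r x, k x⟫ = ∫ x in Ω, ⟪k x, k x⟫ := by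
    refine setIntegral_congr_cells (M := M) hΩo hΩ fun K hK x hx => ?_
    rw [gradient_congr (hr0.eventuallyEq hK hx)]
    simp [gradient]
  rw [gradForm, h1, h2, add_zero, integral_eq_zero_iff_of_nonneg
    (fun x => real_inner_self_nonneg) ((hu.inner hu).integrableOn hΩ)] at h
  intro K hK
  have h3 : k =ᵐ[volume.restrict (openCell K)] fun _ => 0 := by
    filter_upwards [ae_restrict_of_ae_restrict_of_subset (M.openCell_subset hΩ hK) h] with x hx
    exact inner_self_eq_zero.1 hx
  exact Measure.eqOn_open_of_ae_eq h3 (isOpen_openCell K)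
    ((hu K hK).1.continuous.continuousOn.congr (hu K hK).2) continuousOn_const

/-- Linearity and uniqueness transfer the coefficients of `ρ` to `q`. This is the source of the time
differentiability of `q`. -/
theorem expansion_of_gradForm (hΩo : IsOpen Ω) (hΩ : interior (closure Ω) = Ω)
    {m : ℕ} {a : Fin m → ℝ} {r : Fin m → Space (n + 1) → ℝ}
    {k : Fin m → Space (n + 1) → Space (n + 1)} {ρ : Space (n + 1) → ℝ}
    {q : Space (n + 1) → Space (n + 1)} (hr : ∀ i, r i ∈ M.fes p) (hk : ∀ i, k i ∈ M.fesNormal p)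
    (hρ : ρ ∈ M.fes p) (hq : q ∈ M.fesNormal p)
    (h : ∀ i, ∀ ζ ∈ M.fesNormal p, M.gradForm (r i) (k i) ζ = 0)
    (h0 : ∀ ζ ∈ M.fesNormal p, M.gradForm ρ q ζ = 0)
    (hexp : ∀ K ∈ M.cells, ∀ x ∈ openCell K, ρ x = ∑ i, a i * r i x) :
    ∀ K ∈ M.cells, ∀ x ∈ openCell K, q x = ∑ i, a i • k i x := by
  -- The difference `q - ∑ aᵢ kᵢ` is treated as one linear combination with coefficients `(1, -a)`;
  -- it is then used as its own test function.
  have hk' : ∀ i, (Fin.cons q k : Fin (m + 1) → Space (n + 1) → Space (n + 1)) i ∈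
      M.fesNormal p := Fin.cases hq hk
  have hr' : ∀ i, (Fin.cons ρ r : Fin (m + 1) → Space (n + 1) → ℝ) i ∈ M.fes p := Fin.cases hρ hr
  have hmem := sum_mem_fesNormal (c := (Fin.cons 1 (-a) : Fin (m + 1) → ℝ)) hk'
  have h1 := gradForm_sum hΩo hΩ (c := (Fin.cons 1 (-a) : Fin (m + 1) → ℝ)) hr' hk' hmem
  have h2 : ∀ i : Fin (m + 1), M.gradForm ((Fin.cons ρ r : Fin (m + 1) → Space (n + 1) → ℝ) i)
      ((Fin.cons q k : Fin (m + 1) → Space (n + 1) → Space (n + 1)) i)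
      (fun x => ∑ i, (Fin.cons 1 (-a) : Fin (m + 1) → ℝ) i •
        (Fin.cons q k : Fin (m + 1) → Space (n + 1) → Space (n + 1)) i x) = 0 :=
    Fin.cases (h0 _ hmem) fun i => h i _ hmem
  rw [Finset.sum_eq_zero fun i _ => by rw [h2 i, mul_zero]] at h1
  have h3 := eq_zero_of_gradForm hΩo hΩ hmem (fun K hK x hx => by
    simp [Fin.sum_univ_succ, hexp K hK x hx]) h1
  intro K hK x hx
  have h4 := h3 K hK x hx
  simp only [Fin.sum_univ_succ, Fin.cons_zero, Fin.cons_succ, one_smul, Pi.neg_apply, neg_smul,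
    Finset.sum_neg_distrib] at h4
  exact add_neg_eq_zero.1 h4

end Triangulation

/-! ### Balance of mass and energy -/

namespace Triangulation

section

variable {Ω : Set (Space d)} {M : Triangulation d Ω} {p : ℕ}

/-- Differentiation of an integral over `Ω` along a curve of coefficients. -/
theorem hasDerivWithinAt_setIntegral (hΩ : interior (closure Ω) = Ω) {E : Type*}
    [NormedAddCommGroup E] [NormedSpace ℝ E] [FiniteDimensional ℝ E]
    {G : Finset (Space d) → E × Space d → ℝ} (hG : ∀ K ∈ M.cells, ContDiff ℝ 1 (G K))
    {c : ℝ → E} {S : Set ℝ} {t : ℝ} (ht : t ∈ S) (hS : UniqueDiffWithinAt ℝ S t)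
    (hc : DifferentiableWithinAt ℝ c S t) {φ : ℝ → Space d → ℝ} {D : Space d → ℝ}
    (hφ : ∀ s ∈ S, ∀ K ∈ M.cells, ∀ x ∈ openCell K, φ s x = G K (c s, x))
    (hD : ∀ K ∈ M.cells, ∀ x ∈ openCell K, HasDerivWithinAt (fun s => φ s x) (D x) S t) :
    HasDerivWithinAt (fun s => ∫ x in Ω, φ s x) (∫ x in Ω, D x) S t := by
  have hGx : ∀ (K : Finset (Space d)) (e : E), K ∈ M.cells → Continuous fun x => G K (e, x) := by
    intro K e hK
    have := (hG K hK).continuous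
    fun_prop
  have h1 : ∀ s ∈ S, ∫ x in Ω, φ s x = ∑ K ∈ M.cells, ∫ x in hull K, G K (c s, x) := fun s hs =>
    (M.integrableOn_and_setIntegral_eq_sum hΩ fun K hK => ⟨hGx K (c s) hK, hφ s hs K hK⟩).2
  -- The given pointwise derivative and the chain rule through `G K` differentiate the same
  -- function, so they agree by uniqueness of derivatives within `S`.
  have h2 : ∀ K ∈ M.cells, ∀ x ∈ openCell K,
      D x = fderiv ℝ (G K) (c t, x) (derivWithin c S t, 0) := by
    intro K hK x hx
    have h3 : HasFDerivAt (G K) (fderiv ℝ (G K) (c t, x)) (c t, x) :=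
      ((hG K hK).differentiable one_ne_zero _).hasFDerivAt
    have h4 : HasDerivWithinAt (fun s => (c s, x)) (derivWithin c S t, (0 : Space d)) S t :=
      hc.hasDerivWithinAt.prodMk (hasDerivWithinAt_const t S x)
    have h5 := h3.comp_hasDerivWithinAt t h4
    exact hS.eq_deriv S ((hD K hK x hx)) (h5.congr (fun s hs => hφ s hs K hK x hx) (hφ t ht K hK x hx))
  have h6 : ∫ x in Ω, D x =
      ∑ K ∈ M.cells, ∫ x in hull K, fderiv ℝ (G K) (c t, x) (derivWithin c S t, 0) := by
    refine (M.integrableOn_and_setIntegral_eq_sum hΩ fun K hK => ⟨?_, h2 K hK⟩).2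
    have := (hG K hK).continuous_fderiv one_ne_zero
    fun_prop
  rw [h6]
  refine HasDerivWithinAt.congr ?_ h1 (h1 t ht)
  exact HasDerivWithinAt.fun_sum fun K hK =>
    hasDerivWithinAt_setIntegral_comp (hG K hK) hc.hasDerivWithinAt (isCompact_hull K)

/-- The time derivative of the mass of a curve in the finite element space. -/
theorem hasDerivWithinAt_mass (hΩ : interior (closure Ω) = Ω) {S : Set ℝ} {t : ℝ}
    (ht : t ∈ S) (hS : UniqueDiffWithinAt ℝ S t) {ρ : ℝ → Space d → ℝ} {m : ℕ}
    {a : ℝ → Fin m → ℝ} {r : Fin m → Space d → ℝ} {g : Fin m → Finset (Space d) → Space d → ℝ}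
    (hg : ∀ i, M.IsRep (r i) (g i)) (ha : DifferentiableWithinAt ℝ a S t)
    (hρ : ∀ s ∈ S, ∀ K ∈ M.cells, ∀ x ∈ openCell K, ρ s x = ∑ i, a s i * r i x) {R : Space d → ℝ}
    (hR : ∀ K ∈ M.cells, ∀ x ∈ openCell K, HasDerivWithinAt (fun s => ρ s x) (R x) S t) :
    HasDerivWithinAt (fun s => mass Ω (ρ s)) (∫ x in Ω, R x) S t := by
  refine hasDerivWithinAt_setIntegral hΩ (M := M)
    (c := a)
    (G := fun K (z : (Fin m → ℝ) × Space d) => ∑ i, z.1 i * g i K z.2) (fun K hK => ?_) ht hS ha (fun s hs K hK x hx => ?_) hR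
  · refine ContDiff.sum fun i _ => ?_
    have := ((hg i K hK).1.of_le (by simp) : ContDiff ℝ 1 (g i K))
    fun_prop
  · rw [hρ s hs K hK x hx]
    simp only [fun i => (hg i K hK).2 hx]

/-- The time derivative of the energy along curves in the finite element spaces. -/
theorem hasDerivWithinAt_energy (hΩ : interior (closure Ω) = Ω) {S : Set ℝ} {t : ℝ}
    (ht : t ∈ S) (hS : UniqueDiffWithinAt ℝ S t) {W : ℝ → ℝ} (hW : ContDiff ℝ 1 W) (γ : ℝ)
    {ρ : ℝ → Space d → ℝ} {v q : ℝ → Space d → Space d} {m l : ℕ}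
    {a : ℝ → Fin m → ℝ} {r : Fin m → Space d → ℝ} {k : Fin m → Space d → Space d}
    {b : ℝ → Fin l → ℝ} {w : Fin l → Space d → Space d}
    {g : Fin m → Finset (Space d) → Space d → ℝ} {u : Fin m → Finset (Space d) → Space d → Space d}
    {z : Fin l → Finset (Space d) → Space d → Space d}
    (hg : ∀ i, M.IsRep (r i) (g i)) (hu : ∀ i, M.IsRep (k i) (u i)) (hz : ∀ i, M.IsRep (w i) (z i))
    (ha : DifferentiableWithinAt ℝ a S t) (hb : DifferentiableWithinAt ℝ b S t)
    (hρ : ∀ s ∈ S, ∀ K ∈ M.cells, ∀ x ∈ openCell K, ρ s x = ∑ i, a s i * r i x)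
    (hq : ∀ s ∈ S, ∀ K ∈ M.cells, ∀ x ∈ openCell K, q s x = ∑ i, a s i • k i x)
    (hv : ∀ s ∈ S, ∀ K ∈ M.cells, ∀ x ∈ openCell K, v s x = ∑ i, b s i • w i x)
    {R : Space d → ℝ} {Q V : Space d → Space d}
    (hR : ∀ K ∈ M.cells, ∀ x ∈ openCell K, HasDerivWithinAt (fun s => ρ s x) (R x) S t)
    (hQ : ∀ K ∈ M.cells, ∀ x ∈ openCell K, HasDerivWithinAt (fun s => q s x) (Q x) S t)
    (hV : ∀ K ∈ M.cells, ∀ x ∈ openCell K, HasDerivWithinAt (fun s => v s x) (V x) S t) :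
    HasDerivWithinAt (fun s => energy Ω W γ (ρ s) (v s) (q s))
      (∫ x in Ω, (deriv W (ρ t x) * R x + (1 / 2 * R x * ‖v t x‖ ^ 2 + ρ t x * ⟪v t x, V x⟫) +
        γ * ⟪q t x, Q x⟫)) S t := by
  refine hasDerivWithinAt_setIntegral hΩ (M := M) (c := fun s => (a s, b s))
    (G := fun K y => W (∑ i, y.1.1 i * g i K y.2) +
      1 / 2 * (∑ i, y.1.1 i * g i K y.2) * ‖∑ i, y.1.2 i • z i K y.2‖ ^ 2 +
      γ / 2 * ‖∑ i, y.1.1 i • u i K y.2‖ ^ 2) (fun K hK => ?_) ht hS (ha.prodMk hb)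
      (fun s hs K hK x hx => ?_) fun K hK x hx => ?_
  · have h1 : ∀ i, ContDiff ℝ 1 (g i K) := fun i => (hg i K hK).1.of_le (by simp)
    have h2 : ∀ i, ContDiff ℝ 1 (u i K) := fun i => (hu i K hK).1.of_le (by simp)
    have h3 : ∀ i, ContDiff ℝ 1 (z i K) := fun i => (hz i K hK).1.of_le (by simp)
    have h4 : ContDiff ℝ 1 fun y : ((Fin m → ℝ) × (Fin l → ℝ)) × Space d =>
        ∑ i, y.1.1 i * g i K y.2 := ContDiff.sum fun i _ => by
      have := h1 i
      fun_prop
    have h5 : ContDiff ℝ 1 fun y : ((Fin m → ℝ) × (Fin l → ℝ)) × Space d =>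
        ∑ i, y.1.1 i • u i K y.2 := ContDiff.sum fun i _ => by
      have := h2 i
      fun_prop
    have h6 : ContDiff ℝ 1 fun y : ((Fin m → ℝ) × (Fin l → ℝ)) × Space d =>
        ∑ i, y.1.2 i • z i K y.2 := ContDiff.sum fun i _ => by
      have := h3 i
      fun_prop
    exact ((hW.comp h4).add ((contDiff_const.mul h4).mul (h6.norm_sq ℝ))).add
      (contDiff_const.mul (h5.norm_sq ℝ))
  · rw [hρ s hs K hK x hx, hq s hs K hK x hx, hv s hs K hK x hx]
    simp only [fun i => (hg i K hK).2 hx, fun i => (hu i K hK).2 hx, fun i => (hz i K hK).2 hx]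
  · have h1 := hR K hK x hx
    have h2 := hQ K hK x hx
    have h3 := hV K hK x hx
    have h4 : HasDerivAt W (deriv W (ρ t x)) (ρ t x) :=
      (hW.differentiable one_ne_zero _).hasDerivAt
    have h5 := h4.comp_hasDerivWithinAt t h1
    have h6 := (h5.add ((h1.const_mul (1 / 2)).mul h3.norm_sq)).add (h2.norm_sq.const_mul (γ / 2))
    refine h6.congr_deriv ?_
    ring

end

variable {Ω : Set (Space (n + 1))} {M : Triangulation (n + 1) Ω} {p : ℕ}

theorem trace_inner_normal_eq_zero {v : Space (n + 1) → Space (n + 1)} (h : v ∈ M.fesZeroVec p)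
    {ρ : Space (n + 1) → ℝ} (hρ : ρ ∈ M.fes p) {F K : Finset (Space (n + 1))}
    (hF : F ∈ M.boundaryFaces) (hK : K ∈ M.cellsOf F) {x : Space (n + 1)} (hx : x ∈ hull F) :
    ⟪trace K (fun y => ρ y • v y) x, normal K F⟫ = 0 := by
  obtain ⟨g, hg⟩ := exists_isRep_fes hρ
  obtain ⟨u, hu⟩ := exists_isRep_fesZeroVec h
  have hK' := M.mem_cellsOf.1 hK
  have hxK := hull_mono hK'.2 hx
  have h1 := trace_eq_zero_of_mem_fesZeroVec h hF hK hx
  rw [hu.trace_eq hK'.1 hxK] at h1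
  rw [(hg.smul hu).trace_eq hK'.1 hxK, h1, smul_zero, inner_zero_left]

/-- The mass balance tested with `1`. -/
theorem setIntegral_mass_rate (hΩ : interior (closure Ω) = Ω)
    {ρ R : Space (n + 1) → ℝ} {v : Space (n + 1) → Space (n + 1)} (hρ : ρ ∈ M.fes p)
    (hR : R ∈ M.fes p) (hv : v ∈ M.fesZeroVec p)
    (h : ∀ Ψ ∈ M.fes p, 0 = (∫ x in Ω, (R x + div (fun y => ρ y • v y) x) * Ψ x) +
      M.intE fun F x => -(M.jumpVec F (fun y => ρ y • v y) x * M.avg F Ψ x)) :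
    ∫ x in Ω, R x = 0 := by
  classical
  obtain ⟨g, hg⟩ := exists_isRep_fes hρ
  obtain ⟨gR, hgR⟩ := exists_isRep_fes hR
  obtain ⟨u, hu⟩ := exists_isRep_fesZeroVec hv
  have h1 := h _ (const_mem_fes 1)
  have h2 := integral_by_parts hΩ (isRep_const (1 : ℝ)) (hg.smul hu)
    fun F hF K hK x hx => trace_inner_normal_eq_zero hv hρ hF hK hx
  -- The jump of the constant test function vanishes, so integration by parts leaves precisely the
  -- flux `[[ρ v]]{1}`.
  have h3 : (M.intE fun F x => ⟪M.jump F (fun _ => (1 : ℝ)) x, M.avg F (fun y => ρ y • v y) x⟫ +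
      M.jumpVec F (fun y => ρ y • v y) x * M.avg F (fun _ => (1 : ℝ)) x) =
      M.intE fun F x => M.jumpVec F (fun y => ρ y • v y) x * M.avg F (fun _ => (1 : ℝ)) x := by
    refine Finset.sum_congr rfl fun F hF => ?_
    refine setIntegral_congr_fun (isCompact_hull F).measurableSet fun x hx => ?_
    obtain ⟨K, J, hne, hKJ⟩ := M.exists_cellsOf_eq_pair (by omega) hF
    have hn := M.normal_eq_neg (by omega) (M.interiorFaces_subset_faces hF) (K := K) (J := J)
      (by rw [hKJ]; simp) (by rw [hKJ]; simp) hne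
    simp only
    rw [(isRep_const (M := M) (1 : ℝ)).jump_eq F hx, hKJ, Finset.sum_pair hne, hn]
    simp
  rw [h3] at h2
  rw [intE_neg, ← h2] at h1
  have h4 : ∫ x in Ω, (R x + div (fun y => ρ y • v y) x) * 1 =
      (∫ x in Ω, R x) + ∫ x in Ω, div (fun y => ρ y • v y) x := by
    simp only [mul_one]
    exact integral_add (hgR.integrableOn hΩ) ((hg.smul hu).div.integrableOn hΩ)
  have h6 : ∫ x in Ω, (⟪gradient (fun _ => (1 : ℝ)) x, ρ x • v x⟫ +
      1 * div (fun y => ρ y • v y) x) = ∫ x in Ω, div (fun y => ρ y • v y) x := by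
    simp [gradient]
  rw [h4, h6] at h1
  linarith

/-- The energy balance, with the rates of change `R`, `V` and `Q` of `ρ`, `v` and `q`. -/
theorem setIntegral_energy_rate (hΩo : IsOpen Ω) (hΩ : interior (closure Ω) = Ω) {W : ℝ → ℝ}
    (hW : ContDiff ℝ 1 W) {γ β : ℝ}
    {ρ τ R : Space (n + 1) → ℝ} {v V q Q : Space (n + 1) → Space (n + 1)}
    {gV : Finset (Space (n + 1)) → Space (n + 1) → Space (n + 1)} (hρ : ρ ∈ M.fes p)
    (hτ : τ ∈ M.fes p) (hR : R ∈ M.fes p) (hv : v ∈ M.fesZeroVec p) (hq : q ∈ M.fesNormal p)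
    (hQ : Q ∈ M.fesNormal p) (hV : M.IsRep V gV)
    (hmass : 0 = (∫ x in Ω, (R x + div (fun y => ρ y • v y) x) * τ x) +
      M.intE fun F x => -(M.jumpVec F (fun y => ρ y • v y) x * M.avg F τ x))
    (hmom : 0 = (∫ x in Ω, ⟪ρ x • V x
            + divMat (fun y => ρ y • Matrix.vecMulVec (v y).ofLp (v y).ofLp) x
            - div (fun y => ρ y • v y) x • v x + ρ x • gradient τ x
            - (1 / 2 * ρ x : ℝ) • gradient (fun y => ‖v y‖ ^ 2) x, v x⟫)
      + (M.intE fun F x => -⟪M.jump F τ x, M.avg F (fun y => ρ y • v y) x⟫) + β)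
    (htau : 0 = (∫ x in Ω, (τ x - deriv W (ρ x) + γ * div q x - 1 / 2 * ‖v x‖ ^ 2) * R x)
      + M.intE fun F x => -(γ * M.jumpVec F q x * M.avg F R x))
    (hgrad : M.gradForm R Q q = 0) :
    ∫ x in Ω, (deriv W (ρ x) * R x + (1 / 2 * R x * ‖v x‖ ^ 2 + ρ x * ⟪v x, V x⟫) +
        γ * ⟪q x, Q x⟫) = -β := by
  obtain ⟨gρ, hgρ⟩ := exists_isRep_fes hρ
  obtain ⟨gτ, hgτ⟩ := exists_isRep_fes hτ
  obtain ⟨gR, hgR⟩ := exists_isRep_fes hR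
  obtain ⟨gv, hgv⟩ := exists_isRep_fesZeroVec hv
  obtain ⟨gq, hgq⟩ := exists_isRep_fesNormal hq
  obtain ⟨gQ, hgQ⟩ := exists_isRep_fesNormal hQ
  have hρv := hgρ.smul hgv
  have ibp1 := integral_by_parts hΩ hgτ hρv
    fun F hF K hK x hx => trace_inner_normal_eq_zero hv hρ hF hK hx
  have ibp2 := integral_by_parts hΩ hgR hgq hq.2
  have hsplit1 := intE_add (M := M) (f := fun F x => ⟪M.jump F τ x, M.avg F (fun y => ρ y • v y) x⟫)
    (g := fun F x => M.jumpVec F (fun y => ρ y • v y) x * M.avg F τ x)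
    (fun F => (hgτ.continuousOn_jump F).inner (hρv.continuousOn_avg F))
    (fun F => (hρv.continuousOn_jumpVec F).mul (hgτ.continuousOn_avg F))
  have hsplit2 := intE_add (M := M) (f := fun F x => ⟪M.jump F R x, M.avg F q x⟫)
    (g := fun F x => M.jumpVec F q x * M.avg F R x)
    (fun F => (hgR.continuousOn_jump F).inner (hgq.continuousOn_avg F))
    (fun F => (hgq.continuousOn_jumpVec F).mul (hgR.continuousOn_avg F))
  rw [hsplit1] at ibp1
  rw [hsplit2] at ibp2
  rw [intE_neg] at hmass hmom htau
  simp only [mul_assoc γ] at htau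
  rw [intE_const_mul] at htau
  -- Tested with `v`, the convective term equals `div (ρ v) |v|² + ½ ρ ∇|v|²·v`, which the two
  -- correction terms of the scheme remove pointwise.
  have hmom' : ∫ x in Ω, ⟪ρ x • V x
            + divMat (fun y => ρ y • Matrix.vecMulVec (v y).ofLp (v y).ofLp) x
            - div (fun y => ρ y • v y) x • v x + ρ x • gradient τ x
            - (1 / 2 * ρ x : ℝ) • gradient (fun y => ‖v y‖ ^ 2) x, v x⟫ =
      ∫ x in Ω, (ρ x * ⟪V x, v x⟫ + ⟪gradient τ x, ρ x • v x⟫) := by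
    refine setIntegral_congr_cells (M := M) hΩo hΩ fun K hK x hx => ?_
    simp only [inner_add_left, inner_sub_left, real_inner_smul_left, real_inner_smul_right,
      inner_divMat_self (hgρ.differentiableAt hK hx) (hgv.differentiableAt hK hx),
      real_inner_self_eq_norm_sq]
    ring
  rw [hmom'] at hmom
  have hWR : IntegrableOn (fun x => deriv W (ρ x) * R x) Ω := by
    refine (M.integrableOn_and_setIntegral_eq_sum hΩ (g := fun K x => deriv W (gρ K x) * gR K x)
      fun K hK => ⟨?_, fun x hx => ?_⟩).1
    · have h1 := (hgρ K hK).1.continuous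
      have h2 := (hgR K hK).1.continuous
      have h3 := hW.continuous_deriv le_rfl
      fun_prop
    · simp only [(hgρ K hK).2 hx, (hgR K hK).2 hx]
  have i1 : IntegrableOn (fun x => (R x + div (fun y => ρ y • v y) x) * τ x) Ω :=
    ((hgR.add hρv.div).mul hgτ).integrableOn hΩ
  have i2 : IntegrableOn (fun x => ρ x * ⟪V x, v x⟫ + ⟪gradient τ x, ρ x • v x⟫) Ω :=
    ((hgρ.mul (hV.inner hgv)).add (hgτ.gradient.inner hρv)).integrableOn hΩ
  have i3 : IntegrableOn
      (fun x => (τ x - deriv W (ρ x) + γ * div q x - 1 / 2 * ‖v x‖ ^ 2) * R x) Ω := by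
    have h1 := (((hgτ.add ((isRep_const γ).mul hgq.div)).sub
      ((isRep_const (1 / 2 : ℝ)).mul (hgv.inner hgv))).mul hgR).integrableOn hΩ
    refine (h1.sub hWR).congr (Filter.Eventually.of_forall fun x => ?_)
    simp only [Pi.sub_apply, real_inner_self_eq_norm_sq]
    ring
  have i4 : IntegrableOn (fun x => ⟪Q x - gradient R x, q x⟫) Ω :=
    ((hgQ.sub hgR.gradient).inner hgq).integrableOn hΩ
  have i5 : IntegrableOn (fun x => ⟪gradient R x, q x⟫ + R x * div q x) Ω :=
    ((hgR.gradient.inner hgq).add (hgR.mul hgq.div)).integrableOn hΩ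
  have i6 : IntegrableOn
      (fun x => ⟪gradient τ x, ρ x • v x⟫ + τ x * div (fun y => ρ y • v y) x) Ω :=
    ((hgτ.gradient.inner hρv).add (hgτ.mul hρv.div)).integrableOn hΩ
  -- A pointwise identity between the integrands: the energy rate is the signed sum of the four
  -- tested equations, corrected by the integrands of the two integrations by parts.
  have key : ∫ x in Ω, (deriv W (ρ x) * R x + (1 / 2 * R x * ‖v x‖ ^ 2 + ρ x * ⟪v x, V x⟫) +
        γ * ⟪q x, Q x⟫) =
      (∫ x in Ω, (R x + div (fun y => ρ y • v y) x) * τ x) +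
      (∫ x in Ω, (ρ x * ⟪V x, v x⟫ + ⟪gradient τ x, ρ x • v x⟫)) -
      (∫ x in Ω, (τ x - deriv W (ρ x) + γ * div q x - 1 / 2 * ‖v x‖ ^ 2) * R x) +
      γ * (∫ x in Ω, ⟪Q x - gradient R x, q x⟫) +
      γ * (∫ x in Ω, (⟪gradient R x, q x⟫ + R x * div q x)) -
      ∫ x in Ω, (⟪gradient τ x, ρ x • v x⟫ + τ x * div (fun y => ρ y • v y) x) := by
    have lin : ∀ {f g : Space (n + 1) → ℝ} (c : ℝ), IntegrableOn f Ω → IntegrableOn g Ω →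
        IntegrableOn (fun x => f x + c * g x) Ω ∧
          ∫ x in Ω, (f x + c * g x) = (∫ x in Ω, f x) + c * ∫ x in Ω, g x := by
      intro f g c hf hg
      refine ⟨hf.add (hg.const_mul c), ?_⟩
      rw [integral_add hf (hg.const_mul c), integral_const_mul]
    have j1 := lin 1 i1 i2
    have j2 := lin (-1) j1.1 i3
    have j3 := lin γ j2.1 i4
    have j4 := lin γ j3.1 i5
    have j5 := lin (-1) j4.1 i6
    rw [j1.2] at j2
    rw [j2.2] at j3
    rw [j3.2] at j4
    rw [j4.2] at j5
    refine (integral_congr_ae (Filter.Eventually.of_forall fun x => ?_)).trans (j5.2.trans (by ring))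
    simp only [inner_sub_left, real_inner_comm (V x) (v x), real_inner_comm (Q x) (q x)]
    ring
  rw [gradForm] at hgrad
  rw [key, ibp1, ibp2]
  -- The face terms from `ibp1` and `ibp2` cancel against the four fluxes.
  linear_combination (-1 : ℝ) * hmass - hmom + htau + γ * hgrad

/-- Along a solution, mass is conserved and the energy changes at the rate `-μ B(v, v)`. -/
theorem hasDerivWithinAt_mass_energy (hΩo : IsOpen Ω) (hΩ : interior (closure Ω) = Ω) {W : ℝ → ℝ}
    (hW : ContDiff ℝ 1 W) {γ μ T : ℝ} (hT : 0 < T)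
    {B : (Space (n + 1) → Space (n + 1)) → (Space (n + 1) → Space (n + 1)) → ℝ}
    {ρ τ : ℝ → Space (n + 1) → ℝ} {v q : ℝ → Space (n + 1) → Space (n + 1)}
    (h : IsSolution M p (M.centralFluxes γ) W γ μ B T ρ v τ q) {t : ℝ} (ht : t ∈ Icc 0 T) :
    HasDerivWithinAt (fun s => mass Ω (ρ s)) 0 (Icc 0 T) t ∧
      HasDerivWithinAt (fun s => energy Ω W γ (ρ s) (v s) (q s)) (-μ * B (v t) (v t))
        (Icc 0 T) t := by
  have hS : UniqueDiffWithinAt ℝ (Icc 0 T) t := uniqueDiffOn_Icc hT t ht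
  obtain ⟨m, s, a, hs, hρ, ha⟩ := exists_time_expansion h.rho_mem h.rho_diff
  obtain ⟨l, s', b, hs', hv, hb⟩ := exists_time_expansion_vec
    (fun t ht i => (h.v_mem t ht i).1) h.v_diff
  have hform : ∀ t ∈ Icc 0 T, ∀ ζ ∈ M.fesNormal p, M.gradForm (ρ t) (q t) ζ = 0 := fun t ht ζ hζ =>
    (h.q_eq t ht ζ hζ).symm
  have hq : ∀ t ∈ Icc 0 T, ∀ K ∈ M.cells, ∀ x ∈ openCell K, q t x = ∑ i, a t i • q (s i) x :=
    fun t ht => expansion_of_gradForm hΩo hΩ (fun i => h.rho_mem _ (hs i))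
      (fun i => h.q_mem _ (hs i)) (h.rho_mem t ht) (h.q_mem t ht) (fun i => hform _ (hs i))
      (hform t ht) (hρ t ht)
  choose g hg using fun i => exists_isRep_fes (h.rho_mem _ (hs i))
  choose u hu using fun i => exists_isRep_fesNormal (h.q_mem _ (hs i))
  choose z hz using fun i => exists_isRep_fesZeroVec (h.v_mem _ (hs' i))
  have ha' := hasDerivWithinAt_pi.1 (ha t ht).hasDerivWithinAt
  have hb' := hasDerivWithinAt_pi.1 (hb t ht).hasDerivWithinAt
  set a' := derivWithin a (Icc 0 T) t
  set b' := derivWithin b (Icc 0 T) t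
  have hR : ∀ K ∈ M.cells, ∀ x ∈ openCell K, HasDerivWithinAt (fun r => ρ r x)
      (∑ i, a' i * ρ (s i) x) (Icc 0 T) t := fun K hK x hx =>
    (HasDerivWithinAt.fun_sum fun i _ => (ha' i).mul_const (ρ (s i) x)).congr
      (fun r hr => hρ r hr K hK x hx) (hρ t ht K hK x hx)
  have hQ : ∀ K ∈ M.cells, ∀ x ∈ openCell K, HasDerivWithinAt (fun r => q r x)
      (∑ i, a' i • q (s i) x) (Icc 0 T) t := fun K hK x hx =>
    (HasDerivWithinAt.fun_sum fun i _ => (ha' i).smul_const (q (s i) x)).congr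
      (fun r hr => hq r hr K hK x hx) (hq t ht K hK x hx)
  have hV : ∀ K ∈ M.cells, ∀ x ∈ openCell K, HasDerivWithinAt (fun r => v r x)
      (∑ i, b' i • v (s' i) x) (Icc 0 T) t := fun K hK x hx =>
    (HasDerivWithinAt.fun_sum fun i _ => (hb' i).smul_const (v (s' i) x)).congr
      (fun r hr => hv r hr K hK x hx) (hv t ht K hK x hx)
  -- The time derivative of `ρ` is again a combination of time slices, hence an admissible test
  -- function for the equation for `τ`.
  have hRmem : (fun x => ∑ i, a' i * ρ (s i) x) ∈ M.fes p :=
    sum_mem_fes fun i => h.rho_mem _ (hs i)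
  have hQmem : (fun x => ∑ i, a' i • q (s i) x) ∈ M.fesNormal p :=
    sum_mem_fesNormal fun i => h.q_mem _ (hs i)
  have hVrep := IsRep.sum (c := b') hz
  have hmass : ∀ Ψ ∈ M.fes p, 0 = (∫ x in Ω, ((∑ i, a' i * ρ (s i) x) +
      div (fun y => ρ t y • v t y) x) * Ψ x) +
      M.intE fun F x => -(M.jumpVec F (fun y => ρ t y • v t y) x * M.avg F Ψ x) := by
    intro Ψ hΨ
    refine (h.mass_eq t ht Ψ hΨ).trans ?_
    congr 1
    refine setIntegral_congr_cells (M := M) hΩo hΩ fun K hK x hx => ?_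
    rw [(hR K hK x hx).derivWithin hS]
  constructor
  · refine (hasDerivWithinAt_mass hΩ ht hS hg (ha t ht) hρ hR).congr_deriv ?_
    exact setIntegral_mass_rate hΩ (h.rho_mem t ht) hRmem (h.v_mem t ht) hmass
  · refine (hasDerivWithinAt_energy hΩ ht hS hW γ hg hu hz (ha t ht) (hb t ht) hρ hq hv hR hQ
      hV).congr_deriv ?_
    rw [neg_mul]
    refine setIntegral_energy_rate hΩo hΩ hW (h.rho_mem t ht) (h.tau_mem t ht) hRmem (h.v_mem t ht)
      (h.q_mem t ht) hQmem hVrep (hmass _ (h.tau_mem t ht)) ?_ (h.tau_eq t ht _ hRmem) ?_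
    · refine (h.momentum_eq t ht _ (h.v_mem t ht)).trans ?_
      congr 2
      refine setIntegral_congr_cells (M := M) hΩo hΩ fun K hK x hx => ?_
      rw [(hV K hK x hx).derivWithin hS]
    -- The differentiated equation for `q` is the combination, with weights `a'`, of the equations
    -- at the fixed times `s i`.
    rw [gradForm_sum hΩo hΩ (fun i => h.rho_mem _ (hs i)) (fun i => h.q_mem _ (hs i))
      (h.q_mem t ht)]
    exact Finset.sum_eq_zero fun i _ => by rw [hform _ (hs i) _ (h.q_mem t ht), mul_zero]

end Triangulation

/-! ### Coercivity -/

theorem totalDegree_pderiv_le (i : Fin d) (P : MvPolynomial (Fin d) ℝ) :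
    (MvPolynomial.pderiv i P).totalDegree ≤ P.totalDegree := by
  conv_lhs => rw [P.as_sum, map_sum]
  refine MvPolynomial.totalDegree_finsetSum_le fun s hs => ?_
  rw [MvPolynomial.pderiv_monomial]
  refine (MvPolynomial.totalDegree_monomial_le _ _).trans ?_
  refine le_trans ?_ (MvPolynomial.le_totalDegree hs)
  exact Finsupp.degree_mono tsub_le_self

theorem fderiv_polyFun (P : MvPolynomial (Fin d) ℝ) (x : Space d) (j : Fin d) :
    fderiv ℝ (polyFun P) x (EuclideanSpace.single j 1) = polyFun (MvPolynomial.pderiv j P) x := by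
  have hdiff : ∀ Q : MvPolynomial (Fin d) ℝ, DifferentiableAt ℝ (polyFun Q) x := fun Q =>
    (contDiff_polyFun Q (k := 1)).differentiable one_ne_zero x
  induction P using MvPolynomial.induction_on with
  | C a =>
    have : polyFun (MvPolynomial.C a) = fun _ : Space d => a := by
      funext y
      simp [polyFun]
    simp [this, polyFun]
  | add P Q hP hQ =>
    have : polyFun (P + Q) = fun y : Space d => polyFun P y + polyFun Q y := by
      funext y
      simp [polyFun]
    rw [this, fderiv_fun_add (hdiff P) (hdiff Q), add_apply, hP, hQ]
    simp [polyFun]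
  | mul_X P i hP =>
    have h1 : polyFun (P * MvPolynomial.X i) = fun y : Space d => polyFun P y * y i := by
      funext y
      simp [polyFun]
    have h2 : HasFDerivAt (fun y : Space d => y i) (PiLp.proj 2 (𝕜 := ℝ) (fun _ : Fin d => ℝ) i) x :=
      (PiLp.proj 2 (𝕜 := ℝ) (fun _ : Fin d => ℝ) i).hasFDerivAt
    rw [h1, fderiv_fun_mul (hdiff P) h2.differentiableAt, h2.fderiv]
    simp only [add_apply, smul_apply, hP, smul_eq_mul]
    simp [polyFun, MvPolynomial.pderiv_X, Pi.single_apply]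
    split_ifs <;> simp_all

theorem jacobian_polyVec (P : Fin d → MvPolynomial (Fin d) ℝ) (x : Space d) (i j : Fin d) :
    jacobian (polyVec P) x i j = polyFun (MvPolynomial.pderiv j (P i)) x := by
  rw [← fderiv_polyFun]
  have h1 : HasFDerivAt (polyVec P) (fderiv ℝ (polyVec P) x) x :=
    ((contDiff_polyVec P (k := 1)).differentiable one_ne_zero x).hasFDerivAt
  have h2 : HasFDerivAt (polyFun (P i)) ((PiLp.proj 2 (𝕜 := ℝ) (fun _ : Fin d => ℝ) i).comp
      (fderiv ℝ (polyVec P) x)) x :=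
    ((PiLp.proj 2 (𝕜 := ℝ) (fun _ : Fin d => ℝ) i).hasFDerivAt).comp x h1
  rw [h2.fderiv]
  rfl

theorem continuous_jacobian_polyVec (P : Fin d → MvPolynomial (Fin d) ℝ) :
    Continuous (jacobian (polyVec P)) := by
  refine continuous_matrix fun i j => ?_
  simp only [jacobian_polyVec]
  exact continuous_polyFun _

theorem frob_eq_sum (X Y : Matrix (Fin d) (Fin d) ℝ) : frob X Y = ∑ i, ∑ j, X i j * Y i j := by
  rw [frob, Matrix.trace, Finset.sum_comm]
  rfl

theorem frob_self_nonneg (X : Matrix (Fin d) (Fin d) ℝ) : 0 ≤ frob X X := by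
  rw [frob_eq_sum]
  exact Finset.sum_nonneg fun i _ => Finset.sum_nonneg fun j _ => mul_self_nonneg _

theorem two_mul_frob_le {ε : ℝ} (hε : 0 < ε) (X Y : Matrix (Fin d) (Fin d) ℝ) :
    2 * frob X Y ≤ ε * frob X X + ε⁻¹ * frob Y Y := by
  simp only [frob_eq_sum, Finset.mul_sum, ← Finset.sum_add_distrib]
  refine Finset.sum_le_sum fun i _ => Finset.sum_le_sum fun j _ => ?_
  have h : ε * (X i j * X i j) + ε⁻¹ * (Y i j * Y i j) - 2 * (X i j * Y i j) =
      ε⁻¹ * (ε * X i j - Y i j) ^ 2 := by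
    field_simp
    ring
  have : 0 ≤ ε⁻¹ * (ε * X i j - Y i j) ^ 2 := by positivity
  linarith

/-- The mean of matrices is bounded by the sum. -/
theorem frob_mean_le {ι : Type*} {s : Finset ι} (hs : s.Nonempty)
    (A : ι → Matrix (Fin d) (Fin d) ℝ) :
    frob ((s.card : ℝ)⁻¹ • ∑ k ∈ s, A k) ((s.card : ℝ)⁻¹ • ∑ k ∈ s, A k) ≤
      ∑ k ∈ s, frob (A k) (A k) := by
  have h0 : ∑ k ∈ s, frob (A k) (A k) = ∑ i, ∑ j, ∑ k ∈ s, A k i j * A k i j := by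
    simp only [frob_eq_sum]
    rw [Finset.sum_comm]
    exact Finset.sum_congr rfl fun i _ => Finset.sum_comm
  rw [h0, frob_eq_sum]
  refine Finset.sum_le_sum fun i _ => Finset.sum_le_sum fun j _ => ?_
  have h1 := sq_sum_le_card_mul_sum_sq (s := s) (f := fun k => A k i j)
  have hc : (1 : ℝ) ≤ s.card := by exact_mod_cast hs.card_pos
  have h2 : 0 ≤ ∑ k ∈ s, A k i j ^ 2 := Finset.sum_nonneg fun k _ => sq_nonneg _
  simp only [Matrix.smul_apply, Matrix.sum_apply, smul_eq_mul, ← sq]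
  rw [mul_pow, inv_pow, inv_mul_le_iff₀ (by positivity)]
  nlinarith

theorem continuous_frob {X Y : Space d → Matrix (Fin d) (Fin d) ℝ} (hX : Continuous X)
    (hY : Continuous Y) : Continuous fun x => frob (X x) (Y x) :=
  (hX.matrix_transpose.matrix_mul hY).matrix_trace

namespace Triangulation

section

variable {Ω : Set (Space d)} {M : Triangulation d Ω} {p : ℕ}

theorem meshSize_nonneg (x : Space d) : 0 ≤ M.meshSize x := by
  refine Real.sSup_nonneg ?_
  rintro _ ⟨K, -, -, rfl⟩
  exact Metric.diam_nonneg

theorem diam_pos (hd : 1 ≤ d) {K : Finset (Space d)} (hK : K ∈ M.cells) :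
    0 < Metric.diam (hull K) := by
  refine Metric.diam_pos ?_ (isCompact_hull K).isBounded
  obtain ⟨x, hx, y, hy, hxy⟩ := Finset.one_lt_card.1 (by rw [M.card_eq K hK]; omega)
  exact ⟨x, subset_convexHull ℝ _ hx, y, subset_convexHull ℝ _ hy, hxy⟩

/-- A relative interior point of `F` belongs only to elements having `F` as a face, so the supremum
defining `h` is the largest diameter among these and is constant there. -/
theorem exists_meshSize_eq {F : Finset (Space d)} (hF : F ∈ M.faces) :
    ∃ K ∈ M.cellsOf F, ∀ x ∈ relint F, M.meshSize x = Metric.diam (hull K) := by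
  classical
  obtain ⟨J, hJ⟩ := M.cellsOf_nonempty hF
  obtain ⟨K, hK, hmax⟩ := (M.cellsOf F).exists_max_image (fun K => Metric.diam (hull K)) ⟨J, hJ⟩
  refine ⟨K, hK, fun x hx => ?_⟩
  have hK' := M.mem_cellsOf.1 hK
  refine IsGreatest.csSup_eq ⟨⟨K, hK'.1, hull_mono hK'.2 (relint_subset_hull F hx), rfl⟩, ?_⟩
  rintro _ ⟨L, hL, hxL, rfl⟩
  exact hmax L (M.mem_cellsOf.2 ⟨hL, M.subset_of_mem_relint_of_mem_hull hK'.1 hK'.2 hL hx hxL⟩)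

/-- The factor `1 + κ` also covers boundary faces, where both elements coincide and `κ ≥ 1` would
otherwise be required. -/
theorem diam_le_of_mem_cellsOf {κ : ℝ} (hκ : 0 < κ) (hM : M.ShapeRegular κ) {F : Finset (Space d)}
    (hF : F ∈ M.faces) {K J : Finset (Space d)} (hK : K ∈ M.cellsOf F) (hJ : J ∈ M.cellsOf F) :
    Metric.diam (hull K) ≤ (1 + κ) * Metric.diam (hull J) := by
  classical
  have hJ0 : 0 ≤ Metric.diam (hull J) := Metric.diam_nonneg
  by_cases h : 2 ≤ (M.cellsOf F).card
  · have := hM.neighbours F (Finset.mem_filter.2 ⟨hF, h⟩) K hK J hJ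
    linarith
  · have hKJ : K = J := Finset.card_le_one.1 (by omega) K hK J hJ
    subst hKJ
    nlinarith

theorem continuous_frob_jacobian (P : Fin d → MvPolynomial (Fin d) ℝ) :
    Continuous fun x => frob (jacobian (polyVec P) x) (jacobian (polyVec P) x) :=
  continuous_frob (continuous_jacobian_polyVec P) (continuous_jacobian_polyVec P)

theorem avg_jacobian_eq {w : Space d → Space d}
    {P : Finset (Space d) → Fin d → MvPolynomial (Fin d) ℝ} (hw : M.IsRep w fun K => polyVec (P K))
    (F : Finset (Space d)) {x : Space d} (hx : x ∈ hull F) :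
    M.avg F (jacobian w) x =
      ((M.cellsOf F).card : ℝ)⁻¹ • ∑ K ∈ M.cellsOf F, jacobian (polyVec (P K)) x := by
  unfold avg
  congr 1
  refine Finset.sum_congr rfl fun K hK => ?_
  have hK' := M.mem_cellsOf.1 hK
  exact NSK.trace_eq (M.card_eq K hK'.1) (M.indep K hK'.1)
    (continuous_jacobian_polyVec (P K)).continuousAt
    (fun y hy => jacobian_congr (hw.eventuallyEq hK'.1 hy)) (hull_mono hK'.2 hx)

theorem tensorJump_eq {w : Space d → Space d} {u : Finset (Space d) → Space d → Space d}
    (hw : M.IsRep w u) (F : Finset (Space d)) {x : Space d} (hx : x ∈ hull F) :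
    M.tensorJump F w x =
      ∑ K ∈ M.cellsOf F, Matrix.vecMulVec (u K x).ofLp (normal K F).ofLp := by
  refine Finset.sum_congr rfl fun K hK => ?_
  have hK' := M.mem_cellsOf.1 hK
  rw [hw.trace_eq hK'.1 (hull_mono hK'.2 hx)]

theorem intEB_eq (f : Finset (Space d) → Space d → ℝ) :
    M.intEB f = ∑ F ∈ M.faces, ∫ x in hull F, f F x ∂μHE[d - 1] := by
  rw [M.sum_faces]
  rfl

theorem dgNormSq_nonneg (w : Space d → Space d) : 0 ≤ M.dgNormSq w := by
  rw [dgNormSq, intEB_eq]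
  refine add_nonneg (integral_nonneg fun x => frob_self_nonneg _) (Finset.sum_nonneg fun F _ =>
    integral_nonneg fun x => mul_nonneg (inv_nonneg.2 (meshSize_nonneg x)) (frob_self_nonneg _))

end

variable {Ω : Set (Space (n + 1))} {M : Triangulation (n + 1) Ω} {p : ℕ}

/-- The discrete trace inequality for each entry of the Jacobian, again a polynomial of degree at
most `p`, with the inscribed ball of radius `h_K / κ`. -/
theorem setIntegral_frob_jacobian_face_le {C κ : ℝ}
    (hC : ∀ K : Finset (Space (n + 1)), K.card = n + 2 →
      AffineIndependent ℝ ((↑) : K → Space (n + 1)) →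
      ∀ F ∈ K.powersetCard (n + 1), ∀ (c : Space (n + 1)) (r : ℝ), Metric.ball c r ⊆ hull K →
      ∀ P : MvPolynomial (Fin (n + 1)) ℝ, P.totalDegree ≤ p →
        r * ∫ x in hull F, polyFun P x ^ 2 ∂μHE[n] ≤ C * ∫ x in hull K, polyFun P x ^ 2)
    (hκ : 0 < κ) (hM : M.ShapeRegular κ) {K F : Finset (Space (n + 1))} (hK : K ∈ M.cells)
    (hF : F ∈ K.powersetCard (n + 1)) {P : Fin (n + 1) → MvPolynomial (Fin (n + 1)) ℝ}
    (hP : ∀ i, (P i).totalDegree ≤ p) :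
    Metric.diam (hull K) *
        ∫ x in hull F, frob (jacobian (polyVec P) x) (jacobian (polyVec P) x) ∂μHE[n] ≤
      κ * C * ∫ x in hull K, frob (jacobian (polyVec P) x) (jacobian (polyVec P) x) := by
  obtain ⟨c, hc⟩ := hM.ball_subset K hK
  have hFc := (Finset.mem_powersetCard.1 hF).2
  have hcont : ∀ i j : Fin (n + 1), Continuous fun x =>
      polyFun (MvPolynomial.pderiv j (P i)) x ^ 2 := fun i j => by
    have := continuous_polyFun (MvPolynomial.pderiv j (P i))
    fun_prop
  have h1 : ∀ (s : Set (Space (n + 1))) (ν : Measure (Space (n + 1))),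
      (∀ i j, Integrable (fun x => polyFun (MvPolynomial.pderiv j (P i)) x ^ 2) (ν.restrict s)) →
      ∫ x in s, frob (jacobian (polyVec P) x) (jacobian (polyVec P) x) ∂ν =
        ∑ i, ∑ j, ∫ x in s, polyFun (MvPolynomial.pderiv j (P i)) x ^ 2 ∂ν := by
    intro s ν h
    simp only [frob_eq_sum, jacobian_polyVec, ← sq]
    rw [integral_finsetSum _ fun i _ => integrable_finsetSum _ fun j _ => h i j]
    exact Finset.sum_congr rfl fun i _ => integral_finsetSum _ fun j _ => h i j
  rw [h1 _ _ fun i j => integrableOn_hull hFc (hcont i j),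
    h1 _ _ fun i j => (hcont i j).continuousOn.integrableOn_compact (isCompact_hull K)]
  simp only [Finset.mul_sum]
  refine Finset.sum_le_sum fun i _ => Finset.sum_le_sum fun j _ => ?_
  have h2 := hC K (M.card_eq K hK) (M.indep K hK) F hF c _ hc _
    ((totalDegree_pderiv_le j (P i)).trans (hP i))
  rw [div_mul_eq_mul_div, div_le_iff₀ hκ] at h2
  linarith

/-- The terms of the symmetric interior penalty form on a single face. -/
theorem sip_face_le {κ δ σ : ℝ} (hκ : 0 < κ) (hδ : 0 < δ) (hσ : δ⁻¹ + 1 / 2 ≤ σ)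
    (hM : M.ShapeRegular κ) {w : Space (n + 1) → Space (n + 1)}
    {P : Finset (Space (n + 1)) → Fin (n + 1) → MvPolynomial (Fin (n + 1)) ℝ}
    (hw : M.IsRep w fun K => polyVec (P K)) {F : Finset (Space (n + 1))} (hF : F ∈ M.faces) :
    (∫ x in hull F, (frob (M.avg F (jacobian w) x) (M.tensorJump F w x) +
          frob (M.avg F (jacobian w) x) (M.tensorJump F w x) -
          σ / M.meshSize x * frob (M.tensorJump F w x) (M.tensorJump F w x)) ∂μHE[n]) +
        1 / 2 * ∫ x in hull F, (M.meshSize x)⁻¹ *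
          frob (M.tensorJump F w x) (M.tensorJump F w x) ∂μHE[n] ≤
      ∑ K ∈ M.cellsOf F, δ * (1 + κ) * (Metric.diam (hull K) *
        ∫ x in hull F, frob (jacobian (polyVec (P K)) x) (jacobian (polyVec (P K)) x) ∂μHE[n]) := by
  obtain ⟨K₀, hK₀, hmesh⟩ := M.exists_meshSize_eq hF
  set h := Metric.diam (hull K₀) with hh
  have hpos : 0 < h := M.diam_pos (by omega) (M.mem_cellsOf.1 hK₀).1
  have hFc := card_face hF
  set A : Space (n + 1) → Matrix (Fin (n + 1)) (Fin (n + 1)) ℝ := fun x =>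
    ((M.cellsOf F).card : ℝ)⁻¹ • ∑ K ∈ M.cellsOf F, jacobian (polyVec (P K)) x with hA
  set X : Space (n + 1) → Matrix (Fin (n + 1)) (Fin (n + 1)) ℝ := fun x =>
    ∑ K ∈ M.cellsOf F, Matrix.vecMulVec (polyVec (P K) x).ofLp (normal K F).ofLp with hX
  have hAc : Continuous A := by
    refine continuous_matrix fun i j => ?_
    simp only [hA, Matrix.smul_apply, Matrix.sum_apply, jacobian_polyVec, smul_eq_mul]
    exact continuous_const.mul (continuous_finsetSum _ fun K _ => continuous_polyFun _)
  have hXc : Continuous X := continuous_finsetSum _ fun K _ => by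
    refine continuous_matrix fun i j => ?_
    have := continuous_polyFun (P K i)
    exact this.mul continuous_const
  have hAX := continuous_frob hAc hXc
  have hXX := continuous_frob hXc hXc
  have e1 : ∫ x in hull F, (frob (M.avg F (jacobian w) x) (M.tensorJump F w x) +
          frob (M.avg F (jacobian w) x) (M.tensorJump F w x) -
          σ / M.meshSize x * frob (M.tensorJump F w x) (M.tensorJump F w x)) ∂μHE[n] =
      ∫ x in hull F, (2 * frob (A x) (X x) - σ / h * frob (X x) (X x)) ∂μHE[n] := by
    refine integral_congr_ae ?_
    -- The mesh size equals `h` on the relative interior only; lower-dimensional subfaces may touch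
    -- larger elements.
    filter_upwards [ae_mem_relint hFc] with x hx
    have hx' := relint_subset_hull F hx
    rw [avg_jacobian_eq hw F hx', tensorJump_eq hw F hx', hmesh x hx, two_mul]
  have e2 : ∫ x in hull F, (M.meshSize x)⁻¹ *
          frob (M.tensorJump F w x) (M.tensorJump F w x) ∂μHE[n] =
      ∫ x in hull F, h⁻¹ * frob (X x) (X x) ∂μHE[n] := by
    refine integral_congr_ae ?_
    filter_upwards [ae_mem_relint hFc] with x hx
    rw [tensorJump_eq hw F (relint_subset_hull F hx), hmesh x hx]
  have hi1 : IntegrableOn (fun x => 2 * frob (A x) (X x) - σ / h * frob (X x) (X x)) (hull F)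
      μHE[n] := integrableOn_hull hFc ((continuous_const.mul hAX).sub (continuous_const.mul hXX))
  have hi2 : IntegrableOn (fun x => h⁻¹ * frob (X x) (X x)) (hull F) μHE[n] :=
    integrableOn_hull hFc (continuous_const.mul hXX)
  have hi3 : ∀ K, IntegrableOn (fun x => δ * (1 + κ) * (Metric.diam (hull K) *
      frob (jacobian (polyVec (P K)) x) (jacobian (polyVec (P K)) x))) (hull F) μHE[n] := fun K =>
    integrableOn_hull hFc
      (continuous_const.mul (continuous_const.mul (continuous_frob_jacobian (P K))))
  rw [e1, e2]
  simp only [← integral_const_mul]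
  rw [← integral_add hi1 (hi2.const_mul _), ← integral_finsetSum _ fun K _ => hi3 K]
  refine integral_mono (hi1.add (hi2.const_mul _)) (integrable_finsetSum _ fun K _ => hi3 K)
    fun x => ?_
  -- Young's inequality with weight `δ * h`: the gradient part goes to the elements, and the jump
  -- part `δ⁻¹ h⁻¹ |X|²` together with the extra `½ h⁻¹ |X|²` is absorbed by the penalty since `σ ≥
  -- δ⁻¹ + ½`.
  have h1 := two_mul_frob_le (mul_pos hδ hpos) (A x) (X x)
  have h2 := frob_mean_le ⟨K₀, hK₀⟩ fun K => jacobian (polyVec (P K)) x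
  have h3 : δ * h * frob (A x) (A x) ≤ ∑ K ∈ M.cellsOf F, δ * (1 + κ) * (Metric.diam (hull K) *
      frob (jacobian (polyVec (P K)) x) (jacobian (polyVec (P K)) x)) := by
    refine (mul_le_mul_of_nonneg_left h2 (mul_pos hδ hpos).le).trans ?_
    rw [Finset.mul_sum]
    refine Finset.sum_le_sum fun K hK => ?_
    rw [← mul_assoc]
    refine mul_le_mul_of_nonneg_right ?_ (frob_self_nonneg _)
    rw [mul_assoc]
    exact mul_le_mul_of_nonneg_left (M.diam_le_of_mem_cellsOf hκ hM hF hK₀ hK) hδ.le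
  have h4 : (δ⁻¹ + 1 / 2) * (h⁻¹ * frob (X x) (X x)) ≤ σ * (h⁻¹ * frob (X x) (X x)) :=
    mul_le_mul_of_nonneg_right hσ (mul_nonneg (inv_nonneg.2 hpos.le) (frob_self_nonneg _))
  have h5 : (δ * h)⁻¹ * frob (X x) (X x) = δ⁻¹ * (h⁻¹ * frob (X x) (X x)) := by
    rw [mul_inv, mul_assoc]
  have h6 : σ / h * frob (X x) (X x) = σ * (h⁻¹ * frob (X x) (X x)) := by
    rw [div_eq_mul_inv, mul_assoc]
  change 2 * frob (A x) (X x) - σ / h * frob (X x) (X x) + 1 / 2 * (h⁻¹ * frob (X x) (X x)) ≤ _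
  rw [h6]
  rw [h5] at h1
  linarith

/-- Coercivity of the symmetric interior penalty form. -/
theorem exists_isCoercive_sip (n p : ℕ) {κ : ℝ} (hκ : 0 < κ) : ∃ σ₀ : ℝ, 0 < σ₀ ∧
    ∀ (Ω : Set (Space (n + 1))), interior (closure Ω) = Ω → ∀ (M : Triangulation (n + 1) Ω),
      M.ShapeRegular κ → ∀ σ : ℝ, σ₀ ≤ σ → M.IsCoercive p (M.sip σ) (1 / 2) := by
  obtain ⟨C, hC0, hC⟩ := exists_trace_const n p
  -- The factors are the comparison of neighbouring diameters, the trace constant and the number of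
  -- faces of an element. With `δ = (2 * C')⁻¹` the gradient terms on the faces use up half of the
  -- volume term, and `σ₀ = δ⁻¹ + ½` leaves half of the jump term.
  set C' : ℝ := (1 + κ) * (κ * C) * (n + 2) with hC'
  have hC'0 : 0 < C' := by positivity
  have hδ : 0 < (2 * C')⁻¹ := by positivity
  refine ⟨2 * C' + 1 / 2, by positivity, fun Ω hΩ M hM σ hσ w hw => ?_⟩
  obtain ⟨P, hPd, hP⟩ := exists_isRep_of_forall_mem_fes fun i => (hw i).1
  have hJ : ∫ x in Ω, frob (jacobian w x) (jacobian w x) = ∑ K ∈ M.cells,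
      ∫ x in hull K, frob (jacobian (polyVec (P K)) x) (jacobian (polyVec (P K)) x) := by
    refine (M.integrableOn_and_setIntegral_eq_sum hΩ fun K hK =>
      ⟨continuous_frob_jacobian (P K), fun x hx => ?_⟩).2
    simp only [jacobian_congr (hP.eventuallyEq hK hx)]
  have hfaces := Finset.sum_le_sum fun F (hF : F ∈ M.faces) =>
    M.sip_face_le hκ hδ (σ := σ) (by rwa [inv_inv]) hM hP hF
  have hsum : ∑ F ∈ M.faces, ∑ K ∈ M.cellsOf F, (2 * C')⁻¹ * (1 + κ) * (Metric.diam (hull K) *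
        ∫ x in hull F, frob (jacobian (polyVec (P K)) x) (jacobian (polyVec (P K)) x) ∂μHE[n]) ≤
      1 / 2 * ∑ K ∈ M.cells,
        ∫ x in hull K, frob (jacobian (polyVec (P K)) x) (jacobian (polyVec (P K)) x) := by
    rw [← M.sum_cells_faces fun K F => (2 * C')⁻¹ * (1 + κ) * (Metric.diam (hull K) *
        ∫ x in hull F, frob (jacobian (polyVec (P K)) x) (jacobian (polyVec (P K)) x) ∂μHE[n]),
      Finset.mul_sum]
    refine Finset.sum_le_sum fun K hK => ?_
    have h1 := Finset.sum_le_card_nsmul (K.powersetCard (n + 1)) _ _ fun F hF =>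
      mul_le_mul_of_nonneg_left
        (setIntegral_frob_jacobian_face_le hC hκ hM hK hF (hPd K hK))
        (mul_nonneg hδ.le (by positivity : 0 ≤ 1 + κ))
    refine h1.trans (le_of_eq ?_)
    rw [Finset.card_powersetCard, M.card_eq K hK, Nat.choose_succ_self_right, nsmul_eq_mul]
    push_cast
    rw [hC']
    field_simp
    ring
  rw [Finset.sum_add_distrib, ← Finset.mul_sum] at hfaces
  rw [dgNormSq, sip, intEB_eq, intEB_eq, hJ]
  simp only [Nat.add_sub_cancel] at hfaces ⊢
  linarith

end Triangulation

end

end NSK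

/-! ### The main theorem -/

theorem corollary3p5 (d p : ℕ) (hd : 1 ≤ d) (hd' : d ≤ 3) :
    -- the case without viscosity, with an arbitrary form `B`
    (∀ (Ω : Set (NSK.Space d)), IsOpen Ω → IsConnected Ω → Bornology.IsBounded Ω →
      interior (closure Ω) = Ω →
      ∀ (M : NSK.Triangulation d Ω) (γ : ℝ),
        NSK.IsConsistent M p (M.centralFluxes γ) ∧
        ∀ (W : ℝ → ℝ), ContDiff ℝ 1 W →
        ∀ (B : (NSK.Space d → NSK.Space d) → (NSK.Space d → NSK.Space d) → ℝ)
          (T : ℝ), 0 < T →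
        ∀ (ρ : ℝ → NSK.Space d → ℝ) (v : ℝ → NSK.Space d → NSK.Space d)
          (τ : ℝ → NSK.Space d → ℝ) (q : ℝ → NSK.Space d → NSK.Space d),
          NSK.IsSolution M p (M.centralFluxes γ) W γ 0 B T ρ v τ q →
          ∀ t ∈ Set.Icc 0 T,
            HasDerivWithinAt (fun s => NSK.mass Ω (ρ s)) 0 (Set.Icc 0 T) t ∧
            HasDerivWithinAt (fun s => NSK.energy Ω W γ (ρ s) (v s) (q s)) 0 (Set.Icc 0 T) t) ∧
    -- the viscous case, with the symmetric interior penalty form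
    (∀ κ : ℝ, 0 < κ → ∃ σ₀ : ℝ, 0 < σ₀ ∧ ∃ c : ℝ, 0 < c ∧
      ∀ (Ω : Set (NSK.Space d)), IsOpen Ω → IsConnected Ω → Bornology.IsBounded Ω →
      interior (closure Ω) = Ω →
      ∀ (M : NSK.Triangulation d Ω), M.ShapeRegular κ →
      ∀ σ : ℝ, σ₀ ≤ σ →
        M.IsCoercive p (M.sip σ) c ∧
        ∀ γ : ℝ,
          NSK.IsConsistent M p (M.centralFluxes γ) ∧
          ∀ (μ : ℝ), 0 < μ → ∀ (W : ℝ → ℝ), ContDiff ℝ 1 W → ∀ (T : ℝ), 0 < T →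
          ∀ (ρ : ℝ → NSK.Space d → ℝ) (v : ℝ → NSK.Space d → NSK.Space d)
            (τ : ℝ → NSK.Space d → ℝ) (q : ℝ → NSK.Space d → NSK.Space d),
            NSK.IsSolution M p (M.centralFluxes γ) W γ μ (M.sip σ) T ρ v τ q →
            ∀ t ∈ Set.Icc 0 T,
              HasDerivWithinAt (fun s => NSK.mass Ω (ρ s)) 0 (Set.Icc 0 T) t ∧
              HasDerivWithinAt (fun s => NSK.energy Ω W γ (ρ s) (v s) (q s))
                (-μ * M.sip σ (v t) (v t)) (Set.Icc 0 T) t ∧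
              -μ * M.sip σ (v t) (v t) ≤ 0) := by
  obtain ⟨n, rfl⟩ := Nat.exists_eq_add_of_le' hd
  refine ⟨fun Ω hΩo _ _ hΩ M γ => ⟨M.isConsistent_centralFluxes hΩo hΩ p γ,
    fun W hW B T hT ρ v τ q h t ht => ?_⟩, fun κ hκ => ?_⟩
  · have h1 := NSK.Triangulation.hasDerivWithinAt_mass_energy hΩo hΩ hW hT h ht
    rwa [neg_zero, zero_mul] at h1
  · obtain ⟨σ₀, hσ₀, hcoer⟩ := NSK.Triangulation.exists_isCoercive_sip n p hκ
    refine ⟨σ₀, hσ₀, 1 / 2, by norm_num, fun Ω hΩo _ _ hΩ M hM σ hσ => ?_⟩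
    have hc := hcoer Ω hΩ M hM σ hσ
    refine ⟨hc, fun γ => ⟨M.isConsistent_centralFluxes hΩo hΩ p γ,
      fun μ hμ W hW T hT ρ v τ q h t ht => ?_⟩⟩
    obtain ⟨h1, h2⟩ := NSK.Triangulation.hasDerivWithinAt_mass_energy hΩo hΩ hW hT h ht
    refine ⟨h1, h2, ?_⟩
    -- Coercivity, with the nonnegative energy norm, gives the sign of the dissipation.
    have h3 := hc (v t) (h.v_mem t ht)
    have h4 := M.dgNormSq_nonneg (v t)
    have h5 : 0 ≤ μ * M.sip σ (v t) (v t) := mul_nonneg hμ.le (by linarith)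
    linarith
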